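/- **Setting.** There are $K\ge 1$ agents. Agent $k$ has a space of tasks $\mathcal T_k$ with a probability distribution $\pi_k$; a task $t\in\mathcal T_k$ has a data distribution and a loss $Q_k^{(t)}(w;x)$, $w\in\mathbb R^M$, that is measurable, twice differentiable in $w$ and has finite risks $J_k^{(t)}(w)=\mathbb E_x Q_k^{(t)}(w;x)$ and $J_k(w)=\mathbb E_{t\sim\pi_k}J_k^{(t)}(w)$. For a batch $\mathcal X=(x_1,\dots,x_N)$ put $Q(w;\mathcal X)=\frac1N\sum_n Q(w;x_n)$. Vector norms are Euclidean, matrix norms are spectral. Let $\alpha>0$, let $\mathcal X_{in},\mathcal X_o$ be independent batches of $N_{in},N_o\ge1$ i.i.d. data points of a task, and set $$\widehat J_k(w)=\mathbb E_{t\sim\pi_k}\mathbb E_{\mathcal X_{in}}J_k^{(t)}\big(w-\alpha\nabla Q_k^{(t)}(w;\mathcal X_{in})\big),\qquad \widehat J(w)=\frac1K\sum_{k=1}^K\widehat J_k(w).$$ **Algorithm (Dif-MAML).** Start from deterministic $w_{1,0},\dots,w_{K,0}\in\mathbb R^M$. In iteration $i\ge1$, independently of the other iterations, agent $k$ draws a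 batch $\mathcal S_k$ of $|\mathcal S_k|\ge1$ i.i.d. tasks from $\pi_k$, with fresh batches $\mathcal X_{in}^{(t)},\mathcal X_o^{(t)}$ for each of them, and, with outer step size $\mu>0$, $$\phi_{k,i}=w_{k,i-1}-\frac{\mu}{|\mathcal S_k|}\sum_{t\in\mathcal S_k}\big(I-\alpha\nabla^2Q_k^{(t)}(w_{k,i-1};\mathcal X_{in}^{(t)})\big)\nabla Q_k^{(t)}\big(w_{k,i-1}-\alpha\nabla Q_k^{(t)}(w_{k,i-1};\mathcal X_{in}^{(t)});\mathcal X_o^{(t)}\big),\qquad w_{k,i}=\sum_{\ell=1}^K a_{\ell k}\phi_{\ell,i}.$$ Let $w_{c,i}=\frac1K\sum_k w_{k,i}$ be the network centroid. **Assumptions.** There are constants $L,\rho,B,\sigma_G,\sigma_H,\gamma_G,\gamma_H\ge0$ such that for all $k$, all $t\in\mathcal T_k$ and all $w,u\in\mathbb R^M$: 1. $\|\nabla Q_k^{(t)}(w;x)-\nabla Q_k^{(t)}(u;x)\|\le L^{x}\|w-u\|$ for all data points $x$, with $\mathbb E_x(L^{x})^2\le L^2$; 2. $\mathbb E_x\|\nabla^2Q_k^{(t)}(w;x)-\nabla^2Q_k^{(t)}(u;x)\|\le\rho\|w-u\|$;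 3. $\mathbb E_x\|\nabla Q_k^{(t)}(w;x)\|\le B$; 4. $\mathbb E_x\|\nabla Q_k^{(t)}(w;x)-\nabla J_k^{(t)}(w)\|^4\le\sigma_G^4$ and $\mathbb E_x\|\nabla^2Q_k^{(t)}(w;x)-\nabla^2J_k^{(t)}(w)\|^4\le\sigma_H^4$; 5. $\mathbb E_{t\sim\pi_k}\|\nabla J_k^{(t)}(w)-\nabla J_k(w)\|^4\le\gamma_G^4$ and $\mathbb E_{t\sim\pi_k}\|\nabla^2J_k^{(t)}(w)-\nabla^2J_k(w)\|^4\le\gamma_H^4$; 6. $A=[a_{\ell k}]$ is doubly stochastic with non-negative entries, any two agents are joined by a path with positive weights, and $a_{kk}>0$ for some $k$. **Constants.** $\widehat L=L(1+\alpha L)^2+\alpha\rho B$ and $C^2=\max_k\frac{3}{|\mathcal S_k|}(C_1^2+C_2^2+C_3^2)$ with $$C_1^2=6(1+\alpha L)^2\sigma_G^2\Big(\tfrac1{N_o}+\tfrac{L^2\alpha^2}{N_{in}}\Big)+\tfrac{6\alpha^2\sigma_H^2}{N_{in}}\Big(B^2+\tfrac{\sigma_G^2}{N_o}\Big)+\tfrac{9\alpha^4}{N_{in}^2}(\sigma_H^4+L^4\sigma_G^4),$$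 $$C_2^2=8(1+\alpha L)^2(1+\alpha^2L^2)\gamma_G^2+4B^2\alpha^2\gamma_H^2+2\alpha^4\gamma_H^4+16(1+\alpha^4L^4)\gamma_G^4,$$ $$C_3=(1+\alpha L)\tfrac{\alpha L\sigma_G}{\sqrt{N_{in}}}+(1+\alpha L)^2\gamma_G+\tfrac{B\alpha\sigma_H}{\sqrt{N_{in}}}+B\alpha\gamma_H+\tfrac{\alpha^2\sigma_H^2}{N_{in}}+\alpha^2\gamma_H^2+\tfrac{\alpha^2L^2\sigma_G^2}{N_{in}}+2(1+\alpha^2L^2)\gamma_G^2.$$ **Theorem 2 (Stationary points of the adjusted objective).** Suppose that $\widehat J(w)\ge\widehat J^o$ for all $w$. Then $\widehat J$ is differentiable, and as $\mu\to0$ the centroid $w_{c,i}$ reaches an $O(\mu)$-mean-square-stationary point of $\widehat J$ in at most $O(1/\mu^2)$ iterations: there are $c$ and $\mu_0>0$, independent of $\mu$, such that for every $0<\mu\le\mu_0$ there is an $i\le c/\mu^2$ with $\mathbb E\|\nabla\widehat J(w_{c,i})\|^2\le c\mu$. In particular, for every $0<\mu\le\mu_0$ there is a time instant $i^\star$ such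 that $$\mathbb E\|\nabla\widehat J(w_{c,i^\star})\|^2\le 2\mu\widehat LC^2+c\mu^2$$ and, if $\widehat LC^2>0$, $$i^\star\le\Big(\frac{2(\widehat J(w_{c,0})-\widehat J^o)}{\widehat LC^2}\Big)\frac1{\mu^2}+\frac c\mu .$$ -/

import Mathlib

open MeasureTheory ProbabilityTheory

noncomputable section

/-- The parameter space `ℝ^M` with its Euclidean norm. -/
abbrev Param (M : ℕ) : Type := EuclideanSpace ℝ (Fin M)

/-- The Hessian `∇² f (w)` as a linear operator on `ℝ^M`; its norm is the operator (spectral)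
norm. -/
def hessian {M : ℕ} (f : Param M → ℝ) (w : Param M) : Param M →L[ℝ] Param M :=
  fderiv ℝ (gradient f) w

/-- `𝔼 f ≤ c`, where the expectation is a genuine (finite) one. -/
def ExpectationLE {Ω : Type*} [MeasurableSpace Ω] (μ : Measure Ω) (f : Ω → ℝ) (c : ℝ) : Prop :=
  Integrable f μ ∧ ∫ ω, f ω ∂μ ≤ c

section Agent

/-! ### One agent

The tasks of the agent form a measurable space `T` with task distribution `π`; for a task `t`
the data points (elements of `X`) have the law `D t`; the loss of the parameter `w` at the data
point `x` of task `t` is `Q t w x`. -/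

variable {M : ℕ} {T X : Type*} [MeasurableSpace T] [MeasurableSpace X]

/-- The loss on a batch of data: the average of the losses at its elements. -/
def batchLoss {n : ℕ} (q : Param M → X → ℝ) (x : Fin n → X) (w : Param M) : ℝ :=
  (1 / (n : ℝ)) * ∑ j, q w (x j)

/-- The stochastic risk of a task: `J^{(t)}(w) = 𝔼_x Q^{(t)}(w; x)`. -/
def taskRisk (D : Kernel T X) (Q : T → Param M → X → ℝ) (t : T) (w : Param M) : ℝ :=
  ∫ x, Q t w x ∂(D t)

/-- The mean risk of the agent: `J_k(w) = 𝔼_{t ∼ π} J^{(t)}(w)`. -/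
def meanRisk (π : Measure T) (D : Kernel T X) (Q : T → Param M → X → ℝ) (w : Param M) : ℝ :=
  ∫ t, taskRisk D Q t w ∂π

/-- The task-specific model after one gradient step of size `α` on the data batch `x`. -/
def innerStep (α : ℝ) {n : ℕ} (q : Param M → X → ℝ) (x : Fin n → X) (w : Param M) : Param M :=
  w - α • gradient (batchLoss q x) w

/-- The adjusted objective of the agent, with `n` i.i.d. data points in the inner batch:
`Ĵ_k(w) = 𝔼_{t ∼ π} 𝔼_{𝒳_in} J^{(t)}(w - α ∇Q^{(t)}(w; 𝒳_in))`. -/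
def adjustedObjective (α : ℝ) (n : ℕ) (π : Measure T) (D : Kernel T X)
    (Q : T → Param M → X → ℝ) (w : Param M) : ℝ :=
  ∫ t, ∫ x, taskRisk D Q t (innerStep α (Q t) x w) ∂(Measure.pi fun _ : Fin n => D t) ∂π

/-- The law of `n` i.i.d. data points of a task, as a kernel in the task. -/
def iidKernel (n : ℕ) (D : Kernel T X) [IsMarkovKernel D] : Kernel T (Fin n → X) where
  toFun t := Measure.pi fun _ => D t
  measurable' := by
    refine Measurable.measure_of_isPiSystem_of_isProbabilityMeasure
      generateFrom_pi.symm isPiSystem_pi ?_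
    rintro _ ⟨s, hs, rfl⟩
    simp only [Measure.pi_pi]
    exact Finset.measurable_prod _ fun i _ => D.measurable_coe (hs i (Set.mem_univ i))

instance (n : ℕ) (D : Kernel T X) [IsMarkovKernel D] : IsMarkovKernel (iidKernel n D) :=
  ⟨fun t => by
    change IsProbabilityMeasure (Measure.pi fun _ : Fin n => D t)
    infer_instance⟩

/-- A sampled task with an inner batch of `n` and an outer batch of `m` data points. -/
abbrev TaskSample (T X : Type*) (n m : ℕ) : Type _ := T × (Fin n → X) × (Fin m → X)

/-- The law of a sampled task with its batches: the task has law `π` and, given the task `t`,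
all the `n + m` data points are independent with law `D t`. -/
def taskSampleLaw (n m : ℕ) (π : Measure T) (D : Kernel T X) [IsMarkovKernel D] :
    Measure (TaskSample T X n m) :=
  π ⊗ₘ (iidKernel n D ×ₖ iidKernel m D)

/-- The stochastic meta-gradient `∇Q̄_k(w)` computed from a batch of `b` sampled tasks:
the average over the tasks `t` of
`(I - α ∇²Q^{(t)}(w; 𝒳_in)) ∇Q^{(t)}(w - α ∇Q^{(t)}(w; 𝒳_in); 𝒳_o)`. -/
def metaGradient (α : ℝ) {b n m : ℕ} (Q : T → Param M → X → ℝ)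
    (z : Fin b → TaskSample T X n m) (w : Param M) : Param M :=
  (1 / (b : ℝ)) • ∑ s,
    (ContinuousLinearMap.id ℝ (Param M) - α • hessian (batchLoss (Q (z s).1) (z s).2.1) w)
      (gradient (batchLoss (Q (z s).1) (z s).2.2) (innerStep α (Q (z s).1) (z s).2.1 w))

/-- Standing regularity: the loss is jointly measurable in the task and the data, twice
differentiable in the parameter, and the risks are finite. -/
structure RegularLoss (π : Measure T) (D : Kernel T X) (Q : T → Param M → X → ℝ) : Prop where
  measurable : ∀ w, Measurable fun p : T × X => Q p.1 w p.2
  differentiable : ∀ t x, Differentiable ℝ fun w => Q t w x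
  differentiable_gradient : ∀ t x, Differentiable ℝ (gradient fun w => Q t w x)
  integrable_loss : ∀ t w, Integrable (fun x => Q t w x) (D t)
  integrable_risk : ∀ w, Integrable (fun t => taskRisk D Q t w) π

/-- Lipschitz gradients, with a data-dependent constant whose second moment is at most `L²`. -/
def LipschitzGradients (D : Kernel T X) (Q : T → Param M → X → ℝ) (L : ℝ) : Prop :=
  ∀ t, ∃ ℓ : X → ℝ,
    (∀ x w u, ‖gradient (fun v => Q t v x) w - gradient (fun v => Q t v x) u‖ ≤ ℓ x * ‖w - u‖) ∧
    MemLp ℓ 2 (D t) ∧ ∫ x, ℓ x ^ 2 ∂(D t) ≤ L ^ 2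

/-- Hessians that are Lipschitz in expectation. -/
def LipschitzHessians (D : Kernel T X) (Q : T → Param M → X → ℝ) (ρ : ℝ) : Prop :=
  ∀ t w u, ExpectationLE (D t)
    (fun x => ‖hessian (fun v => Q t v x) w - hessian (fun v => Q t v x) u‖) (ρ * ‖w - u‖)

/-- Gradients that are bounded in expectation. -/
def BoundedGradients (D : Kernel T X) (Q : T → Param M → X → ℝ) (B : ℝ) : Prop :=
  ∀ t w, ExpectationLE (D t) (fun x => ‖gradient (fun v => Q t v x) w‖) B

/-- Bounded fourth central moments of gradients and Hessians with respect to the data. -/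
def BoundedNoiseMoments (D : Kernel T X) (Q : T → Param M → X → ℝ) (σG σH : ℝ) : Prop :=
  ∀ t w,
    ExpectationLE (D t)
      (fun x => ‖gradient (fun v => Q t v x) w - gradient (taskRisk D Q t) w‖ ^ 4) (σG ^ 4) ∧
    ExpectationLE (D t)
      (fun x => ‖hessian (fun v => Q t v x) w - hessian (taskRisk D Q t) w‖ ^ 4) (σH ^ 4)

/-- Bounded fourth central moments of gradients and Hessians with respect to the task. -/
def BoundedTaskVariability (π : Measure T) (D : Kernel T X) (Q : T → Param M → X → ℝ)
    (γG γH : ℝ) : Prop :=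
  ∀ w,
    ExpectationLE π
      (fun t => ‖gradient (taskRisk D Q t) w - gradient (meanRisk π D Q) w‖ ^ 4) (γG ^ 4) ∧
    ExpectationLE π
      (fun t => ‖hessian (taskRisk D Q t) w - hessian (meanRisk π D Q) w‖ ^ 4) (γH ^ 4)

end Agent

/-! ### Constants -/

/-- `L̂ = L (1 + α L)² + α ρ B`. -/
def Lhat (α L ρ B : ℝ) : ℝ := L * (1 + α * L) ^ 2 + α * ρ * B

/-- `C₁²`; `n` and `m` are the sizes of the inner and the outer batch. -/
def C1sq (α L B σG σH : ℝ) (n m : ℕ) : ℝ :=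
  6 * (1 + α * L) ^ 2 * σG ^ 2 * (1 / (m : ℝ) + L ^ 2 * α ^ 2 / (n : ℝ))
    + 6 * α ^ 2 * σH ^ 2 / (n : ℝ) * (B ^ 2 + σG ^ 2 / (m : ℝ))
    + 9 * α ^ 4 / (n : ℝ) ^ 2 * (σH ^ 4 + L ^ 4 * σG ^ 4)

/-- `C₂²`. -/
def C2sq (α L B γG γH : ℝ) : ℝ :=
  8 * (1 + α * L) ^ 2 * (1 + α ^ 2 * L ^ 2) * γG ^ 2 + 4 * B ^ 2 * α ^ 2 * γH ^ 2
    + 2 * α ^ 4 * γH ^ 4 + 16 * (1 + α ^ 4 * L ^ 4) * γG ^ 4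

/-- `C₃`. -/
def C3 (α L B σG σH γG γH : ℝ) (n : ℕ) : ℝ :=
  (1 + α * L) * α * L * (σG / √(n : ℝ)) + (1 + α * L) ^ 2 * γG + B * α * (σH / √(n : ℝ))
    + B * α * γH + α ^ 2 * (σH ^ 2 / (n : ℝ)) + α ^ 2 * γH ^ 2
    + α ^ 2 * L ^ 2 * (σG ^ 2 / (n : ℝ)) + 2 * (1 + α ^ 2 * L ^ 2) * γG ^ 2

/-- The gradient noise constant `C²`: the largest over the agents `k` of
`(3 / |𝒮_k|) (C₁² + C₂² + C₃²)`, where `b k = |𝒮_k|` is the task batch size of agent `k`. -/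
def noiseConst (α L B σG σH γG γH : ℝ) (n m : ℕ) {K : ℕ} (b : Fin K → ℕ) : ℝ :=
  ⨆ k, 3 / (b k : ℝ) *
    (C1sq α L B σG σH n m + C2sq α L B γG γH + C3 α L B σG σH γG γH n ^ 2)

section Network

/-! ### The network -/

variable {K M : ℕ}

/-- The combination matrix is doubly stochastic; any two agents are joined by a path with positive
weights, and some agent has a positive weight on itself. -/
structure CombinationMatrix (A : Matrix (Fin K) (Fin K) ℝ) : Prop where
  doublyStochastic : A ∈ doublyStochastic ℝ (Fin K)
  path : ∀ k l, Relation.ReflTransGen (fun i j => 0 < A i j) k l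
  loop : ∃ k, 0 < A k k

/-- The centroid `(1/K) ∑ₖ wₖ` of the agents' parameters. -/
def centroid (w : Fin K → Param M) : Param M := (1 / (K : ℝ)) • ∑ k, w k

variable {T X : Fin K → Type*} [∀ k, MeasurableSpace (T k)] [∀ k, MeasurableSpace (X k)]

/-- The aggregate adjusted objective `Ĵ(w) = (1/K) ∑ₖ Ĵ_k(w)`. -/
def aggregateObjective (α : ℝ) (n : ℕ) (π : ∀ k, Measure (T k)) (D : ∀ k, Kernel (T k) (X k))
    (Q : ∀ k, T k → Param M → X k → ℝ) (w : Param M) : ℝ :=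
  (1 / (K : ℝ)) * ∑ k, adjustedObjective α n (π k) (D k) (Q k) w

/-- The iterates of Dif-MAML: `φ_{k,i} = w_{k,i-1} - μ ∇Q̄_k(w_{k,i-1})` and
`w_{k,i} = ∑_ℓ a_{ℓk} φ_{ℓ,i}`, started at `w₀`; `z i k` is the batch of tasks with data that
agent `k` samples in the `i`-th iteration, counted from `0`. -/
def difMAML (α μ : ℝ) (A : Matrix (Fin K) (Fin K) ℝ) (Q : ∀ k, T k → Param M → X k → ℝ)
    {b : Fin K → ℕ} {n m : ℕ} (w₀ : Fin K → Param M)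
    (z : ℕ → ∀ k, Fin (b k) → TaskSample (T k) (X k) n m) : ℕ → Fin K → Param M
  | 0 => w₀
  | i + 1 => fun k => ∑ l, A l k •
      (difMAML α μ A Q w₀ z i l - μ • metaGradient α (Q l) (z i l) (difMAML α μ A Q w₀ z i l))

/-- The random samples of the algorithm: the samples of different iterations are independent, and
in each iteration agent `k` draws `b k` i.i.d. tasks with their batches. No relation between the
samples that different agents draw in the same iteration is required. -/
structure IsSampling {Ω : Type*} [MeasurableSpace Ω] (P : Measure Ω) {b : Fin K → ℕ} {n m : ℕ}
    (π : ∀ k, Measure (T k)) (D : ∀ k, Kernel (T k) (X k)) [∀ k, IsMarkovKernel (D k)]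
    (Z : ℕ → Ω → ∀ k, Fin (b k) → TaskSample (T k) (X k) n m) : Prop where
  measurable : ∀ i, Measurable (Z i)
  law : ∀ i k, P.map (fun ω => Z i ω k)
    = Measure.pi fun _ : Fin (b k) => taskSampleLaw n m (π k) (D k)
  indep : iIndepFun Z P

end Network

end

/-! The argument is stochastic gradient descent on a smooth nonconvex function, followed along the
centroid. Three facts feed it.

Unbiasedness. The outer batch is independent of the inner one, so averaging over it turns the outer
gradient into the gradient of the task risk. The chain rule through the inner step (symmetry of the
Hessian removes the adjoint) and differentiation under the integrals then identify the mean of the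
stochastic meta-gradient with the gradient of `adjustedObjective`
(`hasGradientAt_adjustedObjective`). The same formula shows that this gradient is bounded by `B (1 +
α L)` and is `Lhat`-Lipschitz.

Variance. A sample is compared with the batch-free meta-gradient of its task
(`sampleGradient_noise_sq`, giving `C1sq`), and the latter with the meta-gradient of the mean risk
(`exactMetaGradient_variability`, giving `C2sq`). Since the mean minimises the mean square distance,
the variance about the true gradient is at most the mean square distance to this explicit reference
point. No estimate of a bias is required, and `C3` only enlarges the final constant.

Agreement. Connectivity and one loop make some power of `A` entrywise positive, so averaging
contracts the disagreement geometrically (`exists_disagreement_le`). The stochastic gradients have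
bounded second moments, hence the mean square disagreement is `O(r ^ i + μ²)` with `r < 1`.

Double stochasticity makes the centroid move by the average of the local stochastic gradients. The
quadratic upper bound for `F = aggregateObjective` then gives an expected decrease of `(μ/2)
𝔼‖∇F‖²`, up to `(μ/2) Lhat²` times the mean square disagreement and a noise term `(μ²/2) Lhat C²`
(`integral_average_step_le`). Telescoping over `N` iterations produces an index `i < N` with `𝔼‖∇F‖²
≤ 2 (F(w_{c,0}) - Jo) / (N μ) + O(1/N) + O(μ²) + μ Lhat C²`. Taking `N ≈ 1/μ²` gives the first
claim; taking `N` so that the first two terms together are at most `μ Lhat C²` gives the explicit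
constants. -/

open scoped Topology
set_option linter.unusedSectionVars false

/-! ### Second and fourth moments of sums of independent centred vectors. -/

section IndependentSums

variable {Ω E : Type*} [MeasurableSpace Ω] {P : Measure Ω} [IsProbabilityMeasure P]
  [NormedAddCommGroup E] [InnerProductSpace ℝ E] [CompleteSpace E] [SecondCountableTopology E]
  [MeasurableSpace E] [BorelSpace E]

theorem memLp_two_of_memLp_four {X : Ω → E} (h : MemLp X 4 P) : MemLp X 2 P :=
  h.mono_exponent (by norm_num)

theorem integrable_norm_pow_four {X : Ω → E} (h : MemLp X 4 P) :
    Integrable (fun ω => ‖X ω‖ ^ 4) P := by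
  simpa using h.integrable_norm_pow (p := 4) (by norm_num)

theorem integrable_norm_pow_three {X : Ω → E} (h : MemLp X 4 P) :
    Integrable (fun ω => ‖X ω‖ ^ 3) P := by
  simpa using (h.mono_exponent (p := 3) (by norm_num)).integrable_norm_pow (p := 3) (by norm_num)

theorem integrable_norm_sq {X : Ω → E} (h : MemLp X 2 P) :
    Integrable (fun ω => ‖X ω‖ ^ 2) P := by
  simpa using h.integrable_norm_pow (p := 2) (by norm_num)

theorem integral_inner_eq_zero_of_indepFun {X Y : Ω → E} (hXY : IndepFun X Y P)
    (hX : Integrable X P) (hY : Integrable Y P) (h : ∫ ω, Y ω ∂P = 0) :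
    ∫ ω, inner ℝ (X ω) (Y ω) ∂P = 0 := by
  have := hXY.integral_bilin hX hY (innerSL ℝ)
  exact this.trans (by rw [h]; simp)

theorem integral_inner_eq_zero_of_indepFun' {X Y : Ω → E} (hXY : IndepFun X Y P)
    (hX : Integrable X P) (hY : Integrable Y P) (h : ∫ ω, X ω ∂P = 0) :
    ∫ ω, inner ℝ (X ω) (Y ω) ∂P = 0 := by
  have := hXY.integral_bilin hX hY (innerSL ℝ)
  exact this.trans (by rw [h]; simp)

theorem integral_norm_add_sq_of_indepFun {X Y : Ω → E} (hXY : IndepFun X Y P)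
    (hX : MemLp X 2 P) (hY : MemLp Y 2 P) (h : ∫ ω, Y ω ∂P = 0) :
    ∫ ω, ‖X ω + Y ω‖ ^ 2 ∂P = ∫ ω, ‖X ω‖ ^ 2 ∂P + ∫ ω, ‖Y ω‖ ^ 2 ∂P := by
  have hX1 := hX.integrable (by norm_num)
  have hY1 := hY.integrable (by norm_num)
  have hc := integral_inner_eq_zero_of_indepFun hXY hX1 hY1 h
  have hi : Integrable (fun ω => inner ℝ (X ω) (Y ω)) P :=
    hXY.integrable_bilin hX1 hY1 (innerSL ℝ)
  simp_rw [norm_add_sq_real]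
  rw [integral_add ((integrable_norm_sq hX).fun_add (hi.const_mul 2)) (integrable_norm_sq hY),
    integral_add (integrable_norm_sq hX) (hi.const_mul 2), integral_const_mul, hc]
  ring

/-- In the expansion of `(‖X‖² + 2⟨X, Y⟩ + ‖Y‖²)²` the terms linear in `X` or in `Y` have mean zero
by independence. Cauchy–Schwarz on `4⟨X, Y⟩²` brings the coefficient of the mixed term to `2 + 4 =
6`. -/
theorem integral_norm_add_pow_four_le_of_indepFun {X Y : Ω → E} (hXY : IndepFun X Y P)
    (hX : MemLp X 4 P) (hY : MemLp Y 4 P) (hX0 : ∫ ω, X ω ∂P = 0) (hY0 : ∫ ω, Y ω ∂P = 0) :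
    ∫ ω, ‖X ω + Y ω‖ ^ 4 ∂P ≤ ∫ ω, ‖X ω‖ ^ 4 ∂P
      + 6 * ((∫ ω, ‖X ω‖ ^ 2 ∂P) * ∫ ω, ‖Y ω‖ ^ 2 ∂P) + ∫ ω, ‖Y ω‖ ^ 4 ∂P := by
  have hX2 := memLp_two_of_memLp_four hX
  have hY2 := memLp_two_of_memLp_four hY
  have hX1 := hX2.integrable (by norm_num)
  have hY1 := hY2.integrable (by norm_num)
  have hcube : ∀ {Z : Ω → E}, MemLp Z 4 P → Integrable (fun ω => ‖Z ω‖ ^ 2 • Z ω) P := by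
    intro Z hZ
    refine (integrable_norm_pow_three hZ).mono (by have := hZ.1; fun_prop) (ae_of_all _ fun ω => ?_)
    rw [norm_smul]
    simp only [norm_pow, norm_norm]
    exact le_of_eq (by ring)
  have mcube : Measurable fun e : E => ‖e‖ ^ 2 • e := by fun_prop
  have i1 : ∫ ω, inner ℝ (‖X ω‖ ^ 2 • X ω) (Y ω) ∂P = 0 :=
    integral_inner_eq_zero_of_indepFun (hXY.comp mcube measurable_id) (hcube hX) hY1 hY0
  have i2 : ∫ ω, inner ℝ (X ω) (‖Y ω‖ ^ 2 • Y ω) ∂P = 0 :=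
    integral_inner_eq_zero_of_indepFun' (hXY.comp measurable_id mcube) hX1 (hcube hY) hX0
  have I1 : Integrable (fun ω => inner ℝ (‖X ω‖ ^ 2 • X ω) (Y ω)) P :=
    (hXY.comp mcube measurable_id).integrable_bilin (hcube hX) hY1 (innerSL ℝ)
  have I2 : Integrable (fun ω => inner ℝ (X ω) (‖Y ω‖ ^ 2 • Y ω)) P :=
    (hXY.comp measurable_id mcube).integrable_bilin hX1 (hcube hY) (innerSL ℝ)
  have msq : Measurable fun e : E => ‖e‖ ^ 2 := by fun_prop
  have hsq : IndepFun (fun ω => ‖X ω‖ ^ 2) (fun ω => ‖Y ω‖ ^ 2) P := hXY.comp msq msq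
  have I3 : Integrable (fun ω => ‖X ω‖ ^ 2 * ‖Y ω‖ ^ 2) P :=
    hsq.integrable_mul (integrable_norm_sq hX2) (integrable_norm_sq hY2)
  have i3 : ∫ ω, ‖X ω‖ ^ 2 * ‖Y ω‖ ^ 2 ∂P = (∫ ω, ‖X ω‖ ^ 2 ∂P) * ∫ ω, ‖Y ω‖ ^ 2 ∂P :=
    hsq.integral_fun_mul_eq_mul_integral (integrable_norm_sq hX2).1 (integrable_norm_sq hY2).1
  have I4 := integrable_norm_pow_four hX
  have I5 := integrable_norm_pow_four hY
  calc ∫ ω, ‖X ω + Y ω‖ ^ 4 ∂P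
      ≤ ∫ ω, (‖X ω‖ ^ 4 + 6 * (‖X ω‖ ^ 2 * ‖Y ω‖ ^ 2) + ‖Y ω‖ ^ 4
          + 4 * inner ℝ (‖X ω‖ ^ 2 • X ω) (Y ω) + 4 * inner ℝ (X ω) (‖Y ω‖ ^ 2 • Y ω)) ∂P := by
        refine integral_mono (integrable_norm_pow_four (hX.add hY))
          ((((I4.add (I3.const_mul 6)).add I5).add (I1.const_mul 4)).add (I2.const_mul 4))
          fun ω => ?_
        have h1 : ‖X ω + Y ω‖ ^ 4 = (‖X ω‖ ^ 2 + 2 * inner ℝ (X ω) (Y ω) + ‖Y ω‖ ^ 2) ^ 2 := by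
          rw [← norm_add_sq_real]; ring
        have h2 : (inner ℝ (X ω) (Y ω)) ^ 2 ≤ ‖X ω‖ ^ 2 * ‖Y ω‖ ^ 2 := by
          rw [← mul_pow, ← sq_abs]
          exact pow_le_pow_left₀ (abs_nonneg _) (abs_real_inner_le_norm _ _) 2
        simp only [inner_smul_left, inner_smul_right, RCLike.conj_to_real]
        rw [h1]
        nlinarith
    _ = _ := by
        rw [integral_add ((((I4.fun_add (I3.const_mul 6)).fun_add I5).fun_add (I1.const_mul 4)))
            (I2.const_mul 4),
          integral_add ((I4.fun_add (I3.const_mul 6)).fun_add I5) (I1.const_mul 4),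
          integral_add (I4.fun_add (I3.const_mul 6)) I5, integral_add I4 (I3.const_mul 6)]
        simp only [integral_const_mul, i1, i2, i3]
        ring

variable {ι : Type*} {ξ : ι → Ω → E}

theorem indepFun_sum_of_notMem (hind : iIndepFun ξ P) (hm : ∀ i, Measurable (ξ i))
    {s : Finset ι} {i : ι} (hi : i ∉ s) : IndepFun (fun ω => ∑ j ∈ s, ξ j ω) (ξ i) P := by
  have := hind.indepFun_finsetSum_of_notMem hm hi
  convert this using 1
  ext ω; simp

theorem integral_norm_sum_sq_le_of_iIndepFun (hind : iIndepFun ξ P) (hm : ∀ i, Measurable (ξ i))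
    (hL : ∀ i, MemLp (ξ i) 2 P) (h0 : ∀ i, ∫ ω, ξ i ω ∂P = 0) {τ : ℝ}
    (hτ : ∀ i, ∫ ω, ‖ξ i ω‖ ^ 2 ∂P ≤ τ) (s : Finset ι) :
    ∫ ω, ‖∑ i ∈ s, ξ i ω‖ ^ 2 ∂P ≤ s.card * τ := by
  classical
  induction s using Finset.induction_on with
  | empty => simp
  | insert i s hi ih =>
    have h := integral_norm_add_sq_of_indepFun (indepFun_sum_of_notMem hind hm hi)
      (memLp_finsetSum s fun j _ => hL j) (hL i) (h0 i)
    simp_rw [Finset.sum_insert hi, add_comm (ξ i _)]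
    rw [h, Finset.card_insert_of_notMem hi]
    push_cast
    linarith [hτ i]

/-- A further summand adds at most `6 s τ² + τ²`, which fits into `3 (s + 1)² τ² - 3 s² τ²`. The
growth `s²` instead of `s⁴` is what gives the fourth moment of a mean its factor `1 / n²`. -/
theorem integral_norm_sum_pow_four_le_of_iIndepFun (hind : iIndepFun ξ P)
    (hm : ∀ i, Measurable (ξ i)) (hL : ∀ i, MemLp (ξ i) 4 P) (h0 : ∀ i, ∫ ω, ξ i ω ∂P = 0)
    {τ : ℝ} (hτ0 : 0 ≤ τ) (hτ : ∀ i, ∫ ω, ‖ξ i ω‖ ^ 2 ∂P ≤ τ)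
    (hτ4 : ∀ i, ∫ ω, ‖ξ i ω‖ ^ 4 ∂P ≤ τ ^ 2) (s : Finset ι) :
    ∫ ω, ‖∑ i ∈ s, ξ i ω‖ ^ 4 ∂P ≤ 3 * s.card ^ 2 * τ ^ 2 := by
  classical
  induction s using Finset.induction_on with
  | empty => simp
  | insert i s hi ih =>
    have h0s : ∫ ω, ∑ j ∈ s, ξ j ω ∂P = 0 := by
      rw [integral_finsetSum _ fun j _ => (hL j).integrable (by norm_num)]
      exact Finset.sum_eq_zero fun j _ => h0 j
    have h := integral_norm_add_pow_four_le_of_indepFun (indepFun_sum_of_notMem hind hm hi)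
      (memLp_finsetSum s fun j _ => hL j) (hL i) h0s (h0 i)
    have h2 := integral_norm_sum_sq_le_of_iIndepFun hind hm
      (fun j => memLp_two_of_memLp_four (hL j)) h0 hτ s
    simp_rw [Finset.sum_insert hi, add_comm (ξ i _)]
    rw [Finset.card_insert_of_notMem hi]
    push_cast
    have h3 : (∫ ω, ‖∑ j ∈ s, ξ j ω‖ ^ 2 ∂P) * ∫ ω, ‖ξ i ω‖ ^ 2 ∂P ≤ s.card * τ * τ :=
      mul_le_mul h2 (hτ i) (integral_nonneg fun ω => by positivity) (by positivity)
    nlinarith [hτ4 i, sq_nonneg τ]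

end IndependentSums

/-! ### Moments of empirical means of i.i.d. data. -/

section EmpiricalMean

variable {X E : Type*} [MeasurableSpace X] {ν : Measure X} [IsProbabilityMeasure ν]
  [NormedAddCommGroup E] [InnerProductSpace ℝ E] [CompleteSpace E] [SecondCountableTopology E]
  [MeasurableSpace E] [BorelSpace E]

theorem sq_integral_le_integral_sq {f : X → ℝ} (h : MemLp f 2 ν) :
    (∫ x, f x ∂ν) ^ 2 ≤ ∫ x, f x ^ 2 ∂ν := by
  have h0 : 0 ≤ Var[f; ν] := variance_nonneg f ν
  rw [variance_eq_sub h] at h0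
  simp only [Pi.pow_apply] at h0
  linarith

theorem integral_norm_sq_le_of_pow_four {f : X → E} (h : MemLp f 4 ν) {τ : ℝ} (hτ0 : 0 ≤ τ)
    (hτ : ∫ x, ‖f x‖ ^ 4 ∂ν ≤ τ ^ 2) : ∫ x, ‖f x‖ ^ 2 ∂ν ≤ τ := by
  have h2 : MemLp (fun x => ‖f x‖ ^ 2) 2 ν := by
    rw [memLp_two_iff_integrable_sq (by have := h.1; fun_prop)]
    simpa [← pow_mul] using integrable_norm_pow_four h
  have := sq_integral_le_integral_sq h2
  simp only [← pow_mul] at this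
  exact le_of_abs_le (abs_le_of_sq_le_sq (this.trans hτ) hτ0)

theorem memLp_comp_eval {n : ℕ} {f : X → E} {p : ENNReal} (hf : MemLp f p ν) (j : Fin n) :
    MemLp (fun x : Fin n → X => f (x j)) p (Measure.pi fun _ : Fin n => ν) :=
  hf.comp_measurePreserving (measurePreserving_eval (fun _ : Fin n => ν) j)

theorem integral_comp_eval_pi {F : Type*} [NormedAddCommGroup F] [NormedSpace ℝ F] {n : ℕ}
    {f : X → F} (hf : AEStronglyMeasurable f ν) (j : Fin n) :
    ∫ x, f (x j) ∂(Measure.pi fun _ : Fin n => ν) = ∫ x, f x ∂ν := by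
  have h := measurePreserving_eval (fun _ : Fin n => ν) j
  have h' := integral_map (φ := Function.eval j) (μ := Measure.pi fun _ : Fin n => ν)
    h.measurable.aemeasurable (f := f) (by rw [h.map_eq]; exact hf)
  rw [h.map_eq] at h'
  exact h'.symm

theorem memLp_mean {n : ℕ} {f : X → E} {p : ENNReal} (hf : MemLp f p ν) :
    MemLp (fun x : Fin n → X => (1 / (n : ℝ)) • ∑ j, f (x j)) p (Measure.pi fun _ : Fin n => ν) :=
  (memLp_finsetSum Finset.univ fun j _ => memLp_comp_eval hf j).const_smul (1 / (n : ℝ))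

theorem iIndepFun_comp_eval {n : ℕ} {f : X → E} (hm : Measurable f) :
    iIndepFun (fun (j : Fin n) (x : Fin n → X) => f (x j)) (Measure.pi fun _ : Fin n => ν) :=
  iIndepFun_pi (X := fun _ => f) fun _ => hm.aemeasurable

theorem integral_norm_mean_sq_le {n : ℕ} (hn : 0 < n) {f : X → E} (hm : Measurable f)
    (hf : MemLp f 2 ν) (h0 : ∫ x, f x ∂ν = 0) {τ : ℝ} (hτ : ∫ x, ‖f x‖ ^ 2 ∂ν ≤ τ) :
    ∫ x, ‖(1 / (n : ℝ)) • ∑ j, f (x j)‖ ^ 2 ∂(Measure.pi fun _ : Fin n => ν) ≤ τ / n := by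
  have hn' : (0 : ℝ) < n := by exact_mod_cast hn
  have h := integral_norm_sum_sq_le_of_iIndepFun (iIndepFun_comp_eval (ν := ν) (n := n) hm)
    (fun j => hm.comp (measurable_pi_apply j)) (fun j => memLp_comp_eval hf j)
    (fun j => by rw [integral_comp_eval_pi hf.1, h0]) (τ := τ)
    (fun j => by
      rw [integral_comp_eval_pi (f := fun x => ‖f x‖ ^ 2) (by fun_prop)]; exact hτ) Finset.univ
  simp only [norm_smul, mul_pow, integral_const_mul]
  rw [Finset.card_univ, Fintype.card_fin] at h
  calc _ ≤ ‖1 / (n : ℝ)‖ ^ 2 * (n * τ) := by gcongr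
    _ = τ / n := by rw [Real.norm_of_nonneg (by positivity)]; field_simp

theorem integral_norm_mean_pow_four_le {n : ℕ} (hn : 0 < n) {f : X → E} (hm : Measurable f)
    (hf : MemLp f 4 ν) (h0 : ∫ x, f x ∂ν = 0) {τ : ℝ} (hτ0 : 0 ≤ τ)
    (hτ : ∫ x, ‖f x‖ ^ 4 ∂ν ≤ τ ^ 2) :
    ∫ x, ‖(1 / (n : ℝ)) • ∑ j, f (x j)‖ ^ 4 ∂(Measure.pi fun _ : Fin n => ν)
      ≤ 3 * τ ^ 2 / n ^ 2 := by
  have hn' : (0 : ℝ) < n := by exact_mod_cast hn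
  have h := integral_norm_sum_pow_four_le_of_iIndepFun (iIndepFun_comp_eval (ν := ν) (n := n) hm)
    (fun j => hm.comp (measurable_pi_apply j)) (fun j => memLp_comp_eval hf j)
    (fun j => by rw [integral_comp_eval_pi hf.1, h0]) hτ0
    (fun j => by
      rw [integral_comp_eval_pi (f := fun x => ‖f x‖ ^ 2) (by fun_prop)]
      exact integral_norm_sq_le_of_pow_four hf hτ0 hτ)
    (fun j => by
      rw [integral_comp_eval_pi (f := fun x => ‖f x‖ ^ 4) (by fun_prop)]; exact hτ) Finset.univ
  simp only [norm_smul, mul_pow, integral_const_mul]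
  rw [Finset.card_univ, Fintype.card_fin] at h
  calc _ ≤ ‖1 / (n : ℝ)‖ ^ 4 * (3 * n ^ 2 * τ ^ 2) := by gcongr
    _ = 3 * τ ^ 2 / n ^ 2 := by rw [Real.norm_of_nonneg (by positivity)]; field_simp

end EmpiricalMean

/-! ### Gradients, Hessians and the quadratic upper bound. -/

section Calculus

variable {M : ℕ}

/-- Through the Riesz isomorphism the Hessian is the second Fréchet derivative, which is symmetric
as soon as it exists; its continuity is not needed. -/
theorem hessian_symmetric {f : Param M → ℝ} (hf : Differentiable ℝ f)
    (hg : Differentiable ℝ (gradient f)) (w u v : Param M) :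
    inner ℝ (hessian f w u) v = inner ℝ u (hessian f w v) := by
  have h1 : HasFDerivAt (fderiv ℝ f)
      ((InnerProductSpace.toDual ℝ (Param M)).toContinuousLinearEquiv.toContinuousLinearMap ∘L
        hessian f w) w := by
    have h := ((InnerProductSpace.toDual ℝ (Param M)).toContinuousLinearEquiv.hasFDerivAt
      (x := gradient f w)).comp w (hg w).hasFDerivAt
    have he : (fderiv ℝ f) = (fun x => (InnerProductSpace.toDual ℝ (Param M)) (gradient f x)) := by
      ext1 x; rw [toDual_gradient]
    rw [he]
    exact h
  have h2 := second_derivative_symmetric (fun y => (hf y).hasFDerivAt) h1 u v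
  have h3 : inner ℝ (hessian f w u) v = inner ℝ (hessian f w v) u := h2
  rw [h3, real_inner_comm]

theorem norm_hessian_le {f : Param M → ℝ} {ℓ : ℝ} (hℓ : 0 ≤ ℓ)
    (h : ∀ w u, ‖gradient f w - gradient f u‖ ≤ ℓ * ‖w - u‖) (w : Param M) :
    ‖hessian f w‖ ≤ ℓ :=
  norm_fderiv_le_of_lip' ℝ hℓ (Filter.Eventually.of_forall fun u => h u w)

theorem norm_gradient {f : Param M → ℝ} (w : Param M) : ‖gradient f w‖ = ‖fderiv ℝ f w‖ := by
  simp [gradient]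

/-- Differentiability is not needed: where it fails, the gradient is `0` by convention. -/
theorem norm_gradient_le_of_lipschitz {f : Param M → ℝ} {c : ℝ} (hc : 0 ≤ c)
    (h : ∀ w u, |f w - f u| ≤ c * ‖w - u‖) (w : Param M) : ‖gradient f w‖ ≤ c := by
  rw [norm_gradient]
  exact norm_fderiv_le_of_lip' ℝ hc (Filter.Eventually.of_forall fun u => h u w)

theorem abs_sub_le_of_norm_gradient_le {f : Param M → ℝ} {c : ℝ} (hf : Differentiable ℝ f)
    (h : ∀ w, ‖gradient f w‖ ≤ c) (w u : Param M) : |f w - f u| ≤ c * ‖w - u‖ :=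
  (convex_univ).norm_image_sub_le_of_norm_fderiv_le (𝕜 := ℝ) (fun x _ => hf x)
    (fun x _ => by rw [← norm_gradient]; exact h x) (Set.mem_univ u) (Set.mem_univ w)

/-- The quadratic upper bound for a function with a Lipschitz gradient. -/
theorem le_add_inner_gradient_add_sq {f : Param M → ℝ} {Λ : ℝ} (hf : Differentiable ℝ f)
    (h : ∀ w u, ‖gradient f w - gradient f u‖ ≤ Λ * ‖w - u‖) (x y : Param M) :
    f y ≤ f x + inner ℝ (gradient f x) (y - x) + Λ / 2 * ‖y - x‖ ^ 2 := by
  set v := y - x with hv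
  -- `φ` is `f` along the segment minus the linear and quadratic terms of the bound; the Lipschitz
  -- condition makes its derivative nonpositive.
  let φ : ℝ → ℝ := fun s => f (x + s • v) - s * inner ℝ (gradient f x) v - Λ / 2 * s ^ 2 * ‖v‖ ^ 2
  have hφ : ∀ s, HasDerivAt φ (inner ℝ (gradient f (x + s • v)) v - inner ℝ (gradient f x) v
      - Λ * s * ‖v‖ ^ 2) s := by
    intro s
    have h1 : HasDerivAt (fun s : ℝ => x + s • v) v s := by
      simpa using ((hasDerivAt_id s).smul_const v).const_add x
    have h2 := (hf (x + s • v)).hasFDerivAt.comp_hasDerivAt s h1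
    rw [← inner_gradient_left] at h2
    have h3 : HasDerivAt (fun s : ℝ => s * inner ℝ (gradient f x) v) (inner ℝ (gradient f x) v) s := by
      simpa using (hasDerivAt_id s).mul_const (inner ℝ (gradient f x) v)
    have h4 : HasDerivAt (fun s : ℝ => Λ / 2 * s ^ 2 * ‖v‖ ^ 2) (Λ * s * ‖v‖ ^ 2) s := by
      refine (((hasDerivAt_pow 2 s).const_mul (Λ / 2)).mul_const (‖v‖ ^ 2)).congr_deriv ?_
      push_cast; ring
    exact (h2.sub h3).sub h4
  have hanti : AntitoneOn φ (Set.Icc 0 1) := by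
    refine antitoneOn_of_deriv_nonpos (convex_Icc 0 1)
      (fun s _ => (hφ s).continuousAt.continuousWithinAt)
      (fun s _ => (hφ s).differentiableAt.differentiableWithinAt) fun s hs => ?_
    rw [interior_Icc] at hs
    rw [(hφ s).deriv, ← inner_sub_left]
    have h1 := h (x + s • v) x
    rw [add_sub_cancel_left, norm_smul, Real.norm_of_nonneg hs.1.le] at h1
    have h2 := real_inner_le_norm (gradient f (x + s • v) - gradient f x) v
    nlinarith [norm_nonneg v, mul_le_mul_of_nonneg_right h1 (norm_nonneg v)]
  have h01 := hanti (Set.left_mem_Icc.2 zero_le_one) (Set.right_mem_Icc.2 zero_le_one) zero_le_one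
  have hy : x + v = y := by rw [hv]; abel
  simp only [φ, one_smul, zero_smul, hy, add_zero] at h01
  linarith

end Calculus

/-! ### Derivatives of a batch loss. -/

section BatchLoss

variable {M : ℕ} {X : Type*} {q : Param M → X → ℝ}

theorem hasGradientAt_batchLoss (hq : ∀ x, Differentiable ℝ fun w => q w x) {n : ℕ}
    (x : Fin n → X) (w : Param M) :
    HasGradientAt (batchLoss q x) ((1 / (n : ℝ)) • ∑ j, gradient (fun v => q v (x j)) w) w := by
  rw [hasGradientAt_iff_hasFDerivAt]
  have h := (HasFDerivAt.fun_sum (u := Finset.univ) fun (j : Fin n) _ =>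
    (hq (x j) w).hasGradientAt.hasFDerivAt).const_mul (1 / (n : ℝ))
  refine h.congr_fderiv ?_
  rw [map_smul, map_sum]

theorem gradient_batchLoss (hq : ∀ x, Differentiable ℝ fun w => q w x) {n : ℕ}
    (x : Fin n → X) :
    gradient (batchLoss q x) = fun w => (1 / (n : ℝ)) • ∑ j, gradient (fun v => q v (x j)) w :=
  funext fun w => (hasGradientAt_batchLoss hq x w).gradient

theorem differentiable_gradient_batchLoss (hq : ∀ x, Differentiable ℝ fun w => q w x)
    (hg : ∀ x, Differentiable ℝ (gradient fun w => q w x)) {n : ℕ} (x : Fin n → X) :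
    Differentiable ℝ (gradient (batchLoss q x)) := by
  rw [gradient_batchLoss hq]
  exact (Differentiable.fun_sum fun (j : Fin n) _ => hg (x j)).const_smul (1 / (n : ℝ))

theorem hessian_batchLoss (hq : ∀ x, Differentiable ℝ fun w => q w x)
    (hg : ∀ x, Differentiable ℝ (gradient fun w => q w x)) {n : ℕ} (x : Fin n → X) (w : Param M) :
    hessian (batchLoss q x) w = (1 / (n : ℝ)) • ∑ j, hessian (fun v => q v (x j)) w := by
  unfold hessian
  rw [gradient_batchLoss hq]
  exact ((HasFDerivAt.fun_sum (u := Finset.univ) fun (j : Fin n) _ =>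
    (hg (x j) w).hasFDerivAt).const_smul (1 / (n : ℝ))).fderiv

end BatchLoss

/-! ### Joint measurability of derivatives in the parameter and the data. -/

section Measurability

variable {M : ℕ} {Y : Type*} [MeasurableSpace Y]

/-- Measurability of derivatives is not an assumption: a directional derivative is the limit of
difference quotients with steps `1/k`, which are jointly measurable. -/
theorem measurable_fderiv_apply {F : Type*} [NormedAddCommGroup F] [NormedSpace ℝ F]
    [MeasurableSpace F] [BorelSpace F] [SecondCountableTopology F] {f : Param M → Y → F}
    (hm : Measurable (Function.uncurry f)) (hd : ∀ y, Differentiable ℝ fun w => f w y)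
    (v : Param M) : Measurable fun p : Param M × Y => fderiv ℝ (fun w => f w p.2) p.1 v := by
  refine measurable_of_tendsto_metrizable (f := fun (k : ℕ) (p : Param M × Y) =>
    (k : ℝ) • (f (p.1 + (k : ℝ)⁻¹ • v) p.2 - f p.1 p.2)) (fun k => ?_) ?_
  · have h1 : Measurable fun p : Param M × Y => f (p.1 + (k : ℝ)⁻¹ • v) p.2 :=
      hm.comp (f := fun p : Param M × Y => (p.1 + (k : ℝ)⁻¹ • v, p.2)) (by fun_prop)
    have h2 : Measurable fun p : Param M × Y => f p.1 p.2 := hm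
    exact (h1.sub h2).const_smul _
  · rw [tendsto_pi_nhds]
    intro p
    exact ((hd p.2 p.1).hasFDerivAt.lim_real v).comp tendsto_natCast_atTop_atTop

theorem measurable_fderiv_param {F : Type*} [NormedAddCommGroup F] [NormedSpace ℝ F]
    [MeasurableSpace F] [BorelSpace F] [SecondCountableTopology F] {f : Param M → Y → F}
    (hm : Measurable (Function.uncurry f)) (hd : ∀ y, Differentiable ℝ fun w => f w y) :
    Measurable fun p : Param M × Y => fderiv ℝ (fun w => f w p.2) p.1 := by
  -- A linear map on `ℝ^M` is a finite combination of its values on the standard basis, so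
  -- directional derivatives suffice.
  have he : ∀ A : Param M →L[ℝ] F, A = ∑ i, ContinuousLinearMap.smulRightL ℝ (Param M) F
      (EuclideanSpace.proj i) (A (EuclideanSpace.single i 1)) := by
    intro A
    ext v
    conv_lhs => rw [← (EuclideanSpace.basisFun (Fin M) ℝ).sum_repr v]
    simp [map_sum]
  rw [show (fun p : Param M × Y => fderiv ℝ (fun w => f w p.2) p.1) = _ from
    funext fun p => he (fderiv ℝ (fun w => f w p.2) p.1)]
  refine Finset.measurable_sum _ fun i _ => ?_
  exact (ContinuousLinearMap.continuous _).measurable.comp (measurable_fderiv_apply hm hd _)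

variable {q : Param M → Y → ℝ}

/-- A Carathéodory function: continuous in the parameter and measurable in the data. -/
theorem measurable_uncurry_loss (hm : ∀ w, Measurable (q w))
    (hq : ∀ y, Differentiable ℝ fun w => q w y) : Measurable (Function.uncurry q) :=
  measurable_uncurry_of_continuous_of_measurable (fun y => (hq y).continuous) hm

theorem measurable_gradient_param (hm : ∀ w, Measurable (q w))
    (hq : ∀ y, Differentiable ℝ fun w => q w y) :
    Measurable fun p : Param M × Y => gradient (fun w => q w p.2) p.1 :=
  (LinearIsometryEquiv.continuous _).measurable.comp
    (measurable_fderiv_param (measurable_uncurry_loss hm hq) hq)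

theorem measurable_hessian_param (hm : ∀ w, Measurable (q w))
    (hq : ∀ y, Differentiable ℝ fun w => q w y)
    (hg : ∀ y, Differentiable ℝ (gradient fun w => q w y)) :
    Measurable fun p : Param M × Y => hessian (fun w => q w p.2) p.1 :=
  measurable_fderiv_param (f := fun w y => gradient (fun v => q v y) w)
    (measurable_gradient_param hm hq) hg

end Measurability

/-! ### Calculus of bounded expectations and scalar moment inequalities. -/

section Expectation

variable {Ω : Type*} [MeasurableSpace Ω] {μ : Measure Ω} {f g : Ω → ℝ} {a c : ℝ}

/-- Domination supplies integrability along with the bound, so later estimates reduce to pointwise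
inequalities between integrable quantities. -/
theorem ExpectationLE.mono (hg : ExpectationLE μ g c) (hf : AEStronglyMeasurable f μ)
    (h0 : ∀ ω, 0 ≤ f ω) (h : ∀ ω, f ω ≤ g ω) : ExpectationLE μ f c := by
  have hi : Integrable f μ := hg.1.mono' hf (ae_of_all _ fun ω => by
    rw [Real.norm_of_nonneg (h0 ω)]; exact h ω)
  exact ⟨hi, (integral_mono hi hg.1 h).trans hg.2⟩

theorem ExpectationLE.trans (hf : ExpectationLE μ f a) (h : a ≤ c) : ExpectationLE μ f c :=
  ⟨hf.1, hf.2.trans h⟩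

theorem ExpectationLE.add (hf : ExpectationLE μ f a) (hg : ExpectationLE μ g c) :
    ExpectationLE μ (fun ω => f ω + g ω) (a + c) :=
  ⟨hf.1.add hg.1, by rw [integral_add hf.1 hg.1]; exact add_le_add hf.2 hg.2⟩

theorem ExpectationLE.const_mul (hf : ExpectationLE μ f a) (hc : 0 ≤ c) :
    ExpectationLE μ (fun ω => c * f ω) (c * a) :=
  ⟨hf.1.const_mul c, by rw [integral_const_mul]; exact mul_le_mul_of_nonneg_left hf.2 hc⟩

end Expectation

section MomentTools

variable {X E : Type*} [MeasurableSpace X] {ν : Measure X} [IsProbabilityMeasure ν]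
  [NormedAddCommGroup E]

theorem memLp_four_of_integrable {f : X → E} (hm : AEStronglyMeasurable f ν)
    (h : Integrable (fun x => ‖f x‖ ^ 4) ν) : MemLp f 4 ν := by
  have h' : (4 : ENNReal) = ((4 : ℕ) : ENNReal) := by norm_num
  rw [← integrable_norm_rpow_iff hm (by norm_num) (by norm_num)]
  simpa using h

theorem pow_four_integral_le {f : X → ℝ} (h : MemLp f 4 ν) :
    (∫ x, f x ∂ν) ^ 4 ≤ ∫ x, f x ^ 4 ∂ν := by
  have h2 : MemLp f 2 ν := h.mono_exponent (by norm_num)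
  have h4 : Integrable (fun x => ‖f x‖ ^ 4) ν := by
    simpa using h.integrable_norm_pow (p := 4) (by norm_num)
  have hsq : MemLp (fun x => f x ^ 2) 2 ν := by
    rw [memLp_two_iff_integrable_sq (by have := h.1; fun_prop)]
    refine h4.congr (ae_of_all _ fun x => ?_)
    simp only [Real.norm_eq_abs, ← pow_mul, Even.pow_abs (show Even 4 by decide)]
  have e1 := sq_integral_le_integral_sq h2
  have e2 := sq_integral_le_integral_sq hsq
  simp only [← pow_mul] at e2
  calc (∫ x, f x ∂ν) ^ 4 = ((∫ x, f x ∂ν) ^ 2) ^ 2 := by ring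
    _ ≤ (∫ x, f x ^ 2 ∂ν) ^ 2 := pow_le_pow_left₀ (sq_nonneg _) e1 2
    _ ≤ _ := e2

/-- `16 = 8 + 8`: one uses `(a - e)⁴ ≤ 8 a⁴ + 8 e⁴`, and by Jensen `e⁴` is at most the fourth
moment. -/
theorem integral_sub_mean_pow_four_le {f : X → ℝ} (h : MemLp f 4 ν) :
    ∫ x, (f x - ∫ y, f y ∂ν) ^ 4 ∂ν ≤ 16 * ∫ x, f x ^ 4 ∂ν := by
  have even4 : ∀ r : ℝ, ‖r‖ ^ 4 = r ^ 4 := fun r => by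
    rw [Real.norm_eq_abs, Even.pow_abs (show Even 4 by decide)]
  have hi : ∀ {g : X → ℝ}, MemLp g 4 ν → Integrable (fun x => g x ^ 4) ν := fun hg => by
    have := hg.integrable_norm_pow (p := 4) (by norm_num)
    simpa only [even4] using this
  have hc : MemLp (fun _ : X => ∫ y, f y ∂ν) 4 ν := memLp_const _
  calc ∫ x, (f x - ∫ y, f y ∂ν) ^ 4 ∂ν
      ≤ ∫ x, (8 * f x ^ 4 + 8 * (∫ y, f y ∂ν) ^ 4) ∂ν := by
        refine integral_mono (hi (h.sub hc)) (((hi h).const_mul 8).add (integrable_const _))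
          fun x => ?_
        change (f x - ∫ y, f y ∂ν) ^ 4 ≤ 8 * f x ^ 4 + 8 * (∫ y, f y ∂ν) ^ 4
        generalize ∫ y, f y ∂ν = e
        nlinarith [sq_nonneg (f x + e), sq_nonneg (f x ^ 2 - e ^ 2), sq_nonneg (f x - e),
          sq_nonneg ((f x + e) ^ 2), mul_nonneg (sq_nonneg (f x + e)) (sq_nonneg (f x - e)),
          mul_nonneg (sq_nonneg (f x + e)) (add_nonneg (sq_nonneg (f x)) (sq_nonneg e))]
    _ = 8 * ∫ x, f x ^ 4 ∂ν + 8 * (∫ y, f y ∂ν) ^ 4 := by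
        rw [integral_add ((hi h).const_mul 8) (integrable_const _), integral_const_mul]
        simp
    _ ≤ _ := by linarith [pow_four_integral_le h]

end MomentTools

/-! ### One task: differentiating the risk and the noise of one data point. -/

/-- The assumptions on the loss `q` of one task, whose data have the law `ν`. -/
structure TaskAssumptions {M : ℕ} {X : Type*} [MeasurableSpace X] (ν : Measure X)
    (q : Param M → X → ℝ) (ℓ : X → ℝ) (L ρ B σG σH : ℝ) : Prop where
  measurable : ∀ w, Measurable (q w)
  differentiable : ∀ x, Differentiable ℝ fun w => q w x
  differentiable_gradient : ∀ x, Differentiable ℝ (gradient fun w => q w x)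
  integrable : ∀ w, Integrable (q w) ν
  nonneg_L : 0 ≤ L
  nonneg_lip : ∀ x, 0 ≤ ℓ x
  lipschitz : ∀ x w u,
    ‖gradient (fun v => q v x) w - gradient (fun v => q v x) u‖ ≤ ℓ x * ‖w - u‖
  memLp_lip : MemLp ℓ 2 ν
  lip_sq_le : ∫ x, ℓ x ^ 2 ∂ν ≤ L ^ 2
  lipschitz_hessian : ∀ w u, ExpectationLE ν
    (fun x => ‖hessian (fun v => q v x) w - hessian (fun v => q v x) u‖) (ρ * ‖w - u‖)
  gradient_le : ∀ w, ExpectationLE ν (fun x => ‖gradient (fun v => q v x) w‖) B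
  gradient_noise : ∀ w, ExpectationLE ν (fun x =>
    ‖gradient (fun v => q v x) w - gradient (fun v => ∫ x, q v x ∂ν) w‖ ^ 4) (σG ^ 4)
  hessian_noise : ∀ w, ExpectationLE ν (fun x =>
    ‖hessian (fun v => q v x) w - hessian (fun v => ∫ x, q v x ∂ν) w‖ ^ 4) (σH ^ 4)

namespace TaskAssumptions

variable {M : ℕ} {X : Type*} [MeasurableSpace X] {ν : Measure X} [IsProbabilityMeasure ν]
  {q : Param M → X → ℝ} {ℓ : X → ℝ} {L ρ B σG σH : ℝ}
  (h : TaskAssumptions ν q ℓ L ρ B σG σH)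

include h

theorem measurable_gradient (w : Param M) : Measurable fun x => gradient (fun v => q v x) w :=
  (measurable_gradient_param h.measurable h.differentiable).comp
    (measurable_prodMk_left (x := w))

theorem measurable_hessian (w : Param M) : Measurable fun x => hessian (fun v => q v x) w :=
  (measurable_hessian_param h.measurable h.differentiable h.differentiable_gradient).comp
    (measurable_prodMk_left (x := w))

theorem norm_hessian_le (x : X) (w : Param M) : ‖hessian (fun v => q v x) w‖ ≤ ℓ x :=
  _root_.norm_hessian_le (h.nonneg_lip x) (h.lipschitz x) w

theorem integrable_lip : Integrable ℓ ν := h.memLp_lip.integrable (by norm_num)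

theorem integral_lip_le : ∫ x, ℓ x ∂ν ≤ L :=
  le_of_abs_le <| abs_le_of_sq_le_sq
    ((sq_integral_le_integral_sq h.memLp_lip).trans h.lip_sq_le) h.nonneg_L

theorem integrable_gradient (w : Param M) : Integrable (fun x => gradient (fun v => q v x) w) ν :=
  (integrable_norm_iff (h.measurable_gradient w).aestronglyMeasurable).1 (h.gradient_le w).1

theorem integrable_hessian (w : Param M) : Integrable (fun x => hessian (fun v => q v x) w) ν :=
  h.integrable_lip.mono' (h.measurable_hessian w).aestronglyMeasurable
    (ae_of_all _ fun x => h.norm_hessian_le x w)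

theorem hasGradientAt_risk (w : Param M) :
    HasGradientAt (fun v => ∫ x, q v x ∂ν) (∫ x, gradient (fun v => q v x) w ∂ν) w := by
  -- On the unit ball the gradient exceeds its norm at the centre by at most `ℓ x`, so the loss has
  -- an integrable Lipschitz constant there, as differentiation under the integral requires.
  have hlip : ∀ x, ∀ u ∈ Metric.ball w 1,
      ‖q u x - q w x‖ ≤ (‖gradient (fun v => q v x) w‖ + ℓ x) * ‖u - w‖ := by
    intro x u hu
    refine (convex_ball w 1).norm_image_sub_le_of_norm_fderiv_le (𝕜 := ℝ)
      (fun y _ => h.differentiable x y) (fun y hy => ?_) (Metric.mem_ball_self one_pos) hu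
    rw [← norm_gradient]
    have h1 := h.lipschitz x y w
    have h2 := norm_le_norm_add_norm_sub' (gradient (fun v => q v x) y) (gradient (fun v => q v x) w)
    rw [Metric.mem_ball, dist_eq_norm] at hy
    nlinarith [h.nonneg_lip x]
  have hint := h.integrable_gradient w
  have h1 := hasFDerivAt_integral_of_dominated_loc_of_lip' (μ := ν) (F := q) (x₀ := w)
    (F' := fun x => InnerProductSpace.toDual ℝ (Param M) (gradient (fun v => q v x) w))
    (Metric.ball_mem_nhds w one_pos) (fun u _ => (h.measurable u).aestronglyMeasurable)
    (h.integrable w)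
    ((LinearIsometryEquiv.continuous _).comp_aestronglyMeasurable hint.1)
    (ae_of_all _ hlip) (hint.norm.add h.integrable_lip)
    (ae_of_all _ fun x => (h.differentiable x w).hasGradientAt.hasFDerivAt)
  rw [hasGradientAt_iff_hasFDerivAt]
  refine h1.2.congr_fderiv ?_
  exact (InnerProductSpace.toDual ℝ (Param M)).toContinuousLinearEquiv.toContinuousLinearMap
    |>.integral_comp_comm hint

theorem gradient_risk :
    gradient (fun v => ∫ x, q v x ∂ν) = fun w => ∫ x, gradient (fun v => q v x) w ∂ν :=
  funext fun w => (h.hasGradientAt_risk w).gradient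

theorem differentiable_risk : Differentiable ℝ fun v => ∫ x, q v x ∂ν :=
  fun w => (h.hasGradientAt_risk w).differentiableAt

theorem norm_gradient_risk_le (w : Param M) : ‖gradient (fun v => ∫ x, q v x ∂ν) w‖ ≤ B := by
  rw [h.gradient_risk]
  exact (norm_integral_le_integral_norm _).trans (h.gradient_le w).2

theorem lipschitz_gradient_risk (w u : Param M) :
    ‖gradient (fun v => ∫ x, q v x ∂ν) w - gradient (fun v => ∫ x, q v x ∂ν) u‖
      ≤ L * ‖w - u‖ := by
  rw [h.gradient_risk]
  simp only
  rw [← integral_sub (h.integrable_gradient w) (h.integrable_gradient u)]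
  calc _ ≤ ∫ x, ℓ x * ‖w - u‖ ∂ν :=
        norm_integral_le_of_norm_le (h.integrable_lip.mul_const _)
          (ae_of_all _ fun x => h.lipschitz x w u)
    _ = (∫ x, ℓ x ∂ν) * ‖w - u‖ := integral_mul_const _ _
    _ ≤ L * ‖w - u‖ := mul_le_mul_of_nonneg_right h.integral_lip_le (norm_nonneg _)

theorem hasFDerivAt_gradient_risk (w : Param M) :
    HasFDerivAt (gradient fun v => ∫ x, q v x ∂ν) (∫ x, hessian (fun v => q v x) w ∂ν) w := by
  rw [h.gradient_risk]
  exact (hasFDerivAt_integral_of_dominated_loc_of_lip' (μ := ν)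
    (F := fun w x => gradient (fun v => q v x) w) Filter.univ_mem
    (fun u _ => (h.measurable_gradient u).aestronglyMeasurable) (h.integrable_gradient w)
    (h.measurable_hessian w).aestronglyMeasurable
    (ae_of_all _ fun x u _ => h.lipschitz x u w) h.integrable_lip
    (ae_of_all _ fun x => (h.differentiable_gradient x w).hasFDerivAt)).2

theorem differentiable_gradient_risk : Differentiable ℝ (gradient fun v => ∫ x, q v x ∂ν) :=
  fun w => (h.hasFDerivAt_gradient_risk w).differentiableAt

theorem hessian_risk (w : Param M) :
    hessian (fun v => ∫ x, q v x ∂ν) w = ∫ x, hessian (fun v => q v x) w ∂ν :=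
  (h.hasFDerivAt_gradient_risk w).fderiv

theorem norm_hessian_risk_le (w : Param M) : ‖hessian (fun v => ∫ x, q v x ∂ν) w‖ ≤ L :=
  _root_.norm_hessian_le h.nonneg_L h.lipschitz_gradient_risk w

theorem memLp_gradient_noise (w : Param M) :
    MemLp (fun x => gradient (fun v => q v x) w - gradient (fun v => ∫ x, q v x ∂ν) w) 4 ν :=
  memLp_four_of_integrable ((h.measurable_gradient w).sub_const _).aestronglyMeasurable
    (h.gradient_noise w).1

theorem integral_gradient_noise (w : Param M) :
    ∫ x, (gradient (fun v => q v x) w - gradient (fun v => ∫ x, q v x ∂ν) w) ∂ν = 0 := by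
  rw [integral_sub (h.integrable_gradient w) (integrable_const _), h.gradient_risk]
  simp

theorem memLp_hessian_noise (w : Param M) :
    MemLp (fun x => hessian (fun v => q v x) w - hessian (fun v => ∫ x, q v x ∂ν) w) 4 ν :=
  memLp_four_of_integrable ((h.measurable_hessian w).sub_const _).aestronglyMeasurable
    (h.hessian_noise w).1

theorem integral_hessian_noise (w : Param M) :
    ∫ x, (hessian (fun v => q v x) w - hessian (fun v => ∫ x, q v x ∂ν) w) ∂ν = 0 := by
  rw [integral_sub (h.integrable_hessian w) (integrable_const _), h.hessian_risk]
  simp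

theorem memLp_norm_hessian_sub (w : Param M) :
    MemLp (fun x => ‖hessian (fun v => q v x) w‖ - ‖hessian (fun v => ∫ x, q v x ∂ν) w‖) 4 ν :=
  (h.memLp_hessian_noise w).of_le
    ((h.measurable_hessian w).norm.sub_const _).aestronglyMeasurable
    (ae_of_all _ fun _ => abs_norm_sub_norm_le _ _)

theorem memLp_norm_hessian_sub_mean (w : Param M) :
    MemLp (fun x => ‖hessian (fun v => q v x) w‖ - ∫ y, ‖hessian (fun v => q v y) w‖ ∂ν) 4 ν := by
  have h1 := (h.memLp_norm_hessian_sub w).sub (memLp_const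
    ((∫ y, ‖hessian (fun v => q v y) w‖ ∂ν) - ‖hessian (fun v => ∫ x, q v x ∂ν) w‖))
  refine h1.ae_eq (ae_of_all _ fun x => ?_)
  simp

/-- The spectral norm is not Euclidean, so the fourth-moment bound is applied to the scalar
`‖hessian‖`. This differs from the norm of the mean Hessian by at most the Hessian noise, and
recentring at its own mean costs `16`, whence `16 σH⁴ = (4 σH²)²`. -/
theorem integral_norm_hessian_sub_mean_pow_four_le (w : Param M) :
    ∫ x, (‖hessian (fun v => q v x) w‖ - ∫ y, ‖hessian (fun v => q v y) w‖ ∂ν) ^ 4 ∂ν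
      ≤ (4 * σH ^ 2) ^ 2 := by
  have hf := h.memLp_norm_hessian_sub w
  have h1 := integral_sub_mean_pow_four_le hf
  rw [integral_sub (h.integrable_hessian w).norm (integrable_const _)] at h1
  simp only [integral_const, probReal_univ, one_smul, sub_sub_sub_cancel_right] at h1
  refine h1.trans ?_
  have h2 : ∫ x, (‖hessian (fun v => q v x) w‖ - ‖hessian (fun v => ∫ x, q v x ∂ν) w‖) ^ 4 ∂ν
      ≤ σH ^ 4 := by
    refine (integral_mono ?_ (h.hessian_noise w).1 fun x => ?_).trans (h.hessian_noise w).2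
    · have := hf.integrable_norm_pow (p := 4) (by norm_num)
      simpa [Even.pow_abs (show Even 4 by decide)] using this
    · rw [← Even.pow_abs (show Even 4 by decide)]
      exact pow_le_pow_left₀ (abs_nonneg _) (abs_norm_sub_norm_le _ _) 4
  nlinarith

theorem integral_norm_hessian_le (w : Param M) : ∫ x, ‖hessian (fun v => q v x) w‖ ∂ν ≤ L :=
  (integral_mono (h.integrable_hessian w).norm h.integrable_lip
    fun x => h.norm_hessian_le x w).trans h.integral_lip_le

end TaskAssumptions

/-! ### The meta-gradient of one sample: measurability and the chain rule. -/

/-- The stochastic meta-gradient of one task with inner batch `x` and outer batch `y`. -/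
noncomputable def sampleGradient {M : ℕ} {X : Type*} (α : ℝ) {n m : ℕ} (q : Param M → X → ℝ) (x : Fin n → X)
    (y : Fin m → X) (w : Param M) : Param M :=
  (ContinuousLinearMap.id ℝ (Param M) - α • hessian (batchLoss q x) w)
    (gradient (batchLoss q y) (innerStep α q x w))

/-- The gradient of `w ↦ f (innerStep α q x w)` for a function `f` with gradient `g`. -/
noncomputable def pullbackGradient {M : ℕ} {X : Type*} (α : ℝ) {n : ℕ} (q : Param M → X → ℝ)
    (g : Param M → Param M) (x : Fin n → X) (w : Param M) : Param M :=
  (ContinuousLinearMap.id ℝ (Param M) - α • hessian (batchLoss q x) w) (g (innerStep α q x w))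

section BatchMeasurability

variable {M : ℕ} {Y : Type*} [MeasurableSpace Y] {q : Param M → Y → ℝ}
  (hm : ∀ w, Measurable (q w)) (hq : ∀ y, Differentiable ℝ fun w => q w y)
  (hg : ∀ y, Differentiable ℝ (gradient fun w => q w y))

include hm hq

theorem measurable_batchLoss (n : ℕ) (w : Param M) :
    Measurable fun x : Fin n → Y => batchLoss q x w :=
  (Finset.measurable_sum _ fun j _ => (hm w).comp (measurable_pi_apply j)).const_mul _

omit hm [MeasurableSpace Y] in
theorem differentiable_batchLoss {n : ℕ} (x : Fin n → Y) : Differentiable ℝ (batchLoss q x) :=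
  fun w => (hasGradientAt_batchLoss hq x w).differentiableAt

theorem measurable_gradient_batchLoss (n : ℕ) :
    Measurable fun p : Param M × (Fin n → Y) => gradient (batchLoss q p.2) p.1 :=
  measurable_gradient_param (q := fun w (x : Fin n → Y) => batchLoss q x w)
    (measurable_batchLoss hm hq n) fun x => differentiable_batchLoss hq x

theorem measurable_innerStep (α : ℝ) (n : ℕ) :
    Measurable fun p : Param M × (Fin n → Y) => innerStep α q p.2 p.1 :=
  measurable_fst.sub ((measurable_gradient_batchLoss hm hq n).const_smul α)

include hg

theorem measurable_hessian_batchLoss (n : ℕ) :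
    Measurable fun p : Param M × (Fin n → Y) => hessian (batchLoss q p.2) p.1 :=
  measurable_hessian_param (q := fun w (x : Fin n → Y) => batchLoss q x w)
    (measurable_batchLoss hm hq n) (fun x => differentiable_batchLoss hq x)
    fun x => differentiable_gradient_batchLoss hq hg x

theorem measurable_sampleGradient (α : ℝ) (n m : ℕ) :
    Measurable fun p : Param M × (Fin n → Y) × (Fin m → Y) =>
      sampleGradient α q p.2.1 p.2.2 p.1 := by
  have hf : Measurable fun p : Param M × (Fin n → Y) × (Fin m → Y) => (p.1, p.2.1) := by fun_prop
  have h1 := (measurable_hessian_batchLoss hm hq hg n).comp hf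
  have h2 := (measurable_innerStep hm hq α n).comp hf
  have h3 := (measurable_gradient_batchLoss hm hq m).comp
    (h2.prodMk (measurable_snd.comp (measurable_snd (α := Param M))))
  have hc : Continuous fun p : (Param M →L[ℝ] Param M) × Param M =>
      (ContinuousLinearMap.id ℝ (Param M) - α • p.1) p.2 := by fun_prop
  have := hc.measurable.comp (h1.prodMk h3)
  exact this

theorem measurable_pullbackGradient (α : ℝ) (n : ℕ) {g : Param M → Param M} (hgm : Measurable g) :
    Measurable fun p : Param M × (Fin n → Y) => pullbackGradient α q g p.2 p.1 := by
  have hc : Continuous fun p : (Param M →L[ℝ] Param M) × Param M =>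
      (ContinuousLinearMap.id ℝ (Param M) - α • p.1) p.2 := by fun_prop
  have := hc.measurable.comp ((measurable_hessian_batchLoss hm hq hg n).prodMk
    (hgm.comp (measurable_innerStep hm hq α n)))
  exact this

end BatchMeasurability

theorem norm_id_sub_smul_le {M : ℕ} {α c : ℝ} (hα : 0 ≤ α) {A : Param M →L[ℝ] Param M}
    (h : ‖A‖ ≤ c) : ‖ContinuousLinearMap.id ℝ (Param M) - α • A‖ ≤ 1 + α * c := by
  refine (norm_sub_le _ _).trans (add_le_add ContinuousLinearMap.norm_id_le ?_)
  rw [norm_smul, Real.norm_of_nonneg hα]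
  gcongr

/-- Chain rule through a gradient step. -/
theorem hasGradientAt_comp_innerStep {M : ℕ} {X : Type*} {q : Param M → X → ℝ}
    (hq : ∀ x, Differentiable ℝ fun w => q w x)
    (hg : ∀ x, Differentiable ℝ (gradient fun w => q w x)) {f : Param M → ℝ}
    (hf : Differentiable ℝ f) (α : ℝ) {n : ℕ} (x : Fin n → X) (w : Param M) :
    HasGradientAt (fun v => f (innerStep α q x v)) (pullbackGradient α q (gradient f) x w) w := by
  have hd := differentiable_gradient_batchLoss hq hg x
  have h1 : HasFDerivAt (innerStep α q x)
      (ContinuousLinearMap.id ℝ (Param M) - α • hessian (batchLoss q x) w) w :=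
    (hasFDerivAt_id w).sub ((hd w).hasFDerivAt.const_smul α)
  have h2 := (hf (innerStep α q x w)).hasFDerivAt.comp w h1
  rw [hasGradientAt_iff_hasFDerivAt]
  refine h2.congr_fderiv ?_
  ext v
  -- The chain rule produces the adjoint of `I - α ∇²`; symmetry identifies it with the operator
  -- itself.
  have hs := hessian_symmetric (differentiable_batchLoss hq x) hd w
    (gradient f (innerStep α q x w)) v
  simp only [ContinuousLinearMap.comp_apply, InnerProductSpace.toDual_apply_apply, pullbackGradient]
  rw [← inner_gradient_left]
  simp [inner_sub_left, inner_sub_right, inner_smul_left, inner_smul_right, hs]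

/-! ### Batches of data from one task. -/

namespace TaskAssumptions

variable {M : ℕ} {X : Type*} [MeasurableSpace X] {ν : Measure X} [IsProbabilityMeasure ν]
  {q : Param M → X → ℝ} {ℓ : X → ℝ} {L ρ B σG σH : ℝ}
  (h : TaskAssumptions ν q ℓ L ρ B σG σH) {n : ℕ}

include h

theorem nonneg_B : 0 ≤ B :=
  (integral_nonneg fun _ => norm_nonneg _).trans (h.gradient_le 0).2

theorem norm_hessian_batchLoss_le (x : Fin n → X) (w : Param M) :
    ‖hessian (batchLoss q x) w‖ ≤ (1 / (n : ℝ)) * ∑ j, ‖hessian (fun v => q v (x j)) w‖ := by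
  rw [hessian_batchLoss h.differentiable h.differentiable_gradient, norm_smul,
    Real.norm_of_nonneg (by positivity)]
  gcongr
  exact norm_sum_le _ _

theorem norm_hessian_batchLoss_le_mean_lip (x : Fin n → X) (w : Param M) :
    ‖hessian (batchLoss q x) w‖ ≤ (1 / (n : ℝ)) * ∑ j, ℓ (x j) :=
  (h.norm_hessian_batchLoss_le x w).trans (by
    gcongr
    exact h.norm_hessian_le _ w)

theorem lipschitz_gradient_batchLoss (x : Fin n → X) (w u : Param M) :
    ‖gradient (batchLoss q x) w - gradient (batchLoss q x) u‖
      ≤ ((1 / (n : ℝ)) * ∑ j, ℓ (x j)) * ‖w - u‖ := by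
  rw [gradient_batchLoss h.differentiable]
  simp only
  rw [← smul_sub, ← Finset.sum_sub_distrib, norm_smul, Real.norm_of_nonneg (by positivity),
    mul_assoc, Finset.sum_mul]
  gcongr
  exact (norm_sum_le _ _).trans (Finset.sum_le_sum fun j _ => h.lipschitz _ _ _)

omit h in
theorem integrable_mean_pi {F : Type*} [NormedAddCommGroup F] [NormedSpace ℝ F] {f : X → F}
    (hf : Integrable f ν) :
    Integrable (fun x : Fin n → X => (1 / (n : ℝ)) • ∑ j, f (x j))
      (Measure.pi fun _ : Fin n => ν) :=
  (integrable_finsetSum _ fun j _ =>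
    (measurePreserving_eval (fun _ : Fin n => ν) j).integrable_comp_of_integrable hf).smul _

omit h in
theorem integral_mean_pi (hn : 0 < n) {F : Type*} [NormedAddCommGroup F] [NormedSpace ℝ F]
    {f : X → F} (hf : Integrable f ν) :
    ∫ x : Fin n → X, (1 / (n : ℝ)) • ∑ j, f (x j) ∂(Measure.pi fun _ : Fin n => ν)
      = ∫ x, f x ∂ν := by
  have hi : ∀ j : Fin n, Integrable (fun x : Fin n → X => f (x j))
      (Measure.pi fun _ : Fin n => ν) := fun j =>
    (measurePreserving_eval (fun _ : Fin n => ν) j).integrable_comp_of_integrable hf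
  rw [integral_smul, integral_finsetSum _ fun j _ => hi j]
  simp_rw [integral_comp_eval_pi hf.1]
  rw [Finset.sum_const, Finset.card_univ, Fintype.card_fin, ← Nat.cast_smul_eq_nsmul ℝ, smul_smul]
  have : (n : ℝ) ≠ 0 := by positivity
  rw [one_div_mul_cancel this, one_smul]

theorem integral_mean_lip_le (hn : 0 < n) :
    ExpectationLE (Measure.pi fun _ : Fin n => ν) (fun x => (1 / (n : ℝ)) * ∑ j, ℓ (x j)) L :=
  ⟨integrable_mean_pi h.integrable_lip, (integral_mean_pi hn h.integrable_lip).trans_le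
    h.integral_lip_le⟩

theorem mean_lip_nonneg (x : Fin n → X) : 0 ≤ (1 / (n : ℝ)) * ∑ j, ℓ (x j) :=
  mul_nonneg (by positivity) (Finset.sum_nonneg fun _ _ => h.nonneg_lip _)

/-- The square of a mean is at most the mean of the squares, so the Lipschitz constant of a batch
keeps the bound `L²` for every batch size. -/
theorem expectation_mean_lip_sq_le (hn : 0 < n) :
    ExpectationLE (Measure.pi fun _ : Fin n => ν)
      (fun x => ((1 / (n : ℝ)) * ∑ j, ℓ (x j)) ^ 2) (L ^ 2) := by
  have hsq : Integrable (fun x => ℓ x ^ 2) ν := h.memLp_lip.integrable_sq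
  have h1 : ExpectationLE (Measure.pi fun _ : Fin n => ν)
      (fun x => (1 / (n : ℝ)) * ∑ j, ℓ (x j) ^ 2) (L ^ 2) :=
    ⟨integrable_mean_pi hsq, (integral_mean_pi hn hsq).trans_le h.lip_sq_le⟩
  refine h1.mono ((integrable_mean_pi h.integrable_lip).1.pow 2) (fun x => sq_nonneg _) fun x => ?_
  have h2 := sq_sum_le_card_mul_sum_sq (s := Finset.univ) (f := fun j : Fin n => ℓ (x j))
  rw [Finset.card_univ, Fintype.card_fin] at h2
  have hn' : (0 : ℝ) < n := by exact_mod_cast hn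
  calc ((1 / (n : ℝ)) * ∑ j, ℓ (x j)) ^ 2 = (1 / (n : ℝ)) ^ 2 * (∑ j, ℓ (x j)) ^ 2 := by ring
    _ ≤ (1 / (n : ℝ)) ^ 2 * (n * ∑ j, ℓ (x j) ^ 2) := by gcongr
    _ = _ := by field_simp

theorem expectation_one_add_mean_lip_sq_le (hn : 0 < n) {α : ℝ} (hα : 0 ≤ α) :
    ExpectationLE (Measure.pi fun _ : Fin n => ν)
      (fun x => (1 + α * ((1 / (n : ℝ)) * ∑ j, ℓ (x j))) ^ 2) ((1 + α * L) ^ 2) := by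
  have h1 := (h.integral_mean_lip_le hn).const_mul (c := 2 * α) (by positivity)
  have h2 := (h.expectation_mean_lip_sq_le hn).const_mul (c := α ^ 2) (by positivity)
  have h0 : ExpectationLE (Measure.pi fun _ : Fin n => ν) (fun _ => (1 : ℝ)) 1 :=
    ⟨integrable_const _, by simp⟩
  convert (h0.add h1).add h2 using 1
  · ext x; ring
  · ring

theorem expectation_one_add_mean_lip_le (hn : 0 < n) {α : ℝ} (hα : 0 ≤ α) :
    ExpectationLE (Measure.pi fun _ : Fin n => ν)
      (fun x => 1 + α * ((1 / (n : ℝ)) * ∑ j, ℓ (x j))) (1 + α * L) := by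
  have h1 := (h.integral_mean_lip_le hn).const_mul (c := α) hα
  have h0 : ExpectationLE (Measure.pi fun _ : Fin n => ν) (fun _ => (1 : ℝ)) 1 :=
    ⟨integrable_const _, by simp⟩
  exact h0.add h1

theorem measurable_sampleGradient_pi (α : ℝ) {m : ℕ} (w : Param M) :
    Measurable fun p : (Fin n → X) × (Fin m → X) => sampleGradient α q p.1 p.2 w :=
  ((measurable_sampleGradient h.measurable h.differentiable h.differentiable_gradient α n m).comp
    (measurable_prodMk_left (x := w)) :)

theorem measurable_gradient_batchLoss_pi (w : Param M) :
    Measurable fun x : Fin n → X => gradient (batchLoss q x) w :=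
  ((measurable_gradient_batchLoss h.measurable h.differentiable n).comp
    (measurable_prodMk_left (x := w)) :)

theorem measurable_hessian_batchLoss_pi (w : Param M) :
    Measurable fun x : Fin n → X => hessian (batchLoss q x) w :=
  ((measurable_hessian_batchLoss h.measurable h.differentiable h.differentiable_gradient n).comp
    (measurable_prodMk_left (x := w)) :)

theorem measurable_innerStep_pi (α : ℝ) (w : Param M) :
    Measurable fun x : Fin n → X => innerStep α q x w :=
  ((measurable_innerStep h.measurable h.differentiable α n).comp (measurable_prodMk_left (x := w)) :)

theorem measurable_gradient_risk : Measurable (gradient fun v => ∫ x, q v x ∂ν) :=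
  h.differentiable_gradient_risk.continuous.measurable

theorem measurable_pullbackGradient_pi (α : ℝ) (w : Param M) :
    Measurable fun x : Fin n → X =>
      pullbackGradient α q (gradient fun v => ∫ x, q v x ∂ν) x w :=
  ((measurable_pullbackGradient h.measurable h.differentiable h.differentiable_gradient α n
    h.measurable_gradient_risk).comp (measurable_prodMk_left (x := w)) :)

theorem integrable_gradient_batchLoss (w : Param M) :
    Integrable (fun x : Fin n → X => gradient (batchLoss q x) w)
      (Measure.pi fun _ : Fin n => ν) := by
  simp only [gradient_batchLoss h.differentiable]
  exact integrable_mean_pi (f := fun x => gradient (fun v => q v x) w) (h.integrable_gradient w)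

theorem norm_gradient_batchLoss_expectation (hn : 0 < n) (w : Param M) :
    ExpectationLE (Measure.pi fun _ : Fin n => ν)
      (fun x => ‖gradient (batchLoss q x) w‖) B := by
  have h1 : ExpectationLE (Measure.pi fun _ : Fin n => ν)
      (fun x => (1 / (n : ℝ)) * ∑ j, ‖gradient (fun v => q v (x j)) w‖) B :=
    ⟨integrable_mean_pi (h.gradient_le w).1,
      (integral_mean_pi hn (h.gradient_le w).1).trans_le (h.gradient_le w).2⟩
  refine h1.mono (h.measurable_gradient_batchLoss_pi w).norm.aestronglyMeasurable
    (fun _ => norm_nonneg _) fun x => ?_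
  rw [gradient_batchLoss h.differentiable, norm_smul, Real.norm_of_nonneg (by positivity)]
  gcongr
  exact norm_sum_le _ _

theorem gradient_batchLoss_sub (hn : 0 < n) (w : Param M) (g : Param M) (x : Fin n → X) :
    gradient (batchLoss q x) w - g = (1 / (n : ℝ)) • ∑ j, (gradient (fun v => q v (x j)) w - g) := by
  have : (n : ℝ) ≠ 0 := by positivity
  rw [gradient_batchLoss h.differentiable, Finset.sum_sub_distrib, smul_sub, Finset.sum_const,
    Finset.card_univ, Fintype.card_fin, ← Nat.cast_smul_eq_nsmul ℝ, smul_smul,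
    one_div_mul_cancel this, one_smul]

theorem hessian_batchLoss_sub_apply (hn : 0 < n) (w v : Param M) (A : Param M →L[ℝ] Param M)
    (x : Fin n → X) :
    (hessian (batchLoss q x) w - A) v
      = (1 / (n : ℝ)) • ∑ j, (hessian (fun v => q v (x j)) w - A) v := by
  have : (n : ℝ) ≠ 0 := by positivity
  rw [hessian_batchLoss h.differentiable h.differentiable_gradient]
  simp only [sub_apply, smul_apply, sum_apply,
    Finset.sum_sub_distrib, smul_sub]
  rw [Finset.sum_const, Finset.card_univ, Fintype.card_fin, ← Nat.cast_smul_eq_nsmul ℝ,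
    smul_smul, one_div_mul_cancel this, one_smul]

theorem gradient_batch_noise_sq (hn : 0 < n) (w : Param M) :
    ExpectationLE (Measure.pi fun _ : Fin n => ν)
      (fun x => ‖gradient (batchLoss q x) w - gradient (fun v => ∫ x, q v x ∂ν) w‖ ^ 2)
      (σG ^ 2 / n) := by
  obtain ⟨N, hN⟩ : ∃ N : X → Param M, N = fun x =>
    gradient (fun v => q v x) w - gradient (fun v => ∫ x, q v x ∂ν) w := ⟨_, rfl⟩
  have hm : Measurable N := by rw [hN]; exact (h.measurable_gradient w).sub_const _
  have h4 : MemLp N 4 ν := by rw [hN]; exact h.memLp_gradient_noise w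
  have h0 : ∫ x, N x ∂ν = 0 := by rw [hN]; exact h.integral_gradient_noise w
  have hτ : ∫ x, ‖N x‖ ^ 4 ∂ν ≤ (σG ^ 2) ^ 2 := by
    rw [hN, ← pow_mul]; exact (h.gradient_noise w).2
  have h2 := memLp_two_of_memLp_four h4
  rw [show (fun x => ‖gradient (batchLoss q x) w - gradient (fun v => ∫ x, q v x ∂ν) w‖ ^ 2)
    = fun x : Fin n → X => ‖(1 / (n : ℝ)) • ∑ j, N (x j)‖ ^ 2 from
      funext fun x => by rw [h.gradient_batchLoss_sub hn, hN]]
  exact ⟨integrable_norm_sq (memLp_mean h2), integral_norm_mean_sq_le hn hm h2 h0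
    (integral_norm_sq_le_of_pow_four h4 (by positivity) hτ)⟩

theorem gradient_batch_noise_pow_four (hn : 0 < n) (w : Param M) :
    ExpectationLE (Measure.pi fun _ : Fin n => ν)
      (fun x => ‖gradient (batchLoss q x) w - gradient (fun v => ∫ x, q v x ∂ν) w‖ ^ 4)
      (3 * σG ^ 4 / n ^ 2) := by
  obtain ⟨N, hN⟩ : ∃ N : X → Param M, N = fun x =>
    gradient (fun v => q v x) w - gradient (fun v => ∫ x, q v x ∂ν) w := ⟨_, rfl⟩
  have hm : Measurable N := by rw [hN]; exact (h.measurable_gradient w).sub_const _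
  have h4 : MemLp N 4 ν := by rw [hN]; exact h.memLp_gradient_noise w
  have h0 : ∫ x, N x ∂ν = 0 := by rw [hN]; exact h.integral_gradient_noise w
  have hτ : ∫ x, ‖N x‖ ^ 4 ∂ν ≤ (σG ^ 2) ^ 2 := by
    rw [hN, ← pow_mul]; exact (h.gradient_noise w).2
  rw [show (fun x => ‖gradient (batchLoss q x) w - gradient (fun v => ∫ x, q v x ∂ν) w‖ ^ 4)
    = fun x : Fin n → X => ‖(1 / (n : ℝ)) • ∑ j, N (x j)‖ ^ 4 from
      funext fun x => by rw [h.gradient_batchLoss_sub hn, hN]]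
  have h5 := integral_norm_mean_pow_four_le hn hm h4 h0 (by positivity) hτ
  rw [← pow_mul] at h5
  exact ⟨integrable_norm_pow_four (memLp_mean h4), h5⟩

/-- Applying the operators to a fixed `v` moves the noise into a Euclidean space, where independent
centred terms are orthogonal in mean and the factor `1 / n` appears. -/
theorem hessian_batch_noise_apply_sq (hn : 0 < n) (w v : Param M) :
    ExpectationLE (Measure.pi fun _ : Fin n => ν)
      (fun x => ‖(hessian (batchLoss q x) w - hessian (fun v => ∫ x, q v x ∂ν) w) v‖ ^ 2)
      (σH ^ 2 * ‖v‖ ^ 2 / n) := by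
  obtain ⟨N, hN⟩ : ∃ N : X → Param M →L[ℝ] Param M, N = fun x =>
    hessian (fun v => q v x) w - hessian (fun v => ∫ x, q v x ∂ν) w := ⟨_, rfl⟩
  have hNm : Measurable N := by rw [hN]; exact (h.measurable_hessian w).sub_const _
  have hN4 : MemLp N 4 ν := by rw [hN]; exact h.memLp_hessian_noise w
  have hN0 : ∫ x, N x ∂ν = 0 := by rw [hN]; exact h.integral_hessian_noise w
  have hτN : ExpectationLE ν (fun x => ‖N x‖ ^ 4) (σH ^ 4) := by
    rw [hN]; exact h.hessian_noise w
  have he : ∀ x : Fin n → X,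
      (hessian (batchLoss q x) w - hessian (fun v => ∫ x, q v x ∂ν) w) v
        = (1 / (n : ℝ)) • ∑ j, N (x j) v := by
    intro x
    rw [hN]
    exact h.hessian_batchLoss_sub_apply hn w v _ x
  simp only [he]
  have hcont : Continuous fun A : Param M →L[ℝ] Param M => A v := by fun_prop
  have hm : Measurable fun x => N x v := (hcont.measurable.comp hNm :)
  have h4' : MemLp (fun x => N x v) 4 ν := by
    refine (hN4.norm.const_mul ‖v‖).of_le hm.aestronglyMeasurable (ae_of_all _ fun x => ?_)
    rw [Real.norm_of_nonneg (by positivity), mul_comm]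
    exact (N x).le_opNorm v
  have h0 : ∫ x, N x v ∂ν = 0 := by
    have hi := hN4.integrable (by norm_num)
    rw [← ContinuousLinearMap.integral_apply hi v, hN0, zero_apply]
  have hτ : ∫ x, ‖N x v‖ ^ 4 ∂ν ≤ (σH ^ 2 * ‖v‖ ^ 2) ^ 2 := by
    calc ∫ x, ‖N x v‖ ^ 4 ∂ν ≤ ∫ x, ‖v‖ ^ 4 * ‖N x‖ ^ 4 ∂ν := by
          refine integral_mono (integrable_norm_pow_four h4') (hτN.1.const_mul _) fun x => ?_
          simp only
          rw [← mul_pow, mul_comm]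
          exact pow_le_pow_left₀ (norm_nonneg _) ((N x).le_opNorm v) 4
      _ ≤ ‖v‖ ^ 4 * σH ^ 4 := by
          rw [integral_const_mul]
          exact mul_le_mul_of_nonneg_left hτN.2 (by positivity)
      _ = _ := by ring
  have h2 := memLp_two_of_memLp_four h4'
  have hi1 := integrable_norm_sq (memLp_mean (n := n) h2)
  have hi2 := integral_norm_mean_sq_le hn hm h2 h0
    (integral_norm_sq_le_of_pow_four h4' (by positivity) hτ)
  exact ⟨hi1, hi2⟩

/-- The norms of the Hessians of a batch concentrate around their mean, uniformly in the
dimension. -/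
theorem exists_norm_hessian_batchLoss_le (hn : 0 < n) (w : Param M) :
    ∃ δ : (Fin n → X) → ℝ, Measurable δ ∧ (∀ x, ‖hessian (batchLoss q x) w‖ ≤ L + δ x) ∧
      ExpectationLE (Measure.pi fun _ : Fin n => ν) (fun x => δ x ^ 4) (48 * σH ^ 4 / n ^ 2) := by
  set e := ∫ y, ‖hessian (fun v => q v y) w‖ ∂ν with he
  have hm : Measurable fun x => ‖hessian (fun v => q v x) w‖ - e :=
    (h.measurable_hessian w).norm.sub_const _
  have h4 := h.memLp_norm_hessian_sub_mean w
  have hnn : (n : ℝ) ≠ 0 := by positivity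
  -- `δ` is the batch mean of the centred scalars `‖∇²‖ - e`, and `e ≤ L`. The constant is `48 = 3 ·
  -- 4²`, from the fourth moment of a mean with `τ = 4 σH²`.
  refine ⟨fun x => (1 / (n : ℝ)) • ∑ j, (‖hessian (fun v => q v (x j)) w‖ - e), ?_, ?_, ?_, ?_⟩
  · exact (Finset.measurable_sum _ fun j _ => hm.comp (measurable_pi_apply j)).const_smul (1 / (n : ℝ))
  · intro x
    refine (h.norm_hessian_batchLoss_le x w).trans ?_
    have h1 : (1 / (n : ℝ)) • ∑ j, (‖hessian (fun v => q v (x j)) w‖ - e)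
        = (1 / (n : ℝ)) * ∑ j, ‖hessian (fun v => q v (x j)) w‖ - e := by
      rw [Finset.sum_sub_distrib, smul_eq_mul, mul_sub, Finset.sum_const, Finset.card_univ,
        Fintype.card_fin, nsmul_eq_mul, ← mul_assoc, one_div_mul_cancel hnn, one_mul]
    simp only [h1]
    linarith [h.integral_norm_hessian_le w]
  · have := integrable_norm_pow_four (memLp_mean (n := n) h4)
    simpa only [Real.norm_eq_abs, Even.pow_abs (show Even 4 by decide)] using this
  · have h5 := integral_norm_mean_pow_four_le hn hm h4 (by
        rw [integral_sub (h.integrable_hessian w).norm (integrable_const _)]; simp [he])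
      (τ := 4 * σH ^ 2) (by positivity) (by
        simpa only [Real.norm_eq_abs, Even.pow_abs (show Even 4 by decide)] using
          h.integral_norm_hessian_sub_mean_pow_four_le w)
    simp only [Real.norm_eq_abs, Even.pow_abs (show Even 4 by decide)] at h5
    refine h5.trans (le_of_eq ?_)
    ring

end TaskAssumptions

/-! ### Expectations over product measures. -/

section Products

variable {Ω Ω' : Type*} [MeasurableSpace Ω] [MeasurableSpace Ω'] {μ : Measure Ω} {ν : Measure Ω'}
  [IsProbabilityMeasure μ] [IsProbabilityMeasure ν]

/-- For nonnegative functions, Tonelli turns bounds conditional on the first coordinate into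
integrability on the product. This serves to freeze the inner batch and, later, the current iterate.
-/
theorem ExpectationLE.prod {f : Ω × Ω' → ℝ} {k : Ω → ℝ} {c : ℝ} (hm : Measurable f)
    (h0 : ∀ p, 0 ≤ f p) (h : ∀ ω, ExpectationLE ν (fun ω' => f (ω, ω')) (k ω))
    (hk : ExpectationLE μ k c) : ExpectationLE (μ.prod ν) f c := by
  have hi : Integrable f (μ.prod ν) := by
    rw [integrable_prod_iff hm.aestronglyMeasurable]
    refine ⟨ae_of_all _ fun ω => (h ω).1, hk.1.mono'
      hm.norm.stronglyMeasurable.integral_prod_right'.aestronglyMeasurable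
      (ae_of_all _ fun ω => ?_)⟩
    rw [Real.norm_of_nonneg (integral_nonneg fun _ => norm_nonneg _)]
    refine (integral_congr_ae (ae_of_all _ fun ω' => ?_)).trans_le (h ω).2
    exact Real.norm_of_nonneg (h0 _)
  refine ⟨hi, ?_⟩
  rw [integral_prod _ hi]
  exact (integral_mono hi.integral_prod_left hk.1 fun ω => (h ω).2).trans hk.2

theorem ExpectationLE.comp_fst {f : Ω → ℝ} {c : ℝ} (h : ExpectationLE μ f c) :
    ExpectationLE (μ.prod ν) (fun p => f p.1) c := by
  refine ⟨h.1.comp_fst ν, ?_⟩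
  rw [integral_fun_fst]
  simpa using h.2

end Products

/-- Cauchy–Schwarz with weights `1/12 + 5/6 + 1/12 = 1`. They are chosen so that `2 * C1sq` pays
exactly for the outer noise and the Hessian noise, and with room to spare for the middle term. -/
theorem norm_add_add_sq_le {E : Type*} [SeminormedAddCommGroup E] (x y z : E) :
    ‖x + y + z‖ ^ 2 ≤ 12 * ‖x‖ ^ 2 + 6 / 5 * ‖y‖ ^ 2 + 12 * ‖z‖ ^ 2 := by
  have h := norm_add₃_le (a := x) (b := y) (c := z)
  have h2 : ‖x + y + z‖ ^ 2 ≤ (‖x‖ + ‖y‖ + ‖z‖) ^ 2 := pow_le_pow_left₀ (norm_nonneg _) h 2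
  nlinarith [sq_nonneg (10 * ‖x‖ - ‖y‖), sq_nonneg (10 * ‖z‖ - ‖y‖), sq_nonneg (‖x‖ - ‖z‖)]

/-! ### The adjusted risk of one task: its gradient, and the outer noise. -/

namespace TaskAssumptions

variable {M : ℕ} {X : Type*} [MeasurableSpace X] {ν : Measure X} [IsProbabilityMeasure ν]
  {q : Param M → X → ℝ} {ℓ : X → ℝ} {L ρ B σG σH : ℝ}
  (h : TaskAssumptions ν q ℓ L ρ B σG σH) {n m : ℕ} {α : ℝ}

include h

theorem norm_innerStep_sub_le (hα : 0 ≤ α) (x : Fin n → X) (w u : Param M) :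
    ‖innerStep α q x w - innerStep α q x u‖
      ≤ (1 + α * ((1 / (n : ℝ)) * ∑ j, ℓ (x j))) * ‖w - u‖ := by
  have h1 : innerStep α q x w - innerStep α q x u
      = (w - u) - α • (gradient (batchLoss q x) w - gradient (batchLoss q x) u) := by
    unfold innerStep; rw [smul_sub]; abel
  rw [h1]
  refine (norm_sub_le _ _).trans ?_
  rw [norm_smul, Real.norm_of_nonneg hα]
  have := mul_le_mul_of_nonneg_left (h.lipschitz_gradient_batchLoss x w u) hα
  linarith

theorem norm_pullbackGradient_le (hα : 0 ≤ α) (x : Fin n → X) (w : Param M) :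
    ‖pullbackGradient α q (gradient fun v => ∫ x, q v x ∂ν) x w‖
      ≤ B * (1 + α * ((1 / (n : ℝ)) * ∑ j, ℓ (x j))) := by
  refine (ContinuousLinearMap.le_opNorm _ _).trans ?_
  rw [mul_comm]
  exact mul_le_mul (h.norm_gradient_risk_le _)
    (norm_id_sub_smul_le hα (h.norm_hessian_batchLoss_le_mean_lip x w)) (norm_nonneg _) h.nonneg_B

theorem integrable_pullbackGradient (hn : 0 < n) (hα : 0 ≤ α) (w : Param M) :
    Integrable (fun x : Fin n → X => pullbackGradient α q (gradient fun v => ∫ x, q v x ∂ν) x w)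
      (Measure.pi fun _ : Fin n => ν) :=
  ((h.expectation_one_add_mean_lip_le hn hα).1.const_mul B).mono'
    (h.measurable_pullbackGradient_pi α w).aestronglyMeasurable
    (ae_of_all _ fun x => h.norm_pullbackGradient_le hα x w)

theorem abs_risk_sub_le (w u : Param M) :
    |(∫ x, q w x ∂ν) - ∫ x, q u x ∂ν| ≤ B * ‖w - u‖ :=
  abs_sub_le_of_norm_gradient_le (f := fun v => ∫ x, q v x ∂ν) h.differentiable_risk
    h.norm_gradient_risk_le w u

theorem integrable_risk_innerStep (hn : 0 < n) (w : Param M) :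
    Integrable (fun x : Fin n → X => ∫ y, q (innerStep α q x w) y ∂ν)
      (Measure.pi fun _ : Fin n => ν) := by
  have hm : Measurable fun x : Fin n → X => ∫ y, q (innerStep α q x w) y ∂ν :=
    (h.differentiable_risk.continuous.measurable.comp (h.measurable_innerStep_pi α w) :)
  have h1 := ((h.norm_gradient_batchLoss_expectation hn w).1.const_mul (B * |α|)).add
    (integrable_const |∫ y, q w y ∂ν|)
  refine h1.mono' hm.aestronglyMeasurable (ae_of_all _ fun x => ?_)
  have h2 := h.abs_risk_sub_le (innerStep α q x w) w
  have h3 : ‖innerStep α q x w - w‖ = |α| * ‖gradient (batchLoss q x) w‖ := by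
    unfold innerStep
    rw [sub_sub_cancel_left, norm_neg, norm_smul, Real.norm_eq_abs]
  rw [h3] at h2
  have h4 := abs_sub_abs_le_abs_sub (∫ y, q (innerStep α q x w) y ∂ν) (∫ y, q w y ∂ν)
  simp only [Real.norm_eq_abs, Pi.add_apply]
  linarith

theorem abs_risk_innerStep_sub_le (hα : 0 ≤ α) (x : Fin n → X) (w u : Param M) :
    |(∫ y, q (innerStep α q x w) y ∂ν) - ∫ y, q (innerStep α q x u) y ∂ν|
      ≤ B * (1 + α * ((1 / (n : ℝ)) * ∑ j, ℓ (x j))) * ‖w - u‖ := by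
  refine (h.abs_risk_sub_le _ _).trans ?_
  rw [mul_assoc]
  exact mul_le_mul_of_nonneg_left (h.norm_innerStep_sub_le hα x w u) h.nonneg_B

/-- For a given inner batch the integrand is Lipschitz in `w` with constant `B (1 + α ℓ̄)`, where
`ℓ̄` is the batch mean of `ℓ`; this is integrable, so differentiation passes under the integral. -/
theorem hasGradientAt_adjustedRisk (hn : 0 < n) (hα : 0 ≤ α) (w : Param M) :
    HasGradientAt
      (fun w => ∫ x, ∫ y, q (innerStep α q x w) y ∂ν ∂(Measure.pi fun _ : Fin n => ν))
      (∫ x, pullbackGradient α q (gradient fun v => ∫ x, q v x ∂ν) x w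
        ∂(Measure.pi fun _ : Fin n => ν)) w := by
  have hint := h.integrable_pullbackGradient hn hα w
  have h1 := hasFDerivAt_integral_of_dominated_loc_of_lip' (μ := Measure.pi fun _ : Fin n => ν)
    (F := fun w x => ∫ y, q (innerStep α q x w) y ∂ν) (x₀ := w)
    (F' := fun x => InnerProductSpace.toDual ℝ (Param M)
      (pullbackGradient α q (gradient fun v => ∫ x, q v x ∂ν) x w))
    Filter.univ_mem (fun u _ => (h.integrable_risk_innerStep hn u).1)
    (h.integrable_risk_innerStep hn w)
    ((LinearIsometryEquiv.continuous _).comp_aestronglyMeasurable hint.1)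
    (ae_of_all _ fun x u _ => h.abs_risk_innerStep_sub_le hα x u w)
    ((h.expectation_one_add_mean_lip_le hn hα).1.const_mul B)
    (ae_of_all _ fun x => (hasGradientAt_comp_innerStep h.differentiable
      h.differentiable_gradient h.differentiable_risk α x w).hasFDerivAt)
  rw [hasGradientAt_iff_hasFDerivAt]
  refine h1.2.congr_fderiv ?_
  exact (InnerProductSpace.toDual ℝ (Param M)).toContinuousLinearEquiv.toContinuousLinearMap
    |>.integral_comp_comm hint

theorem norm_integral_pullbackGradient_le (hn : 0 < n) (hα : 0 ≤ α) (w : Param M) :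
    ‖∫ x, pullbackGradient α q (gradient fun v => ∫ x, q v x ∂ν) x w
        ∂(Measure.pi fun _ : Fin n => ν)‖ ≤ B * (1 + α * L) := by
  have h1 := (h.expectation_one_add_mean_lip_le hn hα).const_mul h.nonneg_B
  exact (norm_integral_le_of_norm_le h1.1
    (ae_of_all _ fun x => h.norm_pullbackGradient_le hα x w)).trans h1.2

theorem hessian_batchLoss_sub_expectation (hn : 0 < n) (w u : Param M) :
    ExpectationLE (Measure.pi fun _ : Fin n => ν)
      (fun x => ‖hessian (batchLoss q x) w - hessian (batchLoss q x) u‖) (ρ * ‖w - u‖) := by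
  have hl := h.lipschitz_hessian w u
  have h1 : ExpectationLE (Measure.pi fun _ : Fin n => ν)
      (fun x => (1 / (n : ℝ)) *
        ∑ j, ‖hessian (fun v => q v (x j)) w - hessian (fun v => q v (x j)) u‖)
      (ρ * ‖w - u‖) :=
    ⟨integrable_mean_pi hl.1, (integral_mean_pi hn hl.1).trans_le hl.2⟩
  refine h1.mono ((h.measurable_hessian_batchLoss_pi w).sub
    (h.measurable_hessian_batchLoss_pi u)).norm.aestronglyMeasurable (fun _ => norm_nonneg _)
    fun x => ?_
  rw [hessian_batchLoss h.differentiable h.differentiable_gradient,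
    hessian_batchLoss h.differentiable h.differentiable_gradient,
    ← smul_sub (1 / (n : ℝ)) (∑ j, hessian (fun v => q v (x j)) w)
      (∑ j, hessian (fun v => q v (x j)) u), ← Finset.sum_sub_distrib, norm_smul, Real.norm_of_nonneg (by positivity)]
  gcongr
  exact norm_sum_le _ _

/-- The vector and the matrix are changed one at a time. One factor `1 + α ℓ̄` comes from the matrix
and another from the inner step; their square is why a second moment of `ℓ` is needed, and its
average gives the first term of `Lhat`. -/
theorem norm_pullbackGradient_sub_le (hα : 0 ≤ α) (x : Fin n → X) (w u : Param M) :
    ‖pullbackGradient α q (gradient fun v => ∫ x, q v x ∂ν) x w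
        - pullbackGradient α q (gradient fun v => ∫ x, q v x ∂ν) x u‖
      ≤ L * ‖w - u‖ * (1 + α * ((1 / (n : ℝ)) * ∑ j, ℓ (x j))) ^ 2
        + α * B * ‖hessian (batchLoss q x) w - hessian (batchLoss q x) u‖ := by
  unfold pullbackGradient
  have h1 := norm_id_sub_smul_le hα (h.norm_hessian_batchLoss_le_mean_lip x w)
  have h2 := h.lipschitz_gradient_risk (innerStep α q x w) (innerStep α q x u)
  have h3 := h.norm_innerStep_sub_le hα x w u
  have h4 := h.norm_gradient_risk_le (innerStep α q x u)
  have hℓ := h.mean_lip_nonneg x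
  generalize (1 / (n : ℝ)) * ∑ j, ℓ (x j) = l at *
  generalize gradient (fun v => ∫ x, q v x ∂ν) (innerStep α q x w) = a at *
  generalize gradient (fun v => ∫ x, q v x ∂ν) (innerStep α q x u) = b at *
  generalize hessian (batchLoss q x) w = H at *
  generalize hessian (batchLoss q x) u = H' at *
  have e : (ContinuousLinearMap.id ℝ (Param M) - α • H) a
      - (ContinuousLinearMap.id ℝ (Param M) - α • H') b
      = (ContinuousLinearMap.id ℝ (Param M) - α • H) (a - b) - α • (H - H') b := by
    simp [smul_sub]
    abel
  rw [e]
  refine (norm_sub_le _ _).trans (add_le_add ?_ ?_)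
  · calc _ ≤ ‖ContinuousLinearMap.id ℝ (Param M) - α • H‖ * ‖a - b‖ :=
          ContinuousLinearMap.le_opNorm _ _
      _ ≤ (1 + α * l) * (L * ((1 + α * l) * ‖w - u‖)) := by
          refine mul_le_mul h1 (h2.trans (mul_le_mul_of_nonneg_left h3 h.nonneg_L))
            (norm_nonneg _) (by positivity)
      _ = _ := by ring
  · rw [norm_smul, Real.norm_of_nonneg hα]
    have h5 := (H - H').le_opNorm b
    calc α * ‖(H - H') b‖ ≤ α * (‖H - H'‖ * B) := by
          refine mul_le_mul_of_nonneg_left (h5.trans ?_) hα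
          exact mul_le_mul_of_nonneg_left h4 (norm_nonneg _)
      _ = _ := by ring

theorem norm_integral_pullbackGradient_sub_le (hn : 0 < n) (hα : 0 ≤ α) (w u : Param M) :
    ‖(∫ x, pullbackGradient α q (gradient fun v => ∫ x, q v x ∂ν) x w
          ∂(Measure.pi fun _ : Fin n => ν))
        - ∫ x, pullbackGradient α q (gradient fun v => ∫ x, q v x ∂ν) x u
          ∂(Measure.pi fun _ : Fin n => ν)‖ ≤ Lhat α L ρ B * ‖w - u‖ := by
  rw [← integral_sub (h.integrable_pullbackGradient hn hα w)
    (h.integrable_pullbackGradient hn hα u)]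
  have h1 := (h.expectation_one_add_mean_lip_sq_le hn hα).const_mul (c := L * ‖w - u‖)
    (mul_nonneg h.nonneg_L (norm_nonneg _))
  have h2 := (h.hessian_batchLoss_sub_expectation hn w u).const_mul (c := α * B)
    (mul_nonneg hα h.nonneg_B)
  have h3 := h1.add h2
  refine (norm_integral_le_of_norm_le h3.1
    (ae_of_all _ fun x => h.norm_pullbackGradient_sub_le hα x w u)).trans (h3.2.trans ?_)
  unfold Lhat
  exact le_of_eq (by ring)

/-- The noise of the outer gradient, seen through the inner step. -/
theorem outer_noise_sq (hn : 0 < n) (hm : 0 < m) (hα : 0 ≤ α) (w : Param M) :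
    ExpectationLE ((Measure.pi fun _ : Fin n => ν).prod (Measure.pi fun _ : Fin m => ν))
      (fun p => ‖sampleGradient α q p.1 p.2 w
        - pullbackGradient α q (gradient fun v => ∫ x, q v x ∂ν) p.1 w‖ ^ 2)
      ((1 + α * L) ^ 2 * (σG ^ 2 / m)) := by
  have hk := (h.expectation_one_add_mean_lip_sq_le hn hα).const_mul (c := σG ^ 2 / m)
    (by positivity)
  rw [mul_comm (σG ^ 2 / (m : ℝ)) ((1 + α * L) ^ 2)] at hk
  have hmeas : Measurable fun p : (Fin n → X) × (Fin m → X) => sampleGradient α q p.1 p.2 w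
      - pullbackGradient α q (gradient fun v => ∫ x, q v x ∂ν) p.1 w :=
    (h.measurable_sampleGradient_pi α w).sub
      ((h.measurable_pullbackGradient_pi α w).comp measurable_fst)
  -- Given the inner batch, the outer gradient is evaluated at a fixed point, so the noise bound for
  -- fixed parameters applies.
  refine ExpectationLE.prod (hmeas.norm.pow_const 2) (fun _ => by positivity) (fun x => ?_) hk
  have h1 := (h.gradient_batch_noise_sq hm (innerStep α q x w)).const_mul
    (c := (1 + α * ((1 / (n : ℝ)) * ∑ j, ℓ (x j))) ^ 2) (by positivity)
  rw [mul_comm _ (σG ^ 2 / (m : ℝ))] at h1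
  refine h1.mono ((hmeas.comp measurable_prodMk_left).norm.pow_const 2).aestronglyMeasurable
    (fun _ => by positivity) fun y => ?_
  unfold sampleGradient pullbackGradient
  simp only
  rw [← map_sub, ← mul_pow]
  refine pow_le_pow_left₀ (norm_nonneg _) ((ContinuousLinearMap.le_opNorm _ _).trans ?_) 2
  exact mul_le_mul_of_nonneg_right
    (norm_id_sub_smul_le hα (h.norm_hessian_batchLoss_le_mean_lip x w)) (norm_nonneg _)

end TaskAssumptions

/-! ### Distance of the stochastic meta-gradient from its batch-free version. -/

/-- The gradient of `w ↦ f (w - α ∇f (w))`. -/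
noncomputable def exactMetaGradient {M : ℕ} (α : ℝ) (f : Param M → ℝ) (w : Param M) : Param M :=
  (ContinuousLinearMap.id ℝ (Param M) - α • hessian f w) (gradient f (w - α • gradient f w))

namespace TaskAssumptions

variable {M : ℕ} {X : Type*} [MeasurableSpace X] {ν : Measure X} [IsProbabilityMeasure ν]
  {q : Param M → X → ℝ} {ℓ : X → ℝ} {L ρ B σG σH : ℝ}
  (h : TaskAssumptions ν q ℓ L ρ B σG σH) {n m : ℕ} {α : ℝ}

include h

/-- Matrix and vector depend on the same inner batch, so their norms cannot be averaged separately.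
With `‖∇²‖ ≤ L + δ` and `r` the norm of the inner gradient noise, the coupled part is `2 α⁴ L² δ²
r²`, which Young's inequality splits into `α⁴ δ⁴ / 4 + 4 α⁴ L⁴ r⁴`. This is where fourth moments
enter. -/
theorem inner_noise_sq (hn : 0 < n) (hα : 0 ≤ α) (w : Param M) :
    ExpectationLE (Measure.pi fun _ : Fin n => ν)
      (fun x => ‖(ContinuousLinearMap.id ℝ (Param M) - α • hessian (batchLoss q x) w)
        (gradient (fun v => ∫ x, q v x ∂ν) (innerStep α q x w)
          - gradient (fun v => ∫ x, q v x ∂ν)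
            (w - α • gradient (fun v => ∫ x, q v x ∂ν) w))‖ ^ 2)
      (2 * (1 + α * L) ^ 2 * α ^ 2 * L ^ 2 * (σG ^ 2 / n)
        + (α ^ 4 / 4 * (48 * σH ^ 4 / n ^ 2) + 4 * α ^ 4 * L ^ 4 * (3 * σG ^ 4 / n ^ 2))) := by
  obtain ⟨δ, hδm, hδ, hδ4⟩ := h.exists_norm_hessian_batchLoss_le hn w
  have h1 := (h.gradient_batch_noise_sq hn w).const_mul
    (c := 2 * (1 + α * L) ^ 2 * α ^ 2 * L ^ 2) (by positivity)
  have h2 := hδ4.const_mul (c := α ^ 4 / 4) (by positivity)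
  have h3 := (h.gradient_batch_noise_pow_four hn w).const_mul (c := 4 * α ^ 4 * L ^ 4)
    (by positivity)
  have hHm := h.measurable_hessian_batchLoss_pi (n := n) w
  have hvm : Measurable fun x : Fin n → X =>
      gradient (fun v => ∫ x, q v x ∂ν) (innerStep α q x w) :=
    (h.measurable_gradient_risk.comp (h.measurable_innerStep_pi α w) :)
  have hc : Continuous fun p : (Param M →L[ℝ] Param M) × Param M =>
      (ContinuousLinearMap.id ℝ (Param M) - α • p.1) p.2 := by fun_prop
  have hmeas := (hc.measurable.comp (hHm.prodMk (hvm.sub_const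
    (gradient (fun v => ∫ x, q v x ∂ν) (w - α • gradient (fun v => ∫ x, q v x ∂ν) w))))).norm.pow_const 2
  refine (h1.add (h2.add h3)).mono hmeas.aestronglyMeasurable (fun _ => by positivity) fun x => ?_
  have e1 := norm_id_sub_smul_le hα (hδ x)
  have e2 := h.lipschitz_gradient_risk (innerStep α q x w)
    (w - α • gradient (fun v => ∫ x, q v x ∂ν) w)
  have e3 : innerStep α q x w - (w - α • gradient (fun v => ∫ x, q v x ∂ν) w)
      = -(α • (gradient (batchLoss q x) w - gradient (fun v => ∫ x, q v x ∂ν) w)) := by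
    unfold innerStep; rw [smul_sub]; abel
  rw [e3, norm_neg, norm_smul, Real.norm_of_nonneg hα] at e2
  have hL := h.nonneg_L
  generalize ‖gradient (batchLoss q x) w - gradient (fun v => ∫ x, q v x ∂ν) w‖ = r at *
  generalize gradient (fun v => ∫ x, q v x ∂ν) (innerStep α q x w)
    - gradient (fun v => ∫ x, q v x ∂ν) (w - α • gradient (fun v => ∫ x, q v x ∂ν) w) = a at *
  generalize ContinuousLinearMap.id ℝ (Param M) - α • hessian (batchLoss q x) w = A at *
  have e4 : ‖A a‖ ≤ (1 + α * (L + δ x)) * (L * (α * r)) :=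
    (A.le_opNorm a).trans (mul_le_mul e1 e2 (norm_nonneg _) ((norm_nonneg _).trans e1))
  have e5 : ‖A a‖ ^ 2 ≤ ((1 + α * (L + δ x)) * (L * (α * r))) ^ 2 :=
    pow_le_pow_left₀ (norm_nonneg _) e4 2
  refine e5.trans ?_
  have e6 : (1 + α * (L + δ x)) ^ 2 ≤ 2 * (1 + α * L) ^ 2 + 2 * (α * δ x) ^ 2 := by
    nlinarith [sq_nonneg (1 + α * L - α * δ x)]
  calc ((1 + α * (L + δ x)) * (L * (α * r))) ^ 2
      = (1 + α * (L + δ x)) ^ 2 * (L * (α * r)) ^ 2 := by ring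
    _ ≤ (2 * (1 + α * L) ^ 2 + 2 * (α * δ x) ^ 2) * (L * (α * r)) ^ 2 :=
        mul_le_mul_of_nonneg_right e6 (sq_nonneg _)
    _ ≤ _ := by nlinarith [sq_nonneg (α ^ 2 * (δ x ^ 2 / 2 - 2 * L ^ 2 * r ^ 2))]

theorem measurable_sampleGradient_sub_pi (w a : Param M) :
    Measurable fun p : (Fin n → X) × (Fin m → X) => sampleGradient α q p.1 p.2 w - a :=
  (h.measurable_sampleGradient_pi α w).sub_const a

/-- The reference point is the meta-gradient with exact gradients and Hessian, not the mean of the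
sample. The deviation splits into outer gradient noise, inner gradient noise carried through the
outer gradient, and Hessian noise applied to a deterministic vector. -/
theorem sampleGradient_noise_sq (hn : 0 < n) (hm : 0 < m) (hα : 0 ≤ α) (w : Param M) :
    ExpectationLE ((Measure.pi fun _ : Fin n => ν).prod (Measure.pi fun _ : Fin m => ν))
      (fun p => ‖sampleGradient α q p.1 p.2 w - exactMetaGradient α (fun v => ∫ x, q v x ∂ν) w‖ ^ 2)
      (2 * C1sq α L B σG σH n m) := by
  have hx := (h.outer_noise_sq hn hm hα w).const_mul (c := 12) (by norm_num)
  have hy := ((h.inner_noise_sq hn hα w).comp_fst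
    (ν := Measure.pi fun _ : Fin m => ν)).const_mul (c := 6 / 5) (by norm_num)
  have hz := ((h.hessian_batch_noise_apply_sq hn w (gradient (fun v => ∫ x, q v x ∂ν)
    (w - α • gradient (fun v => ∫ x, q v x ∂ν) w))).comp_fst
    (ν := Measure.pi fun _ : Fin m => ν)).const_mul (c := 12 * α ^ 2) (by positivity)
  refine (((hx.add hy).add hz).mono
    ((h.measurable_sampleGradient_sub_pi w _).norm.pow_const 2).aestronglyMeasurable
    (fun _ => by positivity) fun p => ?_).trans ?_
  · refine le_trans (le_of_eq ?_) ((norm_add_add_sq_le (sampleGradient α q p.1 p.2 w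
      - pullbackGradient α q (gradient fun v => ∫ x, q v x ∂ν) p.1 w)
      ((ContinuousLinearMap.id ℝ (Param M) - α • hessian (batchLoss q p.1) w)
        (gradient (fun v => ∫ x, q v x ∂ν) (innerStep α q p.1 w)
          - gradient (fun v => ∫ x, q v x ∂ν)
            (w - α • gradient (fun v => ∫ x, q v x ∂ν) w)))
      (-(α • (hessian (batchLoss q p.1) w - hessian (fun v => ∫ x, q v x ∂ν) w)
        (gradient (fun v => ∫ x, q v x ∂ν)
          (w - α • gradient (fun v => ∫ x, q v x ∂ν) w))))).trans (le_of_eq ?_))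
    · congr 2
      unfold pullbackGradient exactMetaGradient
      generalize gradient (fun v => ∫ x, q v x ∂ν) (innerStep α q p.1 w) = v
      generalize gradient (fun v => ∫ x, q v x ∂ν)
          (w - α • gradient (fun v => ∫ x, q v x ∂ν) w) = v0
      generalize hessian (batchLoss q p.1) w = A
      generalize hessian (fun v => ∫ x, q v x ∂ν) w = A'
      simp [smul_sub]
      abel
    · rw [norm_neg, norm_smul, mul_pow, Real.norm_eq_abs, sq_abs]
      ring
  · have hB : ‖gradient (fun v => ∫ x, q v x ∂ν)
        (w - α • gradient (fun v => ∫ x, q v x ∂ν) w)‖ ^ 2 ≤ B ^ 2 :=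
      pow_le_pow_left₀ (norm_nonneg _) (h.norm_gradient_risk_le _) 2
    have hL := h.nonneg_L
    generalize ‖gradient (fun v => ∫ x, q v x ∂ν)
        (w - α • gradient (fun v => ∫ x, q v x ∂ν) w)‖ ^ 2 = b at *
    have hn' : (0 : ℝ) < n := by exact_mod_cast hn
    have hm' : (0 : ℝ) < m := by exact_mod_cast hm
    -- The outer and Hessian terms match those of `2 * C1sq` once the vector is bounded by `B`; for
    -- the middle term `12/5 ≤ 12` and `72/5 ≤ 18`. The product term in `σH² σG²` is slack.
    unfold C1sq
    have t1 : 12 * α ^ 2 * (σH ^ 2 * b / n) ≤ 12 * α ^ 2 * (σH ^ 2 * B ^ 2 / n) := by gcongr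
    have t2 : 0 ≤ (1 + α * L) ^ 2 * α ^ 2 * L ^ 2 * (σG ^ 2 / n) := by positivity
    have t3 : 0 ≤ α ^ 2 * σH ^ 2 / n * (σG ^ 2 / m) := by positivity
    have t4 : 0 ≤ α ^ 4 / n ^ 2 * σH ^ 4 := by positivity
    have t5 : 0 ≤ α ^ 4 / n ^ 2 * (L ^ 4 * σG ^ 4) := by positivity
    have e : 2 * (6 * (1 + α * L) ^ 2 * σG ^ 2 * (1 / (m : ℝ) + L ^ 2 * α ^ 2 / (n : ℝ))
        + 6 * α ^ 2 * σH ^ 2 / (n : ℝ) * (B ^ 2 + σG ^ 2 / (m : ℝ))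
        + 9 * α ^ 4 / (n : ℝ) ^ 2 * (σH ^ 4 + L ^ 4 * σG ^ 4))
        = 12 * ((1 + α * L) ^ 2 * (σG ^ 2 / m))
          + 12 * ((1 + α * L) ^ 2 * α ^ 2 * L ^ 2 * (σG ^ 2 / n))
          + 12 * α ^ 2 * (σH ^ 2 * B ^ 2 / n) + 12 * (α ^ 2 * σH ^ 2 / n * (σG ^ 2 / m))
          + 18 * (α ^ 4 / n ^ 2 * σH ^ 4) + 18 * (α ^ 4 / n ^ 2 * (L ^ 4 * σG ^ 4)) := by
      field_simp
      ring
    have e' : 6 / 5 * (2 * (1 + α * L) ^ 2 * α ^ 2 * L ^ 2 * (σG ^ 2 / n)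
        + (α ^ 4 / 4 * (48 * σH ^ 4 / n ^ 2) + 4 * α ^ 4 * L ^ 4 * (3 * σG ^ 4 / n ^ 2)))
        = 12 / 5 * ((1 + α * L) ^ 2 * α ^ 2 * L ^ 2 * (σG ^ 2 / n))
          + 72 / 5 * (α ^ 4 / n ^ 2 * σH ^ 4) + 72 / 5 * (α ^ 4 / n ^ 2 * (L ^ 4 * σG ^ 4)) := by
      field_simp
      ring
    rw [e, e']
    linarith

theorem memLp_sampleGradient_sub (hn : 0 < n) (hm : 0 < m) (hα : 0 ≤ α) (w : Param M) :
    MemLp (fun p : (Fin n → X) × (Fin m → X) => sampleGradient α q p.1 p.2 w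
      - exactMetaGradient α (fun v => ∫ x, q v x ∂ν) w) 2
      ((Measure.pi fun _ : Fin n => ν).prod (Measure.pi fun _ : Fin m => ν)) :=
  (memLp_two_iff_integrable_sq_norm
    (h.measurable_sampleGradient_sub_pi w _).aestronglyMeasurable).2
    (h.sampleGradient_noise_sq hn hm hα w).1

theorem integrable_sampleGradient (hn : 0 < n) (hm : 0 < m) (hα : 0 ≤ α) (w : Param M) :
    Integrable (fun p : (Fin n → X) × (Fin m → X) => sampleGradient α q p.1 p.2 w)
      ((Measure.pi fun _ : Fin n => ν).prod (Measure.pi fun _ : Fin m => ν)) := by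
  have h1 := ((h.memLp_sampleGradient_sub hn hm hα w).integrable (by norm_num)).add
    (integrable_const (exactMetaGradient α (fun v => ∫ x, q v x ∂ν) w))
  refine h1.congr (ae_of_all _ fun p => ?_)
  simp

/-- Given the inner batch, the matrix and the evaluation point are constant, and the outer gradient
averages to the gradient of the risk. -/
theorem integral_sampleGradient (hn : 0 < n) (hm : 0 < m) (hα : 0 ≤ α) (w : Param M) :
    ∫ p, sampleGradient α q p.1 p.2 w
        ∂((Measure.pi fun _ : Fin n => ν).prod (Measure.pi fun _ : Fin m => ν))
      = ∫ x, pullbackGradient α q (gradient fun v => ∫ x, q v x ∂ν) x w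
        ∂(Measure.pi fun _ : Fin n => ν) := by
  rw [integral_prod _ (h.integrable_sampleGradient hn hm hα w)]
  refine integral_congr_ae (ae_of_all _ fun x => ?_)
  have h1 := (ContinuousLinearMap.id ℝ (Param M)
    - α • hessian (batchLoss q x) w).integral_comp_comm
      (h.integrable_gradient_batchLoss (n := m) (innerStep α q x w))
  have h2 : ∫ y, gradient (batchLoss q y) (innerStep α q x w) ∂(Measure.pi fun _ : Fin m => ν)
      = gradient (fun v => ∫ x, q v x ∂ν) (innerStep α q x w) := by
    simp only [gradient_batchLoss h.differentiable]
    rw [integral_mean_pi hm (h.integrable_gradient (innerStep α q x w)), h.gradient_risk]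
  rw [h2] at h1
  exact h1

end TaskAssumptions

/-! ### Integration over tasks, and variance as minimal mean square distance. -/

theorem ExpectationLE.compProd {T Ω : Type*} [MeasurableSpace T] [MeasurableSpace Ω]
    {μ : Measure T} {κ : Kernel T Ω} [IsProbabilityMeasure μ] [IsMarkovKernel κ]
    {f : T × Ω → ℝ} {k : T → ℝ} {c : ℝ} (hm : Measurable f)
    (h0 : ∀ p, 0 ≤ f p) (h : ∀ t, ExpectationLE (κ t) (fun ω => f (t, ω)) (k t))
    (hk : ExpectationLE μ k c) : ExpectationLE (μ ⊗ₘ κ) f c := by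
  have hi : Integrable f (μ ⊗ₘ κ) := by
    rw [Measure.integrable_compProd_iff hm.aestronglyMeasurable]
    refine ⟨ae_of_all _ fun ω => (h ω).1, hk.1.mono'
      (hm.norm.stronglyMeasurable.integral_kernel_prod_right' (κ := κ)).aestronglyMeasurable
      (ae_of_all _ fun ω => ?_)⟩
    rw [Real.norm_of_nonneg (integral_nonneg fun _ => norm_nonneg _)]
    refine (integral_congr_ae (ae_of_all _ fun ω' => ?_)).trans_le (h ω).2
    exact Real.norm_of_nonneg (h0 _)
  refine ⟨hi, ?_⟩
  rw [Measure.integral_compProd hi]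
  refine (integral_mono (hk.1.mono'
    (hm.stronglyMeasurable.integral_kernel_prod_right' (κ := κ)).aestronglyMeasurable
    (ae_of_all _ fun t => ?_)) hk.1 fun t => (h t).2).trans hk.2
  rw [Real.norm_of_nonneg (integral_nonneg fun _ => h0 _)]
  exact (h t).2

theorem norm_integral_sub_integral_le {T E : Type*} [MeasurableSpace T] {μ : Measure T}
    [IsProbabilityMeasure μ] [NormedAddCommGroup E] [NormedSpace ℝ E] {f g : T → E} {c : ℝ}
    (hf : Integrable f μ) (hg : Integrable g μ) (h : ∀ t, ‖f t - g t‖ ≤ c) :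
    ‖(∫ t, f t ∂μ) - ∫ t, g t ∂μ‖ ≤ c := by
  rw [← integral_sub hf hg]
  simpa using norm_integral_le_of_norm_le (integrable_const c) (ae_of_all μ h)

/-- The cross term vanishes, so the mean is the best constant. A variance can thus be bounded
through any explicit reference point, without knowing how far that point is from the mean. -/
theorem integral_norm_sub_integral_sq_le {Ω E : Type*} [MeasurableSpace Ω] {μ : Measure Ω}
    [IsProbabilityMeasure μ] [NormedAddCommGroup E] [InnerProductSpace ℝ E] [CompleteSpace E]
    {G : Ω → E} (hG : MemLp G 2 μ) (c : E) :
    ∫ ω, ‖G ω - ∫ ω', G ω' ∂μ‖ ^ 2 ∂μ ≤ ∫ ω, ‖G ω - c‖ ^ 2 ∂μ := by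
  set g := ∫ ω', G ω' ∂μ with hg
  have hGi : Integrable G μ := hG.integrable (by norm_num)
  have h1 : Integrable (fun ω => ‖G ω - g‖ ^ 2) μ := by
    simpa using (hG.sub (memLp_const g)).integrable_norm_pow (p := 2) (by norm_num)
  have h2 : Integrable (fun ω => 2 * inner ℝ (G ω - g) (g - c)) μ :=
    ((hGi.sub (integrable_const g)).inner_const (g - c)).const_mul 2
  have h3 : ∫ ω, inner ℝ (G ω - g) (g - c) ∂μ = 0 := by
    have h4 := integral_inner (𝕜 := ℝ) (hGi.sub (integrable_const g)) (g - c)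
    simp only [Pi.sub_apply] at h4
    rw [integral_sub hGi (integrable_const g), ← hg] at h4
    simp only [real_inner_comm (g - c)] at h4 ⊢
    rw [h4]
    simp
  have h5 : ∀ ω, ‖G ω - c‖ ^ 2 = ‖G ω - g‖ ^ 2 + 2 * inner ℝ (G ω - g) (g - c) + ‖g - c‖ ^ 2 := by
    intro ω
    rw [← norm_add_sq_real, sub_add_sub_cancel]
  simp only [h5]
  rw [integral_add (h1.fun_add h2) (integrable_const _), integral_add h1 h2, integral_const_mul, h3]
  simp

/-! ### One agent: measurability in the task and variability over tasks. -/

/-- The assumptions on one agent. -/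
structure AgentAssumptions {M : ℕ} {T X : Type*} [MeasurableSpace T] [MeasurableSpace X]
    (π : Measure T) (D : Kernel T X) (Q : T → Param M → X → ℝ) (L ρ B σG σH γG γH : ℝ) :
    Prop where
  regular : RegularLoss π D Q
  nonneg_L : 0 ≤ L
  task : ∀ t, ∃ ℓ, TaskAssumptions (D t) (Q t) ℓ L ρ B σG σH
  variability : BoundedTaskVariability π D Q γG γH

namespace AgentAssumptions

variable {M : ℕ} {T X : Type*} [MeasurableSpace T] [MeasurableSpace X]
    {π : Measure T} [IsProbabilityMeasure π] {D : Kernel T X} [IsMarkovKernel D]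
    {Q : T → Param M → X → ℝ} {L ρ B σG σH γG γH : ℝ}

theorem of_assumptions (hQ : RegularLoss π D Q) (hL : 0 ≤ L) (h1 : LipschitzGradients D Q L)
    (h2 : LipschitzHessians D Q ρ) (h3 : BoundedGradients D Q B)
    (h4 : BoundedNoiseMoments D Q σG σH) (h5 : BoundedTaskVariability π D Q γG γH) :
    AgentAssumptions π D Q L ρ B σG σH γG γH where
  regular := hQ
  nonneg_L := hL
  variability := h5
  task t := by
    obtain ⟨ℓ, hℓ, hℓ2, hℓL⟩ := h1 t
    -- The given constant may be negative when `M = 0`; its absolute value serves equally well.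
    refine ⟨fun x => |ℓ x|, ?_⟩
    exact
    { measurable := fun w => (hQ.measurable w).comp measurable_prodMk_left
      differentiable := hQ.differentiable t
      differentiable_gradient := hQ.differentiable_gradient t
      integrable := hQ.integrable_loss t
      nonneg_L := hL
      nonneg_lip := fun x => abs_nonneg _
      lipschitz := fun x w u => (hℓ x w u).trans
        (mul_le_mul_of_nonneg_right (le_abs_self _) (norm_nonneg _))
      memLp_lip := hℓ2.abs
      lip_sq_le := by simpa only [sq_abs] using hℓL
      lipschitz_hessian := h2 t
      gradient_le := h3 t
      gradient_noise := fun w => (h4 t w).1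
      hessian_noise := fun w => (h4 t w).2 }

variable (h : AgentAssumptions π D Q L ρ B σG σH γG γH) {n m : ℕ} {α : ℝ}

include h

theorem nonempty_task : Nonempty T := nonempty_of_isProbabilityMeasure π

theorem nonneg_B : 0 ≤ B := by
  obtain ⟨t⟩ := h.nonempty_task
  obtain ⟨ℓ, ht⟩ := h.task t
  exact ht.nonneg_B

theorem measurable_taskRisk_apply (w : Param M) : Measurable fun t => taskRisk D Q t w :=
  ((h.regular.measurable w).stronglyMeasurable.integral_kernel_prod_right' (κ := D)).measurable

theorem differentiable_taskRisk (t : T) : Differentiable ℝ (taskRisk D Q t) := by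
  obtain ⟨ℓ, ht⟩ := h.task t
  exact ht.differentiable_risk

theorem differentiable_gradient_taskRisk (t : T) :
    Differentiable ℝ (gradient (taskRisk D Q t)) := by
  obtain ⟨ℓ, ht⟩ := h.task t
  exact ht.differentiable_gradient_risk

theorem norm_gradient_taskRisk_le (t : T) (w : Param M) :
    ‖gradient (taskRisk D Q t) w‖ ≤ B := by
  obtain ⟨ℓ, ht⟩ := h.task t
  exact ht.norm_gradient_risk_le w

theorem norm_hessian_taskRisk_le (t : T) (w : Param M) :
    ‖hessian (taskRisk D Q t) w‖ ≤ L := by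
  obtain ⟨ℓ, ht⟩ := h.task t
  exact ht.norm_hessian_risk_le w

theorem lipschitz_gradient_taskRisk (t : T) (w u : Param M) :
    ‖gradient (taskRisk D Q t) w - gradient (taskRisk D Q t) u‖ ≤ L * ‖w - u‖ := by
  obtain ⟨ℓ, ht⟩ := h.task t
  exact ht.lipschitz_gradient_risk w u

/-- The mean risk is `B`-Lipschitz as an average of `B`-Lipschitz risks; its differentiability is
not used. -/
theorem norm_gradient_meanRisk_le (w : Param M) : ‖gradient (meanRisk π D Q) w‖ ≤ B := by
  refine norm_gradient_le_of_lipschitz h.nonneg_B (fun w u => ?_) w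
  unfold meanRisk
  exact norm_integral_sub_integral_le (h.regular.integrable_risk w) (h.regular.integrable_risk u)
    fun t => abs_sub_le_of_norm_gradient_le (h.differentiable_taskRisk t)
      (h.norm_gradient_taskRisk_le t) w u

theorem measurable_taskRisk : Measurable fun p : Param M × T => taskRisk D Q p.2 p.1 :=
  measurable_uncurry_loss (q := fun w t => taskRisk D Q t w) h.measurable_taskRisk_apply
    h.differentiable_taskRisk

theorem measurable_gradient_taskRisk :
    Measurable fun p : Param M × T => gradient (taskRisk D Q p.2) p.1 :=
  measurable_gradient_param (q := fun w t => taskRisk D Q t w) h.measurable_taskRisk_apply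
    h.differentiable_taskRisk

theorem measurable_hessian_taskRisk :
    Measurable fun p : Param M × T => hessian (taskRisk D Q p.2) p.1 :=
  measurable_hessian_param (q := fun w t => taskRisk D Q t w) h.measurable_taskRisk_apply
    h.differentiable_taskRisk h.differentiable_gradient_taskRisk

theorem measurable_exactMetaGradient_taskRisk (w : Param M) :
    Measurable fun t => exactMetaGradient α (taskRisk D Q t) w := by
  have h1 : Measurable fun t => hessian (taskRisk D Q t) w :=
    (h.measurable_hessian_taskRisk.comp (measurable_prodMk_left (x := w)) :)
  have h2 : Measurable fun t => gradient (taskRisk D Q t) w :=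
    (h.measurable_gradient_taskRisk.comp (measurable_prodMk_left (x := w)) :)
  have h3 := h.measurable_gradient_taskRisk.comp
    (((h2.const_smul α).const_sub w).prodMk measurable_id)
  have hc : Continuous fun p : (Param M →L[ℝ] Param M) × Param M =>
      (ContinuousLinearMap.id ℝ (Param M) - α • p.1) p.2 := by fun_prop
  have := hc.measurable.comp (h1.prodMk h3)
  exact this

/-- Pairs `(t, x)` are regarded as the data points of a single loss. A batch that repeats `t` in
every entry then yields joint measurability in the task and the data. -/
theorem measurable_innerStep_task :
    Measurable fun p : Param M × T × (Fin n → X) => innerStep α (Q p.2.1) p.2.2 p.1 := by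
  have h1 := measurable_innerStep (q := fun w (y : T × X) => Q y.1 w y.2) h.regular.measurable
    (fun y => h.regular.differentiable y.1 y.2) α n
  have h2 : Measurable fun p : Param M × T × (Fin n → X) =>
      (p.1, fun j => (p.2.1, p.2.2 j)) := by fun_prop
  have h3 := h1.comp h2
  exact h3

theorem measurable_sampleGradient_task :
    Measurable fun p : Param M × TaskSample T X n m =>
      sampleGradient α (Q p.2.1) p.2.2.1 p.2.2.2 p.1 := by
  have h1 := measurable_sampleGradient (q := fun w (y : T × X) => Q y.1 w y.2)
    h.regular.measurable (fun y => h.regular.differentiable y.1 y.2)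
    (fun y => h.regular.differentiable_gradient y.1 y.2) α n m
  have h2 : Measurable fun p : Param M × TaskSample T X n m =>
      (p.1, (fun j => (p.2.1, p.2.2.1 j)), fun j => (p.2.1, p.2.2.2 j)) := by fun_prop
  have h3 := h1.comp h2
  exact h3

theorem sampleGradient_noise_task (hn : 0 < n) (hm : 0 < m) (hα : 0 ≤ α) (w : Param M) :
    ExpectationLE (taskSampleLaw n m π D)
      (fun z => ‖sampleGradient α (Q z.1) z.2.1 z.2.2 w
        - exactMetaGradient α (taskRisk D Q z.1) w‖ ^ 2) (2 * C1sq α L B σG σH n m) := by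
  have hmeas : Measurable fun z : TaskSample T X n m =>
      sampleGradient α (Q z.1) z.2.1 z.2.2 w - exactMetaGradient α (taskRisk D Q z.1) w :=
    (h.measurable_sampleGradient_task.comp (measurable_prodMk_left (x := w)) :).sub
      ((h.measurable_exactMetaGradient_taskRisk w).comp measurable_fst :)
  refine ExpectationLE.compProd (k := fun _ => 2 * C1sq α L B σG σH n m)
    (hmeas.norm.pow_const 2) (fun _ => by positivity) (fun t => ?_)
    ⟨integrable_const _, by simp⟩
  obtain ⟨ℓ, ht⟩ := h.task t
  rw [Kernel.prod_apply]
  exact ht.sampleGradient_noise_sq hn hm hα w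

theorem gradient_variability (w : Param M) :
    ExpectationLE π
      (fun t => ‖gradient (taskRisk D Q t) w - gradient (meanRisk π D Q) w‖ ^ 2) (γG ^ 2) := by
  have hm : Measurable fun t => gradient (taskRisk D Q t) w - gradient (meanRisk π D Q) w :=
    (h.measurable_gradient_taskRisk.comp (measurable_prodMk_left (x := w)) :).sub_const _
  have h4 := memLp_four_of_integrable hm.aestronglyMeasurable (h.variability w).1.1
  refine ⟨integrable_norm_sq (memLp_two_of_memLp_four h4),
    integral_norm_sq_le_of_pow_four h4 (by positivity) ?_⟩
  rw [← pow_mul]; exact (h.variability w).1.2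

theorem hessian_variability (w : Param M) :
    ExpectationLE π
      (fun t => ‖hessian (taskRisk D Q t) w - hessian (meanRisk π D Q) w‖ ^ 2) (γH ^ 2) := by
  have hm : Measurable fun t => ‖hessian (taskRisk D Q t) w - hessian (meanRisk π D Q) w‖ :=
    ((h.measurable_hessian_taskRisk.comp (measurable_prodMk_left (x := w)) :).sub_const _).norm
  have h4 : MemLp (fun t => ‖hessian (taskRisk D Q t) w - hessian (meanRisk π D Q) w‖) 4 π :=
    memLp_four_of_integrable hm.aestronglyMeasurable (by simpa using (h.variability w).2.1)
  have h2 := integrable_norm_sq (memLp_two_of_memLp_four h4)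
  have hτ := integral_norm_sq_le_of_pow_four h4 (τ := γH ^ 2) (by positivity)
    (by rw [← pow_mul]; simpa using (h.variability w).2.2)
  simp only [norm_norm] at h2 hτ
  exact ⟨h2, hτ⟩

/-- The matrix and the vector are compared across tasks, with `w'` the inner step along the mean
risk. Only quadratic terms arise, so the fourth powers in `C2sq` are slack. -/
theorem exactMetaGradient_variability (hα : 0 ≤ α) (w : Param M) :
    ExpectationLE π
      (fun t => ‖exactMetaGradient α (taskRisk D Q t) w
        - exactMetaGradient α (meanRisk π D Q) w‖ ^ 2) (C2sq α L B γG γH / 2) := by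
  have hL := h.nonneg_L
  obtain ⟨w', hw'⟩ : ∃ w', w' = w - α • gradient (meanRisk π D Q) w := ⟨_, rfl⟩
  have e1 := (h.gradient_variability w).const_mul (c := 4 * (1 + α * L) ^ 2 * (α ^ 2 * L ^ 2))
    (by positivity)
  have e2 := (h.gradient_variability w').const_mul (c := 4 * (1 + α * L) ^ 2) (by positivity)
  have e3 := (h.hessian_variability w).const_mul (c := 2 * B ^ 2 * α ^ 2) (by positivity)
  refine (((e1.add e2).add e3).mono (((h.measurable_exactMetaGradient_taskRisk w).sub_const
    (exactMetaGradient α (meanRisk π D Q) w)).norm.pow_const 2).aestronglyMeasurable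
    (fun _ => by positivity) fun t => ?_).trans ?_
  · have f1 := norm_id_sub_smul_le hα (h.norm_hessian_taskRisk_le t w)
    have f2 := h.lipschitz_gradient_taskRisk t (w - α • gradient (taskRisk D Q t) w) w'
    have f3 := h.norm_gradient_meanRisk_le w'
    have f4 : w - α • gradient (taskRisk D Q t) w - w'
        = -(α • (gradient (taskRisk D Q t) w - gradient (meanRisk π D Q) w)) := by
      rw [hw', smul_sub]; abel
    rw [f4, norm_neg, norm_smul, Real.norm_of_nonneg hα] at f2
    unfold exactMetaGradient
    rw [← hw']
    generalize ‖gradient (taskRisk D Q t) w - gradient (meanRisk π D Q) w‖ = d₁ at *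
    generalize gradient (taskRisk D Q t) (w - α • gradient (taskRisk D Q t) w) = v at *
    generalize gradient (taskRisk D Q t) w' = v' at *
    generalize gradient (meanRisk π D Q) w' = u at *
    generalize hessian (taskRisk D Q t) w = A at *
    generalize hessian (meanRisk π D Q) w = A' at *
    have f5 : (ContinuousLinearMap.id ℝ (Param M) - α • A) v
        - (ContinuousLinearMap.id ℝ (Param M) - α • A') u
        = (ContinuousLinearMap.id ℝ (Param M) - α • A) (v - u) - α • (A - A') u := by
      simp [smul_sub]; abel
    have f6 : ‖v - u‖ ≤ L * (α * d₁) + ‖v' - u‖ := by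
      calc ‖v - u‖ = ‖(v - v') + (v' - u)‖ := by congr 1; abel
        _ ≤ _ := (norm_add_le _ _).trans (by linarith)
    have f7 : ‖(ContinuousLinearMap.id ℝ (Param M) - α • A) (v - u)‖
        ≤ (1 + α * L) * (L * (α * d₁) + ‖v' - u‖) :=
      (ContinuousLinearMap.le_opNorm _ _).trans
        (mul_le_mul f1 f6 (norm_nonneg _) ((norm_nonneg _).trans f1))
    have f8 : ‖α • (A - A') u‖ ≤ α * (‖A - A'‖ * B) := by
      rw [norm_smul, Real.norm_of_nonneg hα]
      exact mul_le_mul_of_nonneg_left (((A - A').le_opNorm u).trans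
        (mul_le_mul_of_nonneg_left f3 (norm_nonneg _))) hα
    rw [f5]
    have f9 := (norm_sub_le ((ContinuousLinearMap.id ℝ (Param M) - α • A) (v - u))
      (α • (A - A') u)).trans (add_le_add f7 f8)
    refine (pow_le_pow_left₀ (norm_nonneg _) f9 2).trans ?_
    nlinarith [sq_nonneg ((1 + α * L) * (L * (α * d₁) + ‖v' - u‖) - α * (‖A - A'‖ * B)),
      sq_nonneg ((1 + α * L) * (L * (α * d₁) - ‖v' - u‖))]
  · unfold C2sq
    have : 0 ≤ 2 * α ^ 4 * γH ^ 4 + 16 * (1 + α ^ 4 * L ^ 4) * γG ^ 4 := by positivity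
    nlinarith

/-- The weights `3/2` and `3` have reciprocals summing to `1`; they turn `2 * C1sq` into `3 * C1sq`
and `C2sq / 2` into at most `3 * C2sq`. -/
theorem sampleGradient_deviation (hn : 0 < n) (hm : 0 < m) (hα : 0 ≤ α) (w : Param M) :
    ExpectationLE (taskSampleLaw n m π D)
      (fun z => ‖sampleGradient α (Q z.1) z.2.1 z.2.2 w
        - exactMetaGradient α (meanRisk π D Q) w‖ ^ 2)
      (3 * (C1sq α L B σG σH n m + C2sq α L B γG γH)) := by
  have e1 := (h.sampleGradient_noise_task hn hm hα w).const_mul (c := 3 / 2) (by norm_num)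
  have hmt := h.measurable_exactMetaGradient_taskRisk (α := α) w
  have e2 : ExpectationLE (taskSampleLaw n m π D)
      (fun z => ‖exactMetaGradient α (taskRisk D Q z.1) w
        - exactMetaGradient α (meanRisk π D Q) w‖ ^ 2) (C2sq α L B γG γH / 2) := by
    refine ExpectationLE.compProd (((hmt.comp measurable_fst).sub_const _).norm.pow_const 2)
      (fun _ => by positivity) (fun t => ?_)
      (h.exactMetaGradient_variability hα w)
    exact ⟨integrable_const (‖exactMetaGradient α (taskRisk D Q t) w
        - exactMetaGradient α (meanRisk π D Q) w‖ ^ 2), by simp⟩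
  have e3 := e2.const_mul (c := 3) (by norm_num)
  have hms : Measurable fun z : TaskSample T X n m => sampleGradient α (Q z.1) z.2.1 z.2.2 w :=
    (h.measurable_sampleGradient_task.comp (measurable_prodMk_left (x := w)) :)
  refine ((e1.add e3).mono ((hms.sub_const _).norm.pow_const 2).aestronglyMeasurable
    (fun _ => by positivity) fun z => ?_).trans ?_
  · generalize sampleGradient α (Q z.1) z.2.1 z.2.2 w = a
    generalize exactMetaGradient α (taskRisk D Q z.1) w = b
    generalize exactMetaGradient α (meanRisk π D Q) w = c
    have h1 : ‖a - c‖ ≤ ‖a - b‖ + ‖b - c‖ := norm_sub_le_norm_sub_add_norm_sub a b c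
    refine (pow_le_pow_left₀ (norm_nonneg _) h1 2).trans ?_
    nlinarith [sq_nonneg (‖a - b‖ - 2 * ‖b - c‖)]
  · have : 0 ≤ C2sq α L B γG γH := by have := h.nonneg_L; unfold C2sq; positivity
    linarith

end AgentAssumptions

instance isProbabilityMeasure_taskSampleLaw {T X : Type*} [MeasurableSpace T] [MeasurableSpace X]
    (n m : ℕ) (π : Measure T) [IsProbabilityMeasure π] (D : Kernel T X) [IsMarkovKernel D] :
    IsProbabilityMeasure (taskSampleLaw n m π D) := by
  unfold taskSampleLaw; infer_instance

/-! ### The adjusted objective of an agent and its unbiased stochastic gradient. -/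

namespace AgentAssumptions

variable {M : ℕ} {T X : Type*} [MeasurableSpace T] [MeasurableSpace X]
    {π : Measure T} [IsProbabilityMeasure π] {D : Kernel T X} [IsMarkovKernel D]
    {Q : T → Param M → X → ℝ} {L ρ B σG σH γG γH : ℝ}
    (h : AgentAssumptions π D Q L ρ B σG σH γG γH) {n m b : ℕ} {α : ℝ}

include h

theorem measurable_adjustedTaskRisk (w : Param M) : Measurable fun t =>
    ∫ x, taskRisk D Q t (innerStep α (Q t) x w) ∂(Measure.pi fun _ : Fin n => D t) := by
  have h1 : Measurable fun p : T × (Fin n → X) => innerStep α (Q p.1) p.2 w :=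
    (h.measurable_innerStep_task.comp (measurable_prodMk_left (x := w)) :)
  have h2 := h.measurable_taskRisk.comp (h1.prodMk (measurable_fst (α := T) (β := Fin n → X)))
  have h3 := (h2.stronglyMeasurable.integral_kernel_prod_right' (κ := iidKernel n D)).measurable
  exact h3

/-- The outer batch does not occur in the adjusted risk, so any `m > 0` is allowed; bounds on the
objective alone use `m = 1`. -/
theorem hasGradientAt_adjustedTaskRisk (hn : 0 < n) (hm : 0 < m) (hα : 0 ≤ α) (t : T)
    (w : Param M) :
    HasGradientAt
      (fun w => ∫ x, taskRisk D Q t (innerStep α (Q t) x w) ∂(Measure.pi fun _ : Fin n => D t))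
      (∫ z, sampleGradient α (Q t) z.1 z.2 w ∂((iidKernel n D ×ₖ iidKernel m D) t)) w := by
  obtain ⟨ℓ, ht⟩ := h.task t
  have h1 := ht.hasGradientAt_adjustedRisk hn hα w
  rw [← ht.integral_sampleGradient hn hm hα w] at h1
  rw [Kernel.prod_apply]
  exact h1

theorem norm_integral_sampleGradient_le (hn : 0 < n) (hm : 0 < m) (hα : 0 ≤ α) (t : T)
    (w : Param M) :
    ‖∫ z, sampleGradient α (Q t) z.1 z.2 w ∂((iidKernel n D ×ₖ iidKernel m D) t)‖
      ≤ B * (1 + α * L) := by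
  obtain ⟨ℓ, ht⟩ := h.task t
  have h1 := ht.norm_integral_pullbackGradient_le hn hα w
  rw [← ht.integral_sampleGradient hn hm hα w] at h1
  rw [Kernel.prod_apply]
  exact h1

theorem norm_integral_sampleGradient_sub_le (hn : 0 < n) (hm : 0 < m) (hα : 0 ≤ α) (t : T)
    (w u : Param M) :
    ‖(∫ z, sampleGradient α (Q t) z.1 z.2 w ∂((iidKernel n D ×ₖ iidKernel m D) t))
      - ∫ z, sampleGradient α (Q t) z.1 z.2 u ∂((iidKernel n D ×ₖ iidKernel m D) t)‖
      ≤ Lhat α L ρ B * ‖w - u‖ := by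
  obtain ⟨ℓ, ht⟩ := h.task t
  have h1 := ht.norm_integral_pullbackGradient_sub_le hn hα w u
  rw [← ht.integral_sampleGradient hn hm hα w, ← ht.integral_sampleGradient hn hm hα u] at h1
  rw [Kernel.prod_apply]
  exact h1

theorem abs_adjustedTaskRisk_sub_le (hn : 0 < n) (hα : 0 ≤ α) (t : T) (w u : Param M) :
    |(∫ x, taskRisk D Q t (innerStep α (Q t) x w) ∂(Measure.pi fun _ : Fin n => D t))
      - ∫ x, taskRisk D Q t (innerStep α (Q t) x u) ∂(Measure.pi fun _ : Fin n => D t)|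
      ≤ B * (1 + α * L) * ‖w - u‖ :=
  abs_sub_le_of_norm_gradient_le (f := fun w =>
      ∫ x, taskRisk D Q t (innerStep α (Q t) x w) ∂(Measure.pi fun _ : Fin n => D t))
    (fun w => (h.hasGradientAt_adjustedTaskRisk hn one_pos hα t w).differentiableAt)
    (fun w => by
      rw [(h.hasGradientAt_adjustedTaskRisk hn one_pos hα t w).gradient]
      exact h.norm_integral_sampleGradient_le hn one_pos hα t w) w u

/-- The inner step moves the parameter by at most `α B` in mean and the risk is `B`-Lipschitz, so
adjusted and plain risk differ by at most `B α B`. -/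
theorem integrable_adjustedTaskRisk (hn : 0 < n) (hα : 0 ≤ α) (w : Param M) :
    Integrable (fun t =>
      ∫ x, taskRisk D Q t (innerStep α (Q t) x w) ∂(Measure.pi fun _ : Fin n => D t)) π := by
  refine ((h.regular.integrable_risk w).norm.add (integrable_const (B * (α * B)))).mono'
    (h.measurable_adjustedTaskRisk w).aestronglyMeasurable (ae_of_all _ fun t => ?_)
  obtain ⟨ℓ, ht⟩ := h.task t
  have h1 := (ht.norm_gradient_batchLoss_expectation hn w).const_mul (mul_nonneg ht.nonneg_B hα)
  have h2 : ‖∫ x, (taskRisk D Q t (innerStep α (Q t) x w) - taskRisk D Q t w)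
      ∂(Measure.pi fun _ : Fin n => D t)‖ ≤ B * α * B := by
    refine (norm_integral_le_of_norm_le h1.1 (ae_of_all _ fun x => ?_)).trans h1.2
    have h3 := ht.abs_risk_sub_le (innerStep α (Q t) x w) w
    have h4 : ‖innerStep α (Q t) x w - w‖ = α * ‖gradient (batchLoss (Q t) x) w‖ := by
      unfold innerStep
      rw [sub_sub_cancel_left, norm_neg, norm_smul, Real.norm_of_nonneg hα]
    rw [h4, ← mul_assoc] at h3
    exact h3
  have hri : Integrable (fun x => taskRisk D Q t (innerStep α (Q t) x w))
      (Measure.pi fun _ : Fin n => D t) := ht.integrable_risk_innerStep hn w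
  rw [integral_sub hri (integrable_const _)] at h2
  simp only [integral_const, probReal_univ, one_smul] at h2
  have h5 := norm_sub_norm_le
    (∫ x, taskRisk D Q t (innerStep α (Q t) x w) ∂(Measure.pi fun _ : Fin n => D t))
    (taskRisk D Q t w)
  simp only [Pi.add_apply]
  linarith

theorem memLp_sampleGradient (hn : 0 < n) (hm : 0 < m) (hα : 0 ≤ α) (w : Param M) :
    MemLp (fun z => sampleGradient α (Q z.1) z.2.1 z.2.2 w) 2 (taskSampleLaw n m π D) := by
  have hms : Measurable fun z : TaskSample T X n m => sampleGradient α (Q z.1) z.2.1 z.2.2 w :=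
    (h.measurable_sampleGradient_task.comp (measurable_prodMk_left (x := w)) :)
  have h1 := (memLp_two_iff_integrable_sq_norm (hms.sub_const
    (exactMetaGradient α (meanRisk π D Q) w)).aestronglyMeasurable).2
    (h.sampleGradient_deviation hn hm hα w).1
  have h2 := h1.add (memLp_const (exactMetaGradient α (meanRisk π D Q) w))
  refine h2.ae_eq (ae_of_all _ fun z => ?_)
  simp

theorem integrable_integral_sampleGradient (hn : 0 < n) (hm : 0 < m) (hα : 0 ≤ α) (w : Param M) :
    Integrable (fun t =>
      ∫ z, sampleGradient α (Q t) z.1 z.2 w ∂((iidKernel n D ×ₖ iidKernel m D) t)) π := by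
  have hms : Measurable fun z : TaskSample T X n m => sampleGradient α (Q z.1) z.2.1 z.2.2 w :=
    (h.measurable_sampleGradient_task.comp (measurable_prodMk_left (x := w)) :)
  have hGm : Measurable fun t =>
      ∫ z, sampleGradient α (Q t) z.1 z.2 w ∂((iidKernel n D ×ₖ iidKernel m D) t) :=
    (hms.stronglyMeasurable.integral_kernel_prod_right'
      (κ := iidKernel n D ×ₖ iidKernel m D)).measurable
  exact (integrable_const (B * (1 + α * L))).mono' hGm.aestronglyMeasurable
    (ae_of_all _ fun t => h.norm_integral_sampleGradient_le hn hm hα t w)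

/-- This is unbiasedness. The Lipschitz constant `B (1 + α L)`, uniform over tasks, lets
differentiation pass through the task integral, and the nested means combine into one integral over
the sample law. -/
theorem hasGradientAt_adjustedObjective (hn : 0 < n) (hm : 0 < m) (hα : 0 ≤ α) (w : Param M) :
    HasGradientAt (adjustedObjective α n π D Q)
      (∫ z, sampleGradient α (Q z.1) z.2.1 z.2.2 w ∂(taskSampleLaw n m π D)) w := by
  have hint := h.integrable_integral_sampleGradient hn hm hα w
  have h1 := hasFDerivAt_integral_of_dominated_loc_of_lip' (μ := π)
    (F := fun w t => ∫ x, taskRisk D Q t (innerStep α (Q t) x w)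
      ∂(Measure.pi fun _ : Fin n => D t)) (x₀ := w)
    (F' := fun t => InnerProductSpace.toDual ℝ (Param M)
      (∫ z, sampleGradient α (Q t) z.1 z.2 w ∂((iidKernel n D ×ₖ iidKernel m D) t)))
    Filter.univ_mem (fun u _ => (h.integrable_adjustedTaskRisk hn hα u).1)
    (h.integrable_adjustedTaskRisk hn hα w)
    ((LinearIsometryEquiv.continuous _).comp_aestronglyMeasurable hint.1)
    (ae_of_all _ fun t u _ => h.abs_adjustedTaskRisk_sub_le hn hα t u w)
    (integrable_const (B * (1 + α * L)))
    (ae_of_all _ fun t => (h.hasGradientAt_adjustedTaskRisk hn hm hα t w).hasFDerivAt)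
  have hi : Integrable (fun z => sampleGradient α (Q z.1) z.2.1 z.2.2 w)
      (taskSampleLaw n m π D) := (h.memLp_sampleGradient hn hm hα w).integrable (by norm_num)
  unfold taskSampleLaw at hi ⊢
  rw [hasGradientAt_iff_hasFDerivAt, Measure.integral_compProd hi]
  refine h1.2.congr_fderiv ?_
  exact (InnerProductSpace.toDual ℝ (Param M)).toContinuousLinearEquiv.toContinuousLinearMap
    |>.integral_comp_comm hint

theorem gradient_adjustedObjective (hn : 0 < n) (hm : 0 < m) (hα : 0 ≤ α) (w : Param M) :
    gradient (adjustedObjective α n π D Q) w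
      = ∫ z, sampleGradient α (Q z.1) z.2.1 z.2.2 w ∂(taskSampleLaw n m π D) :=
  (h.hasGradientAt_adjustedObjective hn hm hα w).gradient

theorem differentiable_adjustedObjective (hn : 0 < n) (hα : 0 ≤ α) :
    Differentiable ℝ (adjustedObjective α n π D Q) :=
  fun w => (h.hasGradientAt_adjustedObjective hn one_pos hα w).differentiableAt

theorem abs_adjustedObjective_sub_le (hn : 0 < n) (hα : 0 ≤ α) (w u : Param M) :
    |adjustedObjective α n π D Q w - adjustedObjective α n π D Q u|
      ≤ B * (1 + α * L) * ‖w - u‖ := by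
  unfold adjustedObjective
  exact norm_integral_sub_integral_le (h.integrable_adjustedTaskRisk hn hα w)
    (h.integrable_adjustedTaskRisk hn hα u) fun t => h.abs_adjustedTaskRisk_sub_le hn hα t w u

theorem norm_gradient_adjustedObjective_le (hn : 0 < n) (hα : 0 ≤ α) (w : Param M) :
    ‖gradient (adjustedObjective α n π D Q) w‖ ≤ B * (1 + α * L) :=
  norm_gradient_le_of_lipschitz
    (mul_nonneg h.nonneg_B (by have := mul_nonneg hα h.nonneg_L; linarith))
    (h.abs_adjustedObjective_sub_le hn hα) w

theorem lipschitz_gradient_adjustedObjective (hn : 0 < n) (hα : 0 ≤ α) (w u : Param M) :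
    ‖gradient (adjustedObjective α n π D Q) w - gradient (adjustedObjective α n π D Q) u‖
      ≤ Lhat α L ρ B * ‖w - u‖ := by
  have hi : ∀ w, Integrable (fun z => sampleGradient α (Q z.1) z.2.1 z.2.2 w)
      (taskSampleLaw n 1 π D) :=
    fun w => (h.memLp_sampleGradient hn one_pos hα w).integrable (by norm_num)
  rw [h.gradient_adjustedObjective hn one_pos hα w, h.gradient_adjustedObjective hn one_pos hα u]
  have hG := h.integrable_integral_sampleGradient hn one_pos hα
  unfold taskSampleLaw at hi ⊢
  rw [Measure.integral_compProd (hi w), Measure.integral_compProd (hi u)]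
  exact norm_integral_sub_integral_le (hG w) (hG u) fun t =>
    h.norm_integral_sampleGradient_sub_le hn one_pos hα t w u

/-- The variance of the stochastic meta-gradient of one sampled task. -/
theorem sampleGradient_variance (hn : 0 < n) (hm : 0 < m) (hα : 0 ≤ α) (w : Param M) :
    ∫ z, ‖sampleGradient α (Q z.1) z.2.1 z.2.2 w - gradient (adjustedObjective α n π D Q) w‖ ^ 2
        ∂(taskSampleLaw n m π D)
      ≤ 3 * (C1sq α L B σG σH n m + C2sq α L B γG γH) := by
  have hd := h.sampleGradient_deviation hn hm hα w
  have hL := h.memLp_sampleGradient hn hm hα w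
  rw [h.gradient_adjustedObjective hn hm hα w]
  exact (integral_norm_sub_integral_sq_le hL _).trans hd.2

theorem measurable_metaGradient : Measurable
    fun p : Param M × (Fin b → TaskSample T X n m) => metaGradient α Q p.2 p.1 := by
  have hs : ∀ s : Fin b, Measurable fun p : Param M × (Fin b → TaskSample T X n m) =>
      sampleGradient α (Q (p.2 s).1) (p.2 s).2.1 (p.2 s).2.2 p.1 := fun s => by
    have h1 : Measurable fun p : Param M × (Fin b → TaskSample T X n m) => (p.1, p.2 s) := by
      fun_prop
    have h2 := h.measurable_sampleGradient_task (α := α).comp h1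
    exact h2
  have h3 := (Finset.measurable_sum Finset.univ fun s _ => hs s).const_smul (1 / (b : ℝ))
  exact h3

theorem metaGradient_variance (hn : 0 < n) (hm : 0 < m) (hb : 0 < b) (hα : 0 ≤ α) (w : Param M) :
    ExpectationLE (Measure.pi fun _ : Fin b => taskSampleLaw n m π D)
      (fun z => ‖metaGradient α Q z w - gradient (adjustedObjective α n π D Q) w‖ ^ 2)
      (3 * (C1sq α L B σG σH n m + C2sq α L B γG γH) / b) := by
  obtain ⟨g, hg⟩ : ∃ g, g = gradient (adjustedObjective α n π D Q) w := ⟨_, rfl⟩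
  obtain ⟨N, hN⟩ : ∃ N : TaskSample T X n m → Param M,
    N = fun z => sampleGradient α (Q z.1) z.2.1 z.2.2 w - g := ⟨_, rfl⟩
  have hms : Measurable fun z : TaskSample T X n m => sampleGradient α (Q z.1) z.2.1 z.2.2 w :=
    (h.measurable_sampleGradient_task.comp (measurable_prodMk_left (x := w)) :)
  have hL := h.memLp_sampleGradient hn hm hα w
  have hNm : Measurable N := by rw [hN]; exact hms.sub_const _
  have hN2 : MemLp N 2 (taskSampleLaw n m π D) := by rw [hN]; exact hL.sub (memLp_const _)
  have hN0 : ∫ z, N z ∂(taskSampleLaw n m π D) = 0 := by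
    rw [hN, integral_sub (hL.integrable (by norm_num)) (integrable_const _),
      ← h.gradient_adjustedObjective hn hm hα w, hg]
    simp
  have hτ : ∫ z, ‖N z‖ ^ 2 ∂(taskSampleLaw n m π D)
      ≤ 3 * (C1sq α L B σG σH n m + C2sq α L B γG γH) := by
    rw [hN, hg]; exact h.sampleGradient_variance hn hm hα w
  have he : ∀ z : Fin b → TaskSample T X n m,
      metaGradient α Q z w - g = (1 / (b : ℝ)) • ∑ s, N (z s) := by
    intro z
    have hb' : (b : ℝ) ≠ 0 := by positivity
    rw [hN]
    simp only
    rw [Finset.sum_sub_distrib, smul_sub, Finset.sum_const, Finset.card_univ, Fintype.card_fin,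
      ← Nat.cast_smul_eq_nsmul ℝ, smul_smul, one_div_mul_cancel hb', one_smul]
    rfl
  rw [← hg]
  simp only [he]
  have h1 := integrable_norm_sq (memLp_mean (n := b) hN2)
  have h2 := integral_norm_mean_sq_le hb hNm hN2 hN0 hτ
  exact ⟨h1, h2⟩

theorem integrable_metaGradient (hn : 0 < n) (hm : 0 < m) (hα : 0 ≤ α) (w : Param M) :
    Integrable (fun z => metaGradient α Q z w)
      (Measure.pi fun _ : Fin b => taskSampleLaw n m π D) := by
  have h1 := TaskAssumptions.integrable_mean_pi (n := b)
    ((h.memLp_sampleGradient hn hm hα w).integrable (by norm_num))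
  exact h1

theorem integral_metaGradient (hn : 0 < n) (hm : 0 < m) (hb : 0 < b) (hα : 0 ≤ α) (w : Param M) :
    ∫ z, metaGradient α Q z w ∂(Measure.pi fun _ : Fin b => taskSampleLaw n m π D)
      = gradient (adjustedObjective α n π D Q) w := by
  have h1 := TaskAssumptions.integral_mean_pi hb
    ((h.memLp_sampleGradient hn hm hα w).integrable (by norm_num))
  rw [h.gradient_adjustedObjective hn hm hα w]
  exact h1

end AgentAssumptions

/-! ### Averaging with a primitive doubly stochastic matrix. -/

section Mixing

variable {K M : ℕ}

/-- One round of averaging with the weights `A`. -/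
noncomputable def mix (A : Matrix (Fin K) (Fin K) ℝ) (u : Fin K → Param M) : Fin K → Param M :=
  fun k => ∑ l, A l k • u l

/-- The total distance of the agents to their centroid. -/
noncomputable def disagreement (u : Fin K → Param M) : ℝ := ∑ k, ‖u k - centroid u‖

theorem disagreement_nonneg (u : Fin K → Param M) : 0 ≤ disagreement u :=
  Finset.sum_nonneg fun _ _ => norm_nonneg _

theorem centroid_sub (u v : Fin K → Param M) :
    centroid (fun k => u k - v k) = centroid u - centroid v := by
  simp only [centroid, Finset.sum_sub_distrib, smul_sub]

theorem centroid_smul (c : ℝ) (u : Fin K → Param M) :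
    centroid (fun k => c • u k) = c • centroid u := by
  simp only [centroid, ← Finset.smul_sum, smul_comm c]

theorem disagreement_sub_le (u v : Fin K → Param M) :
    disagreement (fun k => u k - v k) ≤ disagreement u + disagreement v := by
  unfold disagreement
  rw [← Finset.sum_add_distrib, centroid_sub]
  refine Finset.sum_le_sum fun k _ => ?_
  rw [sub_sub_sub_comm]
  exact norm_sub_le _ _

theorem disagreement_smul (c : ℝ) (u : Fin K → Param M) :
    disagreement (fun k => c • u k) = |c| * disagreement u := by
  unfold disagreement
  rw [centroid_smul, Finset.mul_sum]
  refine Finset.sum_congr rfl fun k _ => ?_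
  rw [← smul_sub, norm_smul, Real.norm_eq_abs]

theorem mix_sub (A : Matrix (Fin K) (Fin K) ℝ) (u v : Fin K → Param M) :
    mix A (fun k => u k - v k) = fun k => mix A u k - mix A v k := by
  ext1 k
  simp only [mix, smul_sub, Finset.sum_sub_distrib]

theorem mix_smul (A : Matrix (Fin K) (Fin K) ℝ) (c : ℝ) (u : Fin K → Param M) :
    mix A (fun k => c • u k) = fun k => c • mix A u k := by
  ext1 k
  simp only [mix, Finset.smul_sum, smul_comm c]

theorem mix_one (u : Fin K → Param M) : mix 1 u = u := by
  ext1 k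
  simp [mix, Matrix.one_apply, ite_smul]

theorem mix_mix (A A' : Matrix (Fin K) (Fin K) ℝ) (u : Fin K → Param M) :
    mix A (mix A' u) = mix (A' * A) u := by
  ext1 k
  simp only [mix, Matrix.mul_apply, Finset.smul_sum, Finset.sum_smul, smul_smul]
  rw [Finset.sum_comm]
  simp only [mul_comm]

theorem sum_sub_centroid (hK : 0 < K) (u : Fin K → Param M) :
    ∑ k, (u k - centroid u) = 0 := by
  have : (K : ℝ) ≠ 0 := by positivity
  rw [Finset.sum_sub_distrib, Finset.sum_const, Finset.card_univ, Fintype.card_fin,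
    ← Nat.cast_smul_eq_nsmul ℝ, centroid, smul_smul, mul_one_div_cancel this, one_smul, sub_self]

theorem centroid_mix {A : Matrix (Fin K) (Fin K) ℝ} (hA : A ∈ doublyStochastic ℝ (Fin K))
    (u : Fin K → Param M) : centroid (mix A u) = centroid u := by
  simp only [centroid, mix]
  rw [Finset.sum_comm]
  simp only [← Finset.sum_smul, sum_row_of_mem_doublyStochastic hA, one_smul]

/-- Deviations from the centroid sum to zero, so `δ` can be subtracted from all weights at no cost;
the remaining nonnegative weights sum to `1 - K δ` in each row. -/
theorem disagreement_mix_le (hK : 0 < K) {A : Matrix (Fin K) (Fin K) ℝ}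
    (hA : A ∈ doublyStochastic ℝ (Fin K)) {δ : ℝ} (hδ : ∀ l k, δ ≤ A l k) (u : Fin K → Param M) :
    disagreement (mix A u) ≤ (1 - K * δ) * disagreement u := by
  have h1 : ∀ k, mix A u k - centroid u = ∑ l, (A l k - δ) • (u l - centroid u) := by
    intro k
    simp only [sub_smul]
    rw [Finset.sum_sub_distrib, ← Finset.smul_sum, sum_sub_centroid hK, smul_zero, sub_zero]
    simp only [smul_sub]
    rw [Finset.sum_sub_distrib, ← Finset.sum_smul, sum_col_of_mem_doublyStochastic hA, one_smul]
    rfl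
  unfold disagreement
  rw [centroid_mix hA]
  calc ∑ k, ‖mix A u k - centroid u‖
      ≤ ∑ k, ∑ l, (A l k - δ) * ‖u l - centroid u‖ := by
        refine Finset.sum_le_sum fun k _ => ?_
        rw [h1]
        refine (norm_sum_le _ _).trans (Finset.sum_le_sum fun l _ => ?_)
        rw [norm_smul, Real.norm_of_nonneg (sub_nonneg.2 (hδ l k))]
    _ = ∑ l, (1 - K * δ) * ‖u l - centroid u‖ := by
        rw [Finset.sum_comm]
        refine Finset.sum_congr rfl fun l _ => ?_
        rw [← Finset.sum_mul, Finset.sum_sub_distrib, sum_row_of_mem_doublyStochastic hA]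
        simp
    _ = _ := by rw [Finset.mul_sum]

theorem disagreement_mix_le_self (hK : 0 < K) {A : Matrix (Fin K) (Fin K) ℝ}
    (hA : A ∈ doublyStochastic ℝ (Fin K)) (u : Fin K → Param M) :
    disagreement (mix A u) ≤ disagreement u := by
  simpa using disagreement_mix_le hK hA (δ := 0)
    (fun l k => nonneg_of_mem_doublyStochastic hA) u

namespace CombinationMatrix

variable {A : Matrix (Fin K) (Fin K) ℝ} (h : CombinationMatrix A)

include h

theorem pow_mem (s : ℕ) : A ^ s ∈ _root_.doublyStochastic ℝ (Fin K) :=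
  Submonoid.pow_mem _ h.doublyStochastic s

theorem mul_le_pow_add (s t : ℕ) (i j k : Fin K) :
    (A ^ s) i j * (A ^ t) j k ≤ (A ^ (s + t)) i k := by
  rw [pow_add, Matrix.mul_apply]
  exact Finset.single_le_sum (f := fun j => (A ^ s) i j * (A ^ t) j k)
    (fun l _ => mul_nonneg (nonneg_of_mem_doublyStochastic (h.pow_mem s))
      (nonneg_of_mem_doublyStochastic (h.pow_mem t))) (Finset.mem_univ j)

theorem pow_add_pos {s t : ℕ} {i j k : Fin K} (h1 : 0 < (A ^ s) i j) (h2 : 0 < (A ^ t) j k) :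
    0 < (A ^ (s + t)) i k :=
  (mul_pos h1 h2).trans_le (h.mul_le_pow_add s t i j k)

theorem exists_pow_pos (i j : Fin K) : ∃ s, 0 < (A ^ s) i j := by
  have h1 := h.path i j
  induction h1 with
  | refl => exact ⟨0, by simp⟩
  | tail _ hab ih =>
    obtain ⟨s, hs⟩ := ih
    exact ⟨s + 1, h.pow_add_pos hs (by simpa using hab)⟩

theorem pow_loop_pos {k : Fin K} (hk : 0 < A k k) (s : ℕ) : 0 < (A ^ s) k k := by
  induction s with
  | zero => simp
  | succ s ih => exact h.pow_add_pos ih (by simpa using hk)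

/-- The combination matrix is primitive. -/
theorem exists_pow_ge : ∃ p δ, 0 < p ∧ 0 < δ ∧ ∀ l k, δ ≤ (A ^ p) l k := by
  obtain ⟨k₀, hk₀⟩ := h.loop
  choose s hs using fun i => h.exists_pow_pos i k₀
  choose t ht using fun i => h.exists_pow_pos k₀ i
  -- A path leads into `k₀`, the loop at `k₀` pads it to a common length, and a path leads out. The
  -- sums `N` and `N'` bound all path lengths; one extra loop step makes the exponent positive.
  set N := ∑ i, s i
  set N' := ∑ i, t i
  have h1 : ∀ i, 0 < (A ^ N) i k₀ := fun i => by
    have hle : s i ≤ N := Finset.single_le_sum (f := s) (fun _ _ => Nat.zero_le _) (Finset.mem_univ i)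
    rw [← Nat.add_sub_cancel' hle]
    exact h.pow_add_pos (hs i) (h.pow_loop_pos hk₀ _)
  have h2 : ∀ i, 0 < (A ^ N') k₀ i := fun i => by
    have hle : t i ≤ N' := Finset.single_le_sum (f := t) (fun _ _ => Nat.zero_le _) (Finset.mem_univ i)
    rw [← Nat.sub_add_cancel hle]
    exact h.pow_add_pos (h.pow_loop_pos hk₀ _) (ht i)
  have h3 : ∀ i j, 0 < (A ^ (N + 1 + N')) i j := fun i j =>
    h.pow_add_pos (h.pow_add_pos (h1 i) (h.pow_loop_pos hk₀ 1)) (h2 j)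
  obtain ⟨x, -, hx⟩ := Finset.exists_min_image (Finset.univ : Finset (Fin K × Fin K))
    (fun x => (A ^ (N + 1 + N')) x.1 x.2) ⟨(k₀, k₀), Finset.mem_univ _⟩
  exact ⟨N + 1 + N', (A ^ (N + 1 + N')) x.1 x.2, by omega, h3 _ _,
    fun l k => hx (l, k) (Finset.mem_univ _)⟩

/-- Averaging contracts the disagreement geometrically. -/
theorem exists_disagreement_le : ∃ c r : ℝ, 0 ≤ c ∧ 0 < r ∧ r < 1 ∧
    ∀ (s : ℕ) (u : Fin K → Param M), disagreement (mix (A ^ s) u) ≤ c * r ^ s * disagreement u := by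
  obtain ⟨k₀, -⟩ := h.loop
  have hK : 0 < K := k₀.pos
  have hKr : (0 : ℝ) < K := by exact_mod_cast hK
  obtain ⟨p, δ, hp, hδ, hA⟩ := h.exists_pow_ge
  have hpr : (1 : ℝ) ≤ p := by exact_mod_cast hp
  have hiter : ∀ (j : ℕ) (u : Fin K → Param M),
      disagreement (mix (A ^ (p * j)) u) ≤ (max (1 - K * δ) (1 / 2)) ^ j * disagreement u := by
    intro j
    induction j with
    | zero => intro u; simp [mix_one]
    | succ j ih =>
      intro u
      rw [Nat.mul_succ, pow_add, ← mix_mix]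
      refine (disagreement_mix_le hK (h.pow_mem p) hA _).trans ?_
      calc _ ≤ max (1 - K * δ) (1 / 2) * disagreement (mix (A ^ (p * j)) u) :=
            mul_le_mul_of_nonneg_right (le_max_left _ _) (disagreement_nonneg _)
        _ ≤ max (1 - K * δ) (1 / 2) * ((max (1 - K * δ) (1 / 2)) ^ j * disagreement u) :=
            mul_le_mul_of_nonneg_left (ih u) (le_max_of_le_right (by norm_num))
        _ = _ := by ring
  have hq0 : 0 < max (1 - K * δ) (1 / 2) := lt_max_of_lt_right (by norm_num)
  have hq1 : max (1 - K * δ) (1 / 2) < 1 := max_lt (by nlinarith) (by norm_num)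
  generalize max (1 - K * δ) (1 / 2) = q at *
  -- Bernoulli's inequality gives `q ≤ r ^ p` for this `r`, which avoids a `p`-th root. The
  -- prefactor `(r ^ p)⁻¹` pays for the incomplete block of `s % p` rounds.
  set r := 1 + -((1 - q) / p) with hr
  have hle : (1 - q) / p ≤ 1 - q := div_le_self (by linarith) hpr
  have hr0 : 0 < r := by rw [hr]; linarith
  have hr1 : r < 1 := by
    have : 0 < (1 - q) / p := div_pos (by linarith) (by linarith)
    rw [hr]; linarith
  have hrp : q ≤ r ^ p := by
    refine le_trans (le_of_eq ?_) (one_add_mul_le_pow (by linarith) p)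
    field_simp
    ring
  refine ⟨(r ^ p)⁻¹, r, by positivity, hr0, hr1, fun s u => ?_⟩
  have hs : s = p * (s / p) + s % p := (Nat.div_add_mod s p).symm
  have h1 : disagreement (mix (A ^ s) u) ≤ q ^ (s / p) * disagreement u := by
    conv_lhs => rw [hs, pow_add, ← mix_mix]
    exact (disagreement_mix_le_self hK (h.pow_mem _) _).trans (hiter _ u)
  refine h1.trans (mul_le_mul_of_nonneg_right ?_ (disagreement_nonneg _))
  rw [inv_mul_eq_div, le_div_iff₀ (by positivity)]
  calc q ^ (s / p) * r ^ p ≤ (r ^ p) ^ (s / p) * r ^ (s % p) := by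
        refine mul_le_mul (pow_le_pow_left₀ hq0.le hrp _)
          (pow_le_pow_of_le_one hr0.le hr1.le (Nat.mod_lt s hp).le) (by positivity) (by positivity)
    _ = r ^ s := by rw [← pow_mul, ← pow_add, ← hs]

end CombinationMatrix

end Mixing

theorem sum_pow_range_le {r : ℝ} (hr : 0 < r) (hr1 : r < 1) (i : ℕ) :
    ∑ j ∈ Finset.range i, r ^ j ≤ (1 - r)⁻¹ := by
  rw [← tsum_geometric_of_lt_one hr.le hr1]
  exact (summable_geometric_of_lt_one hr.le hr1).sum_le_tsum _ fun j _ => by positivity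

theorem sum_pow_range_sub_le {r : ℝ} (hr : 0 < r) (hr1 : r < 1) (i : ℕ) :
    ∑ j ∈ Finset.range i, r ^ (i - j) ≤ (1 - r)⁻¹ := by
  have h4 : ∑ j ∈ Finset.range i, r ^ (i - j) ≤ ∑ j ∈ Finset.range i, r ^ (i - 1 - j) :=
    Finset.sum_le_sum fun j hj => pow_le_pow_of_le_one hr.le hr1.le (by omega)
  rw [Finset.sum_range_reflect (fun j => r ^ j) i] at h4
  exact h4.trans (sum_pow_range_le hr hr1 i)

/-! ### Deterministic bounds for diffusion steps, and the averaged objective. -/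

section Diffusion

variable {K M : ℕ} {A : Matrix (Fin K) (Fin K) ℝ} {μ : ℝ}

/-- One round of averaging need not contract strictly; the geometric bound is available for `A ^ s`
with a prefactor `c`. The induction therefore carries a spare power `A ^ s`, and each past gradient
is damped once by all the rounds since, not by a product of prefactors. -/
theorem disagreement_mix_pow_le_of_step {c r : ℝ} (hμ : 0 ≤ μ)
    (hA : ∀ (s : ℕ) (u : Fin K → Param M),
      disagreement (mix (A ^ s) u) ≤ c * r ^ s * disagreement u)
    {w g : ℕ → Fin K → Param M} (hw : ∀ i, w (i + 1) = mix A fun k => w i k - μ • g i k)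
    (i s : ℕ) :
    disagreement (mix (A ^ s) (w i)) ≤ c * r ^ (s + i) * disagreement (w 0)
      + μ * c * ∑ j ∈ Finset.range i, r ^ (s + i - j) * disagreement (g j) := by
  induction i generalizing s with
  | zero => simpa using hA s (w 0)
  | succ i ih =>
    rw [hw, mix_mix, ← pow_succ', mix_sub, mix_smul]
    refine (disagreement_sub_le _ _).trans ?_
    rw [disagreement_smul, abs_of_nonneg hμ, Finset.sum_range_succ]
    have h1 := ih (s + 1)
    have h2 := mul_le_mul_of_nonneg_left (hA (s + 1) (g i)) hμ
    have h3 : s + 1 + i = s + (i + 1) := by ring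
    have h4 : s + (i + 1) - i = s + 1 := by omega
    rw [h3] at h1
    rw [h4]
    linarith

/-- Cauchy–Schwarz with the weights `r ^ (i - j)`, of total mass at most `(1 - r)⁻¹`, reduces
everything to second moments of the gradients. -/
theorem disagreement_sq_le_of_step {c r : ℝ} (hμ : 0 ≤ μ) (hr : 0 < r) (hr1 : r < 1)
    (hA : ∀ (s : ℕ) (u : Fin K → Param M),
      disagreement (mix (A ^ s) u) ≤ c * r ^ s * disagreement u)
    {w g : ℕ → Fin K → Param M} (hw : ∀ i, w (i + 1) = mix A fun k => w i k - μ • g i k)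
    (i : ℕ) :
    disagreement (w i) ^ 2 ≤ 2 * c ^ 2 * disagreement (w 0) ^ 2 * r ^ i
      + 2 * μ ^ 2 * c ^ 2 * (1 - r)⁻¹ *
        ∑ j ∈ Finset.range i, r ^ (i - j) * disagreement (g j) ^ 2 := by
  have h1 := disagreement_mix_pow_le_of_step hμ hA hw i 0
  rw [pow_zero, mix_one, zero_add] at h1
  have h2 : (∑ j ∈ Finset.range i, r ^ (i - j) * disagreement (g j)) ^ 2
      ≤ (1 - r)⁻¹ * ∑ j ∈ Finset.range i, r ^ (i - j) * disagreement (g j) ^ 2 := by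
    have h3 := Finset.sum_sq_le_sum_mul_sum_of_sq_le_mul (Finset.range i)
      (r := fun j => r ^ (i - j) * disagreement (g j)) (f := fun j => r ^ (i - j))
      (g := fun j => r ^ (i - j) * disagreement (g j) ^ 2)
      (fun j _ => by positivity) (fun j _ => by positivity) (fun j _ => le_of_eq (by ring))
    refine h3.trans (mul_le_mul_of_nonneg_right (sum_pow_range_sub_le hr hr1 i)
      (Finset.sum_nonneg fun j _ => by positivity))
  have h5 : disagreement (w i) ^ 2 ≤ (c * r ^ i * disagreement (w 0)
      + μ * c * ∑ j ∈ Finset.range i, r ^ (i - j) * disagreement (g j)) ^ 2 :=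
    pow_le_pow_left₀ (disagreement_nonneg _) h1 2
  refine h5.trans ((add_sq_le).trans ?_)
  have h6 : (r ^ i) ^ 2 ≤ r ^ i := by
    have : r ^ i ≤ 1 := pow_le_one₀ hr.le hr1.le
    have : 0 ≤ r ^ i := by positivity
    nlinarith
  have h7 : (c * r ^ i * disagreement (w 0)) ^ 2 ≤ c ^ 2 * disagreement (w 0) ^ 2 * r ^ i := by
    calc _ = c ^ 2 * disagreement (w 0) ^ 2 * (r ^ i) ^ 2 := by ring
      _ ≤ _ := by gcongr
  have h8 := mul_le_mul_of_nonneg_left h2 (by positivity : 0 ≤ μ ^ 2 * c ^ 2)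
  calc _ = 2 * (c * r ^ i * disagreement (w 0)) ^ 2 + 2 * (μ ^ 2 * c ^ 2 *
        (∑ j ∈ Finset.range i, r ^ (i - j) * disagreement (g j)) ^ 2) := by ring
    _ ≤ 2 * (c ^ 2 * disagreement (w 0) ^ 2 * r ^ i) + 2 * (μ ^ 2 * c ^ 2 * ((1 - r)⁻¹ *
        ∑ j ∈ Finset.range i, r ^ (i - j) * disagreement (g j) ^ 2)) := by gcongr
    _ = _ := by ring

theorem norm_centroid_sq_le (hK : 0 < K) (u : Fin K → Param M) :
    ‖centroid u‖ ^ 2 ≤ (1 / (K : ℝ)) * ∑ k, ‖u k‖ ^ 2 := by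
  have hKr : (0 : ℝ) < K := by exact_mod_cast hK
  have h1 : ‖centroid u‖ ≤ (1 / (K : ℝ)) * ∑ k, ‖u k‖ := by
    rw [centroid, norm_smul, Real.norm_of_nonneg (by positivity)]
    gcongr
    exact norm_sum_le _ _
  have h2 : (∑ k, ‖u k‖) ^ 2 ≤ K * ∑ k, ‖u k‖ ^ 2 := by
    simpa using sq_sum_le_card_mul_sum_sq (s := Finset.univ) (f := fun k => ‖u k‖)
  calc ‖centroid u‖ ^ 2 ≤ ((1 / (K : ℝ)) * ∑ k, ‖u k‖) ^ 2 := by gcongr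
    _ = (1 / (K : ℝ)) ^ 2 * (∑ k, ‖u k‖) ^ 2 := by ring
    _ ≤ (1 / (K : ℝ)) ^ 2 * (K * ∑ k, ‖u k‖ ^ 2) := by gcongr
    _ = _ := by field_simp

theorem norm_centroid_le (hK : 0 < K) {u : Fin K → Param M} {R : ℝ} (h : ∀ k, ‖u k‖ ≤ R) :
    ‖centroid u‖ ≤ R := by
  have hKr : (0 : ℝ) < K := by exact_mod_cast hK
  rw [centroid, norm_smul, Real.norm_of_nonneg (by positivity)]
  have h1 : ‖∑ k, u k‖ ≤ K * R := by
    refine (norm_sum_le_of_le _ fun k _ => h k).trans ?_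
    simp
  calc _ ≤ 1 / (K : ℝ) * (K * R) := by gcongr
    _ = R := by field_simp

theorem disagreement_le_sum_norm (hK : 0 < K) (u : Fin K → Param M) :
    disagreement u ≤ 2 * ∑ k, ‖u k‖ := by
  have hKr : (0 : ℝ) < K := by exact_mod_cast hK
  have h1 : K * ‖centroid u‖ ≤ ∑ k, ‖u k‖ := by
    rw [centroid, norm_smul, Real.norm_of_nonneg (by positivity), ← mul_assoc,
      mul_one_div_cancel hKr.ne', one_mul]
    exact norm_sum_le _ _
  calc disagreement u ≤ ∑ k, (‖u k‖ + ‖centroid u‖) :=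
        Finset.sum_le_sum fun k _ => norm_sub_le _ _
    _ = ∑ k, ‖u k‖ + K * ‖centroid u‖ := by simp [Finset.sum_add_distrib]
    _ ≤ _ := by linarith

theorem disagreement_sq_le (hK : 0 < K) (u : Fin K → Param M) :
    disagreement u ^ 2 ≤ 4 * K * ∑ k, ‖u k‖ ^ 2 := by
  have h2 : (∑ k, ‖u k‖) ^ 2 ≤ K * ∑ k, ‖u k‖ ^ 2 := by
    simpa using sq_sum_le_card_mul_sum_sq (s := Finset.univ) (f := fun k => ‖u k‖)
  have h3 := pow_le_pow_left₀ (disagreement_nonneg u) (disagreement_le_sum_norm hK u) 2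
  nlinarith

@[fun_prop]
theorem continuous_centroid : Continuous (centroid (K := K) (M := M)) := by
  unfold centroid
  fun_prop

@[fun_prop]
theorem continuous_disagreement : Continuous (disagreement (K := K) (M := M)) := by
  unfold disagreement
  fun_prop

/-- The average `(1/K) ∑ₖ F k` of the local objectives. -/
noncomputable def averageObjective (F : Fin K → Param M → ℝ) (w : Param M) : ℝ :=
  (1 / (K : ℝ)) * ∑ k, F k w

/-- Differentiable local objectives with bounded and Lipschitz gradients. -/
structure SmoothObjectives (F : Fin K → Param M → ℝ) (G Λ : ℝ) : Prop where
  differentiable : ∀ k, Differentiable ℝ (F k)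
  norm_gradient_le : ∀ k w, ‖gradient (F k) w‖ ≤ G
  lipschitz_gradient : ∀ k w u, ‖gradient (F k) w - gradient (F k) u‖ ≤ Λ * ‖w - u‖

namespace SmoothObjectives

variable {F : Fin K → Param M → ℝ} {G Λ : ℝ} (h : SmoothObjectives F G Λ)
include h

theorem differentiable_average : Differentiable ℝ (averageObjective F) := by
  have := h.differentiable
  unfold averageObjective
  fun_prop

theorem gradient_average (w : Param M) :
    gradient (averageObjective F) w = centroid fun k => gradient (F k) w := by
  have h1 : HasGradientAt (averageObjective F) (centroid fun k => gradient (F k) w) w := by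
    rw [hasGradientAt_iff_hasFDerivAt]
    have h2 := (HasFDerivAt.fun_sum (u := Finset.univ) fun k _ =>
      (h.differentiable k w).hasGradientAt.hasFDerivAt).const_mul (1 / (K : ℝ))
    have h3 : (InnerProductSpace.toDual ℝ (Param M)) (centroid fun k => gradient (F k) w)
        = (1 / (K : ℝ)) • ∑ k, (InnerProductSpace.toDual ℝ (Param M)) (gradient (F k) w) := by
      ext v
      simp [centroid]
    rw [h3]
    exact h2
  exact h1.gradient

theorem norm_gradient_average_le (hK : 0 < K) (w : Param M) :
    ‖gradient (averageObjective F) w‖ ≤ G := by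
  rw [h.gradient_average]
  exact norm_centroid_le hK fun k => h.norm_gradient_le k w

/-- The points `u k` are free: the agents' iterates give the error caused by disagreement, a common
point gives the Lipschitz bound of the average. -/
theorem norm_gradient_average_sub_le (hK : 0 < K) (w : Param M) {u : Fin K → Param M} {R : ℝ}
    (hR : ∀ k, Λ * ‖w - u k‖ ≤ R) :
    ‖gradient (averageObjective F) w - centroid fun k => gradient (F k) (u k)‖ ≤ R := by
  rw [h.gradient_average, ← centroid_sub]
  exact norm_centroid_le hK fun k => (h.lipschitz_gradient k w (u k)).trans (hR k)

theorem lipschitz_gradient_average (hK : 0 < K) (w u : Param M) :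
    ‖gradient (averageObjective F) w - gradient (averageObjective F) u‖ ≤ Λ * ‖w - u‖ := by
  rw [h.gradient_average u]
  exact h.norm_gradient_average_sub_le hK w fun k => le_rfl

theorem continuous_gradient (k : Fin K) : Continuous (gradient (F k)) := by
  refine (LipschitzWith.of_dist_le_mul (K := Real.toNNReal Λ) fun w u => ?_).continuous
  rw [dist_eq_norm, dist_eq_norm]
  exact (h.lipschitz_gradient k w u).trans (by gcongr; exact Real.le_coe_toNNReal Λ)

theorem continuous_gradient_average : Continuous (gradient (averageObjective F)) := by
  have := h.continuous_gradient
  simp only [funext h.gradient_average]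
  fun_prop

end SmoothObjectives

end Diffusion

/-! ### Diffusion with stochastic gradients: consensus and expected descent. -/

section NoisyDiffusion

variable {K M : ℕ} {Ω : Type*} [MeasurableSpace Ω]

/-- A diffusion strategy driven by stochastic gradients `g` that are conditionally unbiased and
whose noise has second moment at most `C`. -/
structure NoisyDiffusion (P : Measure Ω) (A : Matrix (Fin K) (Fin K) ℝ) (μ : ℝ)
    (F : Fin K → Param M → ℝ) (C : ℝ) (w₀ : Fin K → Param M)
    (w g : ℕ → Ω → Fin K → Param M) : Prop where
  zero : ∀ ω, w 0 ω = w₀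
  step : ∀ i ω, w (i + 1) ω = mix A fun k => w i ω k - μ • g i ω k
  measurable_iterate : ∀ i, Measurable (w i)
  measurable_gradient : ∀ i, Measurable (g i)
  noise : ∀ i k, ExpectationLE P (fun ω => ‖g i ω k - gradient (F k) (w i ω k)‖ ^ 2) C
  unbiased : ∀ i k (φ : (Fin K → Param M) → Param M), Continuous φ → (∃ R, ∀ u, ‖φ u‖ ≤ R) →
    ∫ ω, inner ℝ (φ (w i ω)) (g i ω k - gradient (F k) (w i ω k)) ∂P = 0

namespace NoisyDiffusion

variable {P : Measure Ω} [IsProbabilityMeasure P] {A : Matrix (Fin K) (Fin K) ℝ} {μ : ℝ}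
  {F : Fin K → Param M → ℝ} {C : ℝ} {w₀ : Fin K → Param M} {w g : ℕ → Ω → Fin K → Param M}
  {G Λ : ℝ} (h : NoisyDiffusion P A μ F C w₀ w g) (hF : SmoothObjectives F G Λ)
include h hF

theorem measurable_noise (i : ℕ) (k : Fin K) :
    Measurable fun ω => g i ω k - gradient (F k) (w i ω k) := by
  have h1 := h.measurable_gradient i
  have h2 := h.measurable_iterate i
  have h3 := (hF.continuous_gradient k).measurable
  exact ((measurable_pi_apply k).comp h1).sub (h3.comp ((measurable_pi_apply k).comp h2))

theorem memLp_noise (i : ℕ) (k : Fin K) :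
    MemLp (fun ω => g i ω k - gradient (F k) (w i ω k)) 2 P :=
  (memLp_two_iff_integrable_sq_norm (h.measurable_noise hF i k).aestronglyMeasurable).2
    (h.noise i k).1

theorem gradient_sq_le (i : ℕ) (k : Fin K) :
    ExpectationLE P (fun ω => ‖g i ω k‖ ^ 2) (2 * C + 2 * G ^ 2) := by
  have h1 : ExpectationLE P (fun _ : Ω => G ^ 2) (G ^ 2) := ⟨integrable_const _, by simp⟩
  refine (((h.noise i k).const_mul zero_le_two).add (h1.const_mul zero_le_two)).mono ?_
    (fun ω => by positivity) fun ω => ?_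
  · have := h.measurable_gradient i
    exact (((measurable_pi_apply k).comp this).norm.pow_const 2).aestronglyMeasurable
  · have h2 := norm_add_le (g i ω k - gradient (F k) (w i ω k)) (gradient (F k) (w i ω k))
    rw [sub_add_cancel] at h2
    have h3 := hF.norm_gradient_le k (w i ω k)
    have h4 := norm_nonneg (g i ω k)
    have h5 := pow_le_pow_left₀ h4 (h2.trans (add_le_add_right h3 _)) 2
    exact h5.trans (add_sq_le.trans (by linarith))

theorem memLp_gradient (i : ℕ) (k : Fin K) : MemLp (fun ω => g i ω k) 2 P :=
  (memLp_two_iff_integrable_sq_norm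
    ((measurable_pi_apply k).comp (h.measurable_gradient i)).aestronglyMeasurable).2
    (h.gradient_sq_le hF i k).1

theorem memLp_iterate (i : ℕ) (k : Fin K) : MemLp (fun ω => w i ω k) 2 P := by
  induction i generalizing k with
  | zero => simp only [h.zero]; exact memLp_const _
  | succ i ih =>
    simp only [h.step, mix]
    exact memLp_finsetSum _ fun l _ =>
      ((ih l).sub ((h.memLp_gradient hF i l).const_smul μ)).const_smul (A l k)

theorem disagreement_gradient_sq_le (hK : 0 < K) (i : ℕ) :
    ExpectationLE P (fun ω => disagreement (g i ω) ^ 2) (4 * K ^ 2 * (2 * C + 2 * G ^ 2)) := by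
  have h1 : ExpectationLE P (fun ω => ∑ k, ‖g i ω k‖ ^ 2) (K * (2 * C + 2 * G ^ 2)) := by
    refine ⟨integrable_finsetSum _ fun k _ => (h.gradient_sq_le hF i k).1, ?_⟩
    rw [integral_finsetSum _ fun k _ => (h.gradient_sq_le hF i k).1]
    refine (Finset.sum_le_sum fun k _ => (h.gradient_sq_le hF i k).2).trans ?_
    simp [mul_add]
  refine ((h1.const_mul (by positivity : (0 : ℝ) ≤ 4 * K)).trans (by ring_nf; rfl)).mono ?_
    (fun ω => by positivity) fun ω => disagreement_sq_le hK _
  exact ((continuous_disagreement.measurable.comp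
    (h.measurable_gradient i)).pow_const 2).aestronglyMeasurable

/-- The agents agree up to an error of order `μ`. -/
theorem disagreement_sq_le (hK : 0 < K) {c r : ℝ} (hμ : 0 ≤ μ) (hr : 0 < r)
    (hr1 : r < 1) (hA : ∀ (s : ℕ) (u : Fin K → Param M),
      disagreement (mix (A ^ s) u) ≤ c * r ^ s * disagreement u) (i : ℕ) :
    ExpectationLE P (fun ω => disagreement (w i ω) ^ 2)
      (2 * c ^ 2 * disagreement w₀ ^ 2 * r ^ i
        + 2 * c ^ 2 * (1 - r)⁻¹ ^ 2 * (4 * K ^ 2 * (2 * C + 2 * G ^ 2)) * μ ^ 2) := by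
  set V := 4 * K ^ 2 * (2 * C + 2 * G ^ 2)
  have hV : 0 ≤ V := by
    have h1 := h.disagreement_gradient_sq_le hF hK 0
    exact (integral_nonneg fun ω => by positivity).trans h1.2
  have h0 : ExpectationLE P (fun _ : Ω => 2 * c ^ 2 * disagreement w₀ ^ 2 * r ^ i)
      (2 * c ^ 2 * disagreement w₀ ^ 2 * r ^ i) := ⟨integrable_const _, by simp⟩
  have hr2 : 0 < 1 - r := by linarith
  have h2 : ExpectationLE P
      (fun ω => ∑ j ∈ Finset.range i, r ^ (i - j) * disagreement (g j ω) ^ 2)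
      ((1 - r)⁻¹ * V) := by
    have h3 := fun j => (h.disagreement_gradient_sq_le hF hK j).const_mul
      (by positivity : 0 ≤ r ^ (i - j))
    refine ⟨integrable_finsetSum _ fun j _ => (h3 j).1, ?_⟩
    rw [integral_finsetSum _ fun j _ => (h3 j).1]
    refine (Finset.sum_le_sum fun j _ => (h3 j).2).trans ?_
    rw [← Finset.sum_mul]
    exact mul_le_mul_of_nonneg_right (sum_pow_range_sub_le hr hr1 i) hV
  refine ((h0.add (h2.const_mul (by positivity : 0 ≤ 2 * μ ^ 2 * c ^ 2 * (1 - r)⁻¹))).trans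
    (le_of_eq (by ring))).mono ?_ (fun ω => by positivity) fun ω => ?_
  · exact ((continuous_disagreement.measurable.comp
      (h.measurable_iterate i)).pow_const 2).aestronglyMeasurable
  · have h5 := disagreement_sq_le_of_step hμ hr hr1 hA (w := fun i => w i ω)
      (g := fun i => g i ω) (fun i => h.step i ω) i
    rwa [h.zero] at h5

theorem memLp_centroid (i : ℕ) : MemLp (fun ω => centroid (w i ω)) 2 P := by
  simp only [centroid]
  exact (memLp_finsetSum _ fun k _ => h.memLp_iterate hF i k).const_smul (1 / (K : ℝ))

theorem integrable_average (hK : 0 < K) (i : ℕ) :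
    Integrable (fun ω => averageObjective F (centroid (w i ω))) P := by
  have h1 := (h.memLp_centroid hF i).integrable one_le_two
  refine ((h1.norm.const_mul G).add (integrable_const |averageObjective F 0|)).mono' ?_
    (.of_forall fun ω => ?_)
  · exact (hF.differentiable_average.continuous.measurable.comp
      (continuous_centroid.measurable.comp (h.measurable_iterate i))).aestronglyMeasurable
  · have h2 := abs_sub_le_of_norm_gradient_le hF.differentiable_average
      (hF.norm_gradient_average_le hK) (centroid (w i ω)) 0
    rw [sub_zero] at h2
    have h3 := abs_sub_abs_le_abs_sub (averageObjective F (centroid (w i ω)))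
      (averageObjective F 0)
    simp only [Real.norm_eq_abs, Pi.add_apply]
    linarith

theorem integrable_gradient_sq (hK : 0 < K) (i : ℕ) :
    Integrable (fun ω => ‖gradient (averageObjective F) (centroid (w i ω))‖ ^ 2) P := by
  refine (integrable_const (G ^ 2)).mono' ?_ (.of_forall fun ω => ?_)
  · exact ((hF.continuous_gradient_average.measurable.comp
      (continuous_centroid.measurable.comp (h.measurable_iterate i))).norm.pow_const
        2).aestronglyMeasurable
  · have h1 := hF.norm_gradient_average_le hK (centroid (w i ω))
    rw [Real.norm_of_nonneg (by positivity)]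
    gcongr

omit h hF [IsProbabilityMeasure P] in
-- Let `a` be the gradient at the centroid, `c` the mean of the local gradients and `s` the mean
-- noise. In the quadratic bound, `-μ⟨a, c⟩ = (μ/2)(‖a - c‖² - ‖a‖² - ‖c‖²)`; the first square is
-- controlled by the disagreement, and `-‖c‖²` absorbs `μ² Λ ‖c‖² / 2` because `μ Λ ≤ 1`. The terms
-- linear in `s` are collected in the last inner product.
theorem averageObjective_step_le (hF : SmoothObjectives F G Λ) (hK : 0 < K) (hΛ : 0 ≤ Λ)
    (hμ : 0 ≤ μ) (hμΛ : μ * Λ ≤ 1) (hA : A ∈ doublyStochastic ℝ (Fin K))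
    (u v : Fin K → Param M) :
    averageObjective F (centroid (mix A fun k => u k - μ • v k))
      ≤ averageObjective F (centroid u)
        - μ / 2 * ‖gradient (averageObjective F) (centroid u)‖ ^ 2
        + μ / 2 * Λ ^ 2 * disagreement u ^ 2
        + μ ^ 2 * Λ / 2 * ‖centroid fun k => v k - gradient (F k) (u k)‖ ^ 2
        + inner ℝ ((μ ^ 2 * Λ) • (centroid fun k => gradient (F k) (u k))
            - μ • gradient (averageObjective F) (centroid u))
          (centroid fun k => v k - gradient (F k) (u k)) := by
  have h1 := le_add_inner_gradient_add_sq hF.differentiable_average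
    (hF.lipschitz_gradient_average hK) (centroid u) (centroid u - μ • centroid v)
  rw [centroid_mix hA, centroid_sub, centroid_smul]
  have h2 : ‖gradient (averageObjective F) (centroid u)
      - centroid fun k => gradient (F k) (u k)‖ ≤ Λ * disagreement u := by
    refine hF.norm_gradient_average_sub_le hK _ fun k => ?_
    rw [norm_sub_rev]
    exact mul_le_mul_of_nonneg_left (Finset.single_le_sum (f := fun k => ‖u k - centroid u‖)
      (fun _ _ => norm_nonneg _) (Finset.mem_univ k)) hΛ
  rw [centroid_sub]
  generalize gradient (averageObjective F) (centroid u) = a at *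
  generalize (centroid fun k => gradient (F k) (u k)) = c at *
  generalize centroid v = d at *
  obtain ⟨s, rfl⟩ : ∃ s, d = c + s := ⟨d - c, by abel⟩
  have h3 := pow_le_pow_left₀ (norm_nonneg _) h2 2
  refine h1.trans ?_
  rw [sub_sub_cancel_left, add_sub_cancel_left]
  rw [@norm_sub_sq_real] at h3
  simp only [inner_neg_right, inner_smul_right, inner_add_right, norm_neg, norm_smul,
    inner_sub_left, inner_smul_left, mul_pow, Real.norm_eq_abs, sq_abs, conj_trivial]
  rw [@norm_add_sq_real]
  have h4 : 0 ≤ μ * (1 - μ * Λ) * ‖c‖ ^ 2 :=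
    mul_nonneg (mul_nonneg hμ (by linarith)) (by positivity)
  have h5 := mul_le_mul_of_nonneg_left h3 (by positivity : 0 ≤ μ / 2)
  linarith

/-- The expected one-step descent. -/
theorem integral_average_step_le (hK : 0 < K) (hΛ : 0 ≤ Λ) (hμ : 0 ≤ μ) (hμΛ : μ * Λ ≤ 1)
    (hA : A ∈ doublyStochastic ℝ (Fin K)) {d : ℝ} (i : ℕ)
    (hd : ExpectationLE P (fun ω => disagreement (w i ω) ^ 2) d) :
    ∫ ω, averageObjective F (centroid (w (i + 1) ω)) ∂P
      ≤ ∫ ω, averageObjective F (centroid (w i ω)) ∂P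
        - μ / 2 * ∫ ω, ‖gradient (averageObjective F) (centroid (w i ω))‖ ^ 2 ∂P
        + μ / 2 * Λ ^ 2 * d + μ ^ 2 * Λ / 2 * C := by
  have hG : 0 ≤ G := (norm_nonneg _).trans (hF.norm_gradient_average_le hK 0)
  have i1 := h.integrable_average hF hK i
  have i2 := h.integrable_gradient_sq hF hK i
  -- Only convexity over the agents is used: their noises within one iteration may be dependent, so
  -- no factor `1 / K` is gained.
  have i4 : ExpectationLE P
      (fun ω => ‖centroid fun k => g i ω k - gradient (F k) (w i ω k)‖ ^ 2) C := by
    have h1 : ExpectationLE P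
        (fun ω => (1 / (K : ℝ)) * ∑ k, ‖g i ω k - gradient (F k) (w i ω k)‖ ^ 2) C := by
      refine ⟨(integrable_finsetSum _ fun k _ => (h.noise i k).1).const_mul _, ?_⟩
      rw [integral_const_mul, integral_finsetSum _ fun k _ => (h.noise i k).1]
      have h2 := Finset.sum_le_sum fun k (_ : k ∈ Finset.univ) => (h.noise i k).2
      have hKr : (0 : ℝ) < K := by exact_mod_cast hK
      calc _ ≤ (1 / (K : ℝ)) * ∑ k : Fin K, C := by gcongr
        _ = C := by simp; field_simp
    refine h1.mono ?_ (fun ω => by positivity) fun ω => norm_centroid_sq_le hK _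
    have h3 : Measurable fun ω => fun k => g i ω k - gradient (F k) (w i ω k) :=
      measurable_pi_lambda _ fun k => h.measurable_noise hF i k
    exact ((continuous_centroid.measurable.comp h3).norm.pow_const 2).aestronglyMeasurable
  -- The linear noise term pairs the noise with a bounded continuous function of the current
  -- iterate, exactly the form in which unbiasedness is available.
  obtain ⟨φ, hφ⟩ : ∃ φ : (Fin K → Param M) → Param M, φ = fun u =>
      (μ ^ 2 * Λ) • (centroid fun k => gradient (F k) (u k))
        - μ • gradient (averageObjective F) (centroid u) := ⟨_, rfl⟩
  have hφc : Continuous φ := by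
    have h1 := hF.continuous_gradient
    have h2 := hF.continuous_gradient_average
    rw [hφ]
    fun_prop
  have hφb : ∀ u, ‖φ u‖ ≤ μ ^ 2 * Λ * G + μ * G := fun u => by
    rw [hφ]
    refine (norm_sub_le _ _).trans ?_
    rw [norm_smul, norm_smul, Real.norm_of_nonneg hμ, Real.norm_of_nonneg (by positivity)]
    have h1 := norm_centroid_le hK fun k => hF.norm_gradient_le k (u k)
    have h2 := hF.norm_gradient_average_le hK (centroid u)
    gcongr
  have i6 : ∀ k, Integrable
      (fun ω => inner ℝ (φ (w i ω)) (g i ω k - gradient (F k) (w i ω k))) P := fun k => by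
    have h1 := ((h.memLp_noise hF i k).integrable one_le_two).norm.const_mul
      (μ ^ 2 * Λ * G + μ * G)
    refine h1.mono' ?_ (.of_forall fun ω => ?_)
    · exact ((hφc.measurable.comp (h.measurable_iterate i)).inner
        (h.measurable_noise hF i k)).aestronglyMeasurable
    · exact (norm_inner_le_norm _ _).trans
        (mul_le_mul_of_nonneg_right (hφb _) (norm_nonneg _))
  have e5 : ∀ ω, inner ℝ (φ (w i ω)) (centroid fun k => g i ω k - gradient (F k) (w i ω k))
      = (1 / (K : ℝ)) * ∑ k, inner ℝ (φ (w i ω)) (g i ω k - gradient (F k) (w i ω k)) :=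
    fun ω => by rw [centroid, inner_smul_right, inner_sum]
  have i5 : Integrable (fun ω => inner ℝ (φ (w i ω))
      (centroid fun k => g i ω k - gradient (F k) (w i ω k))) P := by
    simp only [e5]
    exact (integrable_finsetSum _ fun k _ => i6 k).const_mul _
  have z5 : ∫ ω, inner ℝ (φ (w i ω))
      (centroid fun k => g i ω k - gradient (F k) (w i ω k)) ∂P = 0 := by
    simp only [e5]
    rw [integral_const_mul, integral_finsetSum _ fun k _ => i6 k,
      Finset.sum_eq_zero fun k _ => h.unbiased i k φ hφc ⟨_, hφb⟩, mul_zero]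
  have key := integral_mono (h.integrable_average hF hK (i + 1))
    (((((i1.sub (i2.const_mul (μ / 2))).add (hd.1.const_mul (μ / 2 * Λ ^ 2))).add
      (i4.1.const_mul (μ ^ 2 * Λ / 2)))).add i5) fun ω => by
        simp only [h.step, hφ, Pi.add_apply, Pi.sub_apply]
        exact averageObjective_step_le hF hK hΛ hμ hμΛ hA (w i ω) (g i ω)
  refine key.trans ?_
  rw [integral_add' ((((i1.sub (i2.const_mul (μ / 2))).add
      (hd.1.const_mul (μ / 2 * Λ ^ 2))).add (i4.1.const_mul (μ ^ 2 * Λ / 2)))) i5,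
    integral_add' ((i1.sub (i2.const_mul (μ / 2))).add (hd.1.const_mul (μ / 2 * Λ ^ 2)))
      (i4.1.const_mul (μ ^ 2 * Λ / 2)),
    integral_add' (i1.sub (i2.const_mul (μ / 2))) (hd.1.const_mul (μ / 2 * Λ ^ 2)),
    integral_sub' i1 (i2.const_mul (μ / 2)), z5,
    integral_const_mul, integral_const_mul, integral_const_mul]
  have h8 := mul_le_mul_of_nonneg_left hd.2 (by positivity : 0 ≤ μ / 2 * Λ ^ 2)
  have h9 := mul_le_mul_of_nonneg_left i4.2 (by positivity : 0 ≤ μ ^ 2 * Λ / 2)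
  linarith

end NoisyDiffusion

end NoisyDiffusion

/-! ### From expected descent to a stationary index. -/

section Descent

/-- Were every `e i` larger, `N` telescoped steps would push `f N` below `J`; the transient `a * r ^
i` contributes at most `a * (1 - r)⁻¹` in total. -/
theorem exists_lt_le_of_descent {e f : ℕ → ℝ} {J μ a r s : ℝ} (hμ : 0 < μ) (ha : 0 ≤ a)
    (hr : 0 < r) (hr1 : r < 1)
    (h : ∀ i, f (i + 1) ≤ f i - μ / 2 * e i + μ / 2 * (a * r ^ i + s)) (hJ : ∀ i, J ≤ f i)
    {N : ℕ} (hN : 0 < N) :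
    ∃ i < N, e i ≤ 2 * (f 0 - J) / (N * μ) + a * (1 - r)⁻¹ / N + s := by
  by_contra! hc
  have hNr : (0 : ℝ) < N := by exact_mod_cast hN
  have h1 : ∀ n, f n ≤ f 0 - μ / 2 * ∑ i ∈ Finset.range n, e i
      + μ / 2 * (a * ∑ i ∈ Finset.range n, r ^ i + n * s) := by
    intro n
    induction n with
    | zero => simp
    | succ n ih =>
      rw [Finset.sum_range_succ, Finset.sum_range_succ]
      push_cast
      linarith [h n]
  have h2 : N * (2 * (f 0 - J) / (N * μ) + a * (1 - r)⁻¹ / N + s)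
      < ∑ i ∈ Finset.range N, e i := by
    have := Finset.sum_lt_sum_of_nonempty (Finset.nonempty_range_iff.2 hN.ne')
      fun i hi => hc i (Finset.mem_range.1 hi)
    simpa only [Finset.sum_const, Finset.card_range, nsmul_eq_mul] using this
  have h3 : N * (2 * (f 0 - J) / (N * μ) + a * (1 - r)⁻¹ / N + s)
      = 2 * (f 0 - J) / μ + a * (1 - r)⁻¹ + N * s := by
    field_simp
  have h4 := mul_le_mul_of_nonneg_left (sum_pow_range_le hr hr1 N) ha
  have h5 : μ / 2 * (2 * (f 0 - J) / μ) = f 0 - J := by field_simp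
  rw [h3] at h2
  have h6 := mul_lt_mul_of_pos_left h2 (half_pos hμ)
  have h7 := mul_le_mul_of_nonneg_left h4 (half_pos hμ).le
  linarith [h1 N, hJ N]

theorem exists_index_of_descent {Δ a c₁ γ : ℝ} (hΔ : 0 ≤ Δ) (ha : 0 ≤ a) (hc₁ : 0 ≤ c₁)
    (hγ : 0 ≤ γ) : ∃ c : ℝ, ∀ μ : ℝ, 0 < μ → μ ≤ 1 → ∀ e : ℕ → ℝ,
    (∀ N : ℕ, 0 < N → ∃ i < N, e i ≤ 2 * Δ / (N * μ) + a / N + (c₁ * μ ^ 2 + μ * γ)) →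
    (∃ i : ℕ, e i ≤ c * μ ∧ (i : ℝ) ≤ c / μ ^ 2) ∧
    (∃ i : ℕ, e i ≤ 2 * μ * γ + c * μ ^ 2 ∧
      (0 < γ → (i : ℝ) ≤ 2 * Δ / γ * (1 / μ ^ 2) + c / μ)) := by
  -- One constant serves all cases; `a / γ` reads as `0` when `γ = 0`.
  refine ⟨2 * Δ + a + c₁ + γ + a / γ + 1, fun μ hμ hμ1 e h => ?_⟩
  have haγ : 0 ≤ a / γ := by positivity
  have hμ2 : μ ^ 2 ≤ μ := by nlinarith
  constructor
  -- The horizon `1 / μ²` balances `Δ / (N μ)` with the noise floor of order `μ`.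
  · have hx : 0 < 1 / μ ^ 2 := by positivity
    obtain ⟨i, hi, he⟩ := h ⌈1 / μ ^ 2⌉₊ (Nat.ceil_pos.2 hx)
    have hN := Nat.le_ceil (1 / μ ^ 2)
    generalize (⌈1 / μ ^ 2⌉₊ : ℝ) = N at he hN
    have hN0 : 0 < N := hx.trans_le hN
    have h1 : 1 / N ≤ μ ^ 2 := by
      rw [div_le_iff₀ hN0]
      rw [div_le_iff₀ (by positivity)] at hN
      linarith
    refine ⟨i, ?_, ?_⟩
    · have h2 : 2 * Δ / (N * μ) ≤ 2 * Δ * μ := by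
        calc 2 * Δ / (N * μ) = 2 * Δ / μ * (1 / N) := by field_simp
          _ ≤ 2 * Δ / μ * μ ^ 2 := by gcongr
          _ = _ := by field_simp
      have h3 : a / N ≤ a * μ := by
        calc a / N = a * (1 / N) := by field_simp
          _ ≤ a * μ := by gcongr; linarith
      have h4 := mul_le_mul_of_nonneg_left hμ2 hc₁
      nlinarith
    · have h2 := (Nat.lt_ceil.1 hi).le
      refine h2.trans ?_
      gcongr
      linarith
  · rcases hγ.eq_or_lt with h0 | hγ0
    -- For `γ = 0` no bound on the index is claimed, so a longer horizon can push the initial gap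
    -- down to order `μ²`.
    · have hx : 0 < 1 / μ ^ 3 := by positivity
      obtain ⟨i, hi, he⟩ := h ⌈1 / μ ^ 3⌉₊ (Nat.ceil_pos.2 hx)
      have hN := Nat.le_ceil (1 / μ ^ 3)
      generalize (⌈1 / μ ^ 3⌉₊ : ℝ) = N at he hN
      have hN0 : 0 < N := hx.trans_le hN
      have h1 : 1 / N ≤ μ ^ 3 := by
        rw [div_le_iff₀ hN0]
        rw [div_le_iff₀ (by positivity)] at hN
        linarith
      refine ⟨i, ?_, fun h => absurd h0 h.ne⟩
      have h2 : 2 * Δ / (N * μ) ≤ 2 * Δ * μ ^ 2 := by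
        calc 2 * Δ / (N * μ) = 2 * Δ / μ * (1 / N) := by field_simp
          _ ≤ 2 * Δ / μ * μ ^ 3 := by gcongr
          _ = _ := by field_simp
      have h3 : a / N ≤ a * μ ^ 2 := by
        have h4 : μ ^ 3 ≤ μ ^ 2 := pow_le_pow_of_le_one hμ.le hμ1 (by norm_num)
        calc a / N = a * (1 / N) := by field_simp
          _ ≤ a * μ ^ 2 := by gcongr; exact h1.trans h4
      nlinarith [sq_nonneg μ]
    -- `x` solves `(2 Δ + a μ) / (x μ) = μ γ`: half of `2 μ γ` pays for the initial gap and the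
    -- transient, the other half is the noise floor. The horizon `⌈x⌉₊ + 1` is positive even if `x =
    -- 0`.
    · set x := (2 * Δ + a * μ) / (γ * μ ^ 2) with hxdef
      have hx : 0 ≤ x := by positivity
      obtain ⟨i, hi, he⟩ := h (⌈x⌉₊ + 1) (Nat.succ_pos _)
      refine ⟨i, ?_, fun _ => ?_⟩
      · have hN : x ≤ ((⌈x⌉₊ + 1 : ℕ) : ℝ) := by
          push_cast
          linarith [Nat.le_ceil x]
        have hN0 : (0 : ℝ) < ((⌈x⌉₊ + 1 : ℕ) : ℝ) := by positivity
        generalize ((⌈x⌉₊ + 1 : ℕ) : ℝ) = N at he hN hN0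
        have h1 : 2 * Δ / (N * μ) + a / N ≤ μ * γ := by
          have h2 : 2 * Δ / (N * μ) + a / N = (2 * Δ + a * μ) / (N * μ) := by field_simp
          rw [h2, div_le_iff₀ (by positivity)]
          rw [hxdef, div_le_iff₀ (by positivity)] at hN
          linarith
        have h3 : 0 ≤ (2 * Δ + a + γ + a / γ + 1) * μ ^ 2 := by positivity
        linarith
      · have h1 : (i : ℝ) ≤ ⌈x⌉₊ := by exact_mod_cast Nat.lt_succ_iff.1 hi
        have h2 := (Nat.ceil_lt_add_one hx).le
        have h3 : x = 2 * Δ / γ * (1 / μ ^ 2) + a / γ / μ := by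
          rw [hxdef]
          field_simp
        have h4 : a / γ / μ + 1 ≤ (2 * Δ + a + c₁ + γ + a / γ + 1) / μ := by
          rw [div_add_one hμ.ne']
          gcongr
          linarith
        linarith

end Descent

namespace NoisyDiffusion

variable {K M : ℕ} {A : Matrix (Fin K) (Fin K) ℝ} {F : Fin K → Param M → ℝ} {G Λ C : ℝ}

/-- A noisy diffusion strategy with a small step size reaches an approximately stationary point
of the average objective. -/
theorem exists_stationary (hA : CombinationMatrix A) (hF : SmoothObjectives F G Λ)
    (hΛ : 0 ≤ Λ) (hC : 0 ≤ C) {J : ℝ} (hJ : ∀ w, J ≤ averageObjective F w)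
    (w₀ : Fin K → Param M) :
    ∃ c μ₀ : ℝ, 0 < μ₀ ∧ ∀ μ : ℝ, 0 < μ → μ ≤ μ₀ →
      ∀ {Ω : Type*} [MeasurableSpace Ω] (P : Measure Ω) [IsProbabilityMeasure P]
        (w g : ℕ → Ω → Fin K → Param M), NoisyDiffusion P A μ F C w₀ w g →
        (∃ i : ℕ, ExpectationLE P
            (fun ω => ‖gradient (averageObjective F) (centroid (w i ω))‖ ^ 2) (c * μ) ∧
          (i : ℝ) ≤ c / μ ^ 2) ∧
        (∃ i : ℕ, ExpectationLE P
            (fun ω => ‖gradient (averageObjective F) (centroid (w i ω))‖ ^ 2)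
            (2 * μ * (Λ * C) + c * μ ^ 2) ∧
          (0 < Λ * C → (i : ℝ) ≤ 2 * (averageObjective F (centroid w₀) - J) / (Λ * C)
            * (1 / μ ^ 2) + c / μ)) := by
  obtain ⟨k₀, -⟩ := hA.loop
  have hK : 0 < K := k₀.pos
  obtain ⟨c₀, r, -, hr, hr1, hmix⟩ := hA.exists_disagreement_le
  have hr2 : 0 < 1 - r := by linarith
  -- `d₀` weights the geometrically decaying effect of the initial disagreement, `d₁` the persistent
  -- disagreement of order `μ²`.
  obtain ⟨d₀, hd₀⟩ : ∃ d, d = Λ ^ 2 * (2 * c₀ ^ 2 * disagreement w₀ ^ 2) := ⟨_, rfl⟩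
  obtain ⟨d₁, hd₁⟩ : ∃ d, d = Λ ^ 2 * (2 * c₀ ^ 2 * (1 - r)⁻¹ ^ 2
    * (4 * K ^ 2 * (2 * C + 2 * G ^ 2))) := ⟨_, rfl⟩
  have hd₀0 : 0 ≤ d₀ := by rw [hd₀]; positivity
  obtain ⟨c, hc⟩ := exists_index_of_descent (Δ := averageObjective F (centroid w₀) - J)
    (a := d₀ * (1 - r)⁻¹) (c₁ := d₁) (γ := Λ * C) (by linarith [hJ (centroid w₀)])
    (by positivity) (by rw [hd₁]; positivity) (by positivity)
  -- This bound on the step size yields both `μ ≤ 1` and `μ Λ ≤ 1`.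
  refine ⟨c, 1 / (1 + Λ), by positivity, fun μ hμ hμ₀ Ω _ P _ w g h => ?_⟩
  have hμΛ : μ * (1 + Λ) ≤ 1 := by rwa [le_div_iff₀ (by positivity)] at hμ₀
  have hμ1 : μ ≤ 1 := by nlinarith
  have hΛ' : μ * Λ ≤ 1 := by nlinarith
  have hdesc := fun i => h.integral_average_step_le hF hK hΛ hμ.le hΛ' hA.doublyStochastic i
    (h.disagreement_sq_le hF hK hμ.le hr hr1 hmix i)
  have hlow : ∀ i, J ≤ ∫ ω, averageObjective F (centroid (w i ω)) ∂P := fun i => by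
    have := integral_mono (integrable_const J) (h.integrable_average hF hK i) fun ω =>
      hJ (centroid (w i ω))
    simpa using this
  have h0 : ∫ ω, averageObjective F (centroid (w 0 ω)) ∂P
      = averageObjective F (centroid w₀) := by
    simp [h.zero]
  obtain ⟨⟨i, hi, hi'⟩, j, hj, hj'⟩ := hc μ hμ hμ1
    (fun i => ∫ ω, ‖gradient (averageObjective F) (centroid (w i ω))‖ ^ 2 ∂P) fun N hN => by
      have h1 := exists_lt_le_of_descent hμ hd₀0 hr hr1 (s := d₁ * μ ^ 2 + μ * (Λ * C))
        (e := fun i => ∫ ω, ‖gradient (averageObjective F) (centroid (w i ω))‖ ^ 2 ∂P)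
        (f := fun i => ∫ ω, averageObjective F (centroid (w i ω)) ∂P)
        (fun i => (hdesc i).trans (le_of_eq (by rw [hd₀, hd₁]; ring))) hlow hN
      simp only [h0] at h1
      exact h1
  exact ⟨⟨i, ⟨h.integrable_gradient_sq hF hK i, hi⟩, hi'⟩,
    j, ⟨h.integrable_gradient_sq hF hK j, hj⟩, hj'⟩

end NoisyDiffusion

/-! ### Dif-MAML as a noisy diffusion on the adjusted objectives. -/

section DifMAML

variable {K M : ℕ} {T X : Fin K → Type*} [∀ k, MeasurableSpace (T k)] [∀ k, MeasurableSpace (X k)]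
  {π : ∀ k, Measure (T k)} [∀ k, IsProbabilityMeasure (π k)]
  {D : ∀ k, Kernel (T k) (X k)} [∀ k, IsMarkovKernel (D k)]
  {Q : ∀ k, T k → Param M → X k → ℝ} {L ρ B σG σH γG γH : ℝ}
  (h : ∀ k, AgentAssumptions (π k) (D k) (Q k) L ρ B σG σH γG γH) {n m : ℕ} {b : Fin K → ℕ}
  {α μ : ℝ} {A : Matrix (Fin K) (Fin K) ℝ} {w₀ : Fin K → Param M}

theorem measurable_mix : Measurable (mix A : (Fin K → Param M) → Fin K → Param M) := by
  have h1 : Continuous (mix A : (Fin K → Param M) → Fin K → Param M) := by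
    unfold mix
    fun_prop
  exact h1.measurable

include h in
theorem measurable_metaGradients : Measurable
    fun p : (Fin K → Param M) × (∀ k, Fin (b k) → TaskSample (T k) (X k) n m) =>
      fun k => metaGradient α (Q k) (p.2 k) (p.1 k) := by
  refine measurable_pi_lambda _ fun k => ?_
  have h1 : Measurable
      fun p : (Fin K → Param M) × (∀ k, Fin (b k) → TaskSample (T k) (X k) n m) =>
        (p.1 k, p.2 k) := by fun_prop
  have h2 := (h k).measurable_metaGradient (α := α).comp h1
  exact h2

include h in
/-- The `i`-th iterate is a measurable function of the first `i` samples. -/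
theorem exists_difMAML_eq (i : ℕ) :
    ∃ W : ((j : Finset.range i) → ∀ k, Fin (b k) → TaskSample (T k) (X k) n m) →
      Fin K → Param M, Measurable W ∧ ∀ z, difMAML α μ A Q w₀ z i = W fun j => z j := by
  induction i with
  | zero => exact ⟨fun _ => w₀, measurable_const, fun z => rfl⟩
  | succ i ih =>
    obtain ⟨W, hW, hz⟩ := ih
    obtain ⟨V, hV⟩ : ∃ V : ((j : Finset.range (i + 1)) → ∀ k, Fin (b k) →
        TaskSample (T k) (X k) n m) → Fin K → Param M, V = fun t => W fun j =>
          t ⟨j, Finset.range_mono i.le_succ j.2⟩ := ⟨_, rfl⟩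
    have hVm : Measurable V := by
      rw [hV]
      exact hW.comp (measurable_pi_lambda _ fun j => measurable_pi_apply _)
    have h1 := (measurable_metaGradients h (α := α)).comp
      (hVm.prodMk (measurable_pi_apply ⟨i, Finset.self_mem_range_succ i⟩))
    refine ⟨_, measurable_mix (A := A).comp (hVm.sub (h1.const_smul μ)), fun z => ?_⟩
    simp only [difMAML, hz, hV]
    rfl

variable {Ω : Type*} [MeasurableSpace Ω] {P : Measure Ω} [IsProbabilityMeasure P]
  {Z : ℕ → Ω → ∀ k, Fin (b k) → TaskSample (T k) (X k) n m}

include h in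
theorem measurable_difMAML (hZ : IsSampling P π D Z) (i : ℕ) :
    Measurable fun ω => difMAML α μ A Q w₀ (fun j => Z j ω) i := by
  obtain ⟨W, hW, hz⟩ := exists_difMAML_eq h (α := α) (μ := μ) (A := A) (w₀ := w₀)
    (n := n) (m := m) (b := b) i
  simp only [hz]
  exact hW.comp (measurable_pi_lambda _ fun j => hZ.measurable j)

include h in
/-- The current iterate is independent of the fresh samples. -/
theorem map_difMAML_prodMk (hZ : IsSampling P π D Z) (i : ℕ) (k : Fin K) :
    P.map (fun ω => (difMAML α μ A Q w₀ (fun j => Z j ω) i, Z i ω k))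
      = (P.map fun ω => difMAML α μ A Q w₀ (fun j => Z j ω) i).prod
        (Measure.pi fun _ : Fin (b k) => taskSampleLaw n m (π k) (D k)) := by
  have hw := measurable_difMAML h (α := α) (μ := μ) (A := A) (w₀ := w₀) hZ i
  have hk : Measurable fun ω => Z i ω k := (measurable_pi_apply k).comp (hZ.measurable i)
  rw [← hZ.law i k, ← indepFun_iff_map_prod_eq_prod_map_map hw.aemeasurable hk.aemeasurable]
  obtain ⟨W, hW, hz⟩ := exists_difMAML_eq h (α := α) (μ := μ) (A := A) (w₀ := w₀)
    (n := n) (m := m) (b := b) i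
  -- Past iterations and the present one are disjoint blocks of an independent family; independence
  -- across agents plays no role.
  have h1 := hZ.indep.indepFun_finset (Finset.range i) {i} (by simp) hZ.measurable
  have h2 := h1.comp hW ((measurable_pi_apply k).comp
    (measurable_pi_apply (⟨i, Finset.mem_singleton_self i⟩ : ({i} : Finset ℕ))))
  simp only [hz]
  exact h2

include h in
/-- Dif-MAML is a stochastic gradient diffusion strategy on the adjusted objectives. -/
theorem noisyDiffusion_difMAML (hn : 0 < n) (hm : 0 < m) (hb : ∀ k, 0 < b k) (hα : 0 ≤ α)
    {C : ℝ} (hC : ∀ k, 3 * (C1sq α L B σG σH n m + C2sq α L B γG γH) / b k ≤ C)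
    (hZ : IsSampling P π D Z) :
    NoisyDiffusion P A μ (fun k => adjustedObjective α n (π k) (D k) (Q k)) C w₀
      (fun i ω => difMAML α μ A Q w₀ (fun j => Z j ω) i)
      (fun i ω k => metaGradient α (Q k) (Z i ω k)
        (difMAML α μ A Q w₀ (fun j => Z j ω) i k)) := by
  have hw := measurable_difMAML h (α := α) (μ := μ) (A := A) (w₀ := w₀) hZ
  have hmap := map_difMAML_prodMk h (α := α) (μ := μ) (A := A) (w₀ := w₀) hZ
  have hcont : ∀ k, Continuous (gradient (adjustedObjective α n (π k) (D k) (Q k))) := fun k =>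
    (LipschitzWith.of_dist_le_mul (K := Real.toNNReal (Lhat α L ρ B)) fun w u => by
      rw [dist_eq_norm, dist_eq_norm]
      exact ((h k).lipschitz_gradient_adjustedObjective hn hα w u).trans
        (by gcongr; exact Real.le_coe_toNNReal _)).continuous
  have hpair : ∀ i k, Measurable
      fun ω => (difMAML α μ A Q w₀ (fun j => Z j ω) i, Z i ω k) := fun i k =>
    (hw i).prodMk ((measurable_pi_apply k).comp (hZ.measurable i))
  obtain ⟨s, hs⟩ : ∃ s : ∀ k, (Fin K → Param M) × (Fin (b k) → TaskSample (T k) (X k) n m) →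
      Param M, s = fun k p => metaGradient α (Q k) p.2 (p.1 k)
        - gradient (adjustedObjective α n (π k) (D k) (Q k)) (p.1 k) := ⟨_, rfl⟩
  have hsm : ∀ k, Measurable (s k) := fun k => by
    have h1 : Measurable fun p : (Fin K → Param M) × (Fin (b k) → TaskSample (T k) (X k) n m) =>
        (p.1 k, p.2) := by fun_prop
    have h2 := (h k).measurable_metaGradient (α := α).comp h1
    have h3 := (hcont k).measurable.comp (measurable_fst.comp h1)
    rw [hs]
    exact h2.sub h3
  -- Under the product law the iterate can be frozen, and the variance bound for a fixed parameter
  -- applies.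
  have hprod : ∀ i k, ExpectationLE ((P.map fun ω => difMAML α μ A Q w₀ (fun j => Z j ω) i).prod
      (Measure.pi fun _ : Fin (b k) => taskSampleLaw n m (π k) (D k)))
      (fun p => ‖s k p‖ ^ 2) C := fun i k => by
    have := Measure.isProbabilityMeasure_map (μ := P) (hw i).aemeasurable
    refine ExpectationLE.prod (k := fun _ => C) ((hsm k).norm.pow_const 2)
      (fun p => by positivity) (fun u => ?_) ⟨integrable_const _, by simp⟩
    rw [hs]
    exact ((h k).metaGradient_variance hn hm (hb k) hα (u k)).trans (hC k)
  refine ⟨fun ω => rfl, fun i ω => rfl, hw, fun i => ?_, fun i k => ?_, fun i k φ hφ hR => ?_⟩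
  · have h1 := (measurable_metaGradients h (α := α)).comp ((hw i).prodMk (hZ.measurable i))
    exact h1
  · have h1 := hprod i k
    rw [← hmap i k] at h1
    have h2 := (integrable_map_measure ((hsm k).norm.pow_const 2).aestronglyMeasurable
      (hpair i k).aemeasurable).1 h1.1
    have h3 := integral_map (hpair i k).aemeasurable
      ((hsm k).norm.pow_const 2).aestronglyMeasurable (μ := P)
    have h4 := h3.symm.trans_le h1.2
    rw [hs] at h2 h4
    exact ⟨h2, h4⟩
  · obtain ⟨R, hR⟩ := hR
    have hprob := Measure.isProbabilityMeasure_map (μ := P) (hw i).aemeasurable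
    have hm1 : Measurable fun p : (Fin K → Param M) × (Fin (b k) → TaskSample (T k) (X k) n m) =>
        inner ℝ (φ p.1) (s k p) := (hφ.measurable.comp measurable_fst).inner (hsm k)
    have h3 := integral_map (hpair i k).aemeasurable hm1.aestronglyMeasurable (μ := P)
    have hL2 := (memLp_two_iff_integrable_sq_norm (hsm k).aestronglyMeasurable).2 (hprod i k).1
    have hint : Integrable (fun p => inner ℝ (φ p.1) (s k p))
        ((P.map fun ω => difMAML α μ A Q w₀ (fun j => Z j ω) i).prod
          (Measure.pi fun _ : Fin (b k) => taskSampleLaw n m (π k) (D k))) :=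
      ((hL2.integrable one_le_two).norm.const_mul R).mono' hm1.aestronglyMeasurable
        (.of_forall fun p => (norm_inner_le_norm _ _).trans
          (mul_le_mul_of_nonneg_right (hR _) (norm_nonneg _)))
    rw [hmap i k, integral_prod _ hint] at h3
    -- For a frozen iterate the noise has mean zero, so the integral over the fresh samples already
    -- vanishes.
    have h4 : ∀ u, ∫ z, inner ℝ (φ u) (s k (u, z))
        ∂(Measure.pi fun _ : Fin (b k) => taskSampleLaw n m (π k) (D k)) = 0 := fun u => by
      have h5 := (h k).integrable_metaGradient (b := b k) hn hm hα (u k)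
      have h6 := integral_sub h5
        (integrable_const (gradient (adjustedObjective α n (π k) (D k) (Q k)) (u k)))
      rw [(h k).integral_metaGradient hn hm (hb k) hα, integral_const, probReal_univ, one_smul,
        sub_self] at h6
      have h7 := integral_inner (𝕜 := ℝ) (h5.sub
        (integrable_const (gradient (adjustedObjective α n (π k) (D k) (Q k)) (u k)))) (φ u)
      simp only [Pi.sub_apply] at h7
      rw [h6, inner_zero_right] at h7
      rw [hs]
      exact h7
    simp only [h4, integral_zero] at h3
    rw [hs] at h3
    exact h3.symm

end DifMAML

/-- The variance is taken about the true gradient, so the contribution of `C3` is not needed and is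
discarded as nonnegative. -/
theorem three_mul_div_le_noiseConst (α L B σG σH γG γH : ℝ) (n m : ℕ) {K : ℕ} (b : Fin K → ℕ)
    (k : Fin K) :
    3 * (C1sq α L B σG σH n m + C2sq α L B γG γH) / b k
      ≤ noiseConst α L B σG σH γG γH n m b := by
  refine le_trans ?_ (le_ciSup (Set.finite_range _).bddAbove k)
  have h1 : 0 ≤ 3 / (b k : ℝ) * C3 α L B σG σH γG γH n ^ 2 := by positivity
  calc _ = 3 / (b k : ℝ) * (C1sq α L B σG σH n m + C2sq α L B γG γH) := by ring
    _ ≤ _ := by linarith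

theorem noiseConst_nonneg {α L B σG σH γG γH : ℝ} (hα : 0 ≤ α) (hL : 0 ≤ L) (n m : ℕ) {K : ℕ}
    (b : Fin K → ℕ) : 0 ≤ noiseConst α L B σG σH γG γH n m b := by
  refine Real.iSup_nonneg fun k => ?_
  unfold C1sq C2sq
  positivity

theorem theorem2
    {K M : ℕ} (hK : 0 < K)
    {T : Fin K → Type*} {X : Fin K → Type*}
    [∀ k, MeasurableSpace (T k)] [∀ k, MeasurableSpace (X k)]
    (π : ∀ k, Measure (T k)) [∀ k, IsProbabilityMeasure (π k)]
    (D : ∀ k, Kernel (T k) (X k)) [∀ k, IsMarkovKernel (D k)]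
    (Q : ∀ k, T k → Param M → X k → ℝ)
    (hQ : ∀ k, RegularLoss (π k) (D k) (Q k))
    -- inner step size, task batch sizes, inner and outer data batch sizes
    (α : ℝ) (hα : 0 < α)
    (b : Fin K → ℕ) (hb : ∀ k, 0 < b k)
    (n m : ℕ) (hn : 0 < n) (hm : 0 < m)
    -- constants and assumptions on the losses, the tasks and the combination matrix
    (L ρ B σG σH γG γH : ℝ) (hL : 0 ≤ L) (hρ : 0 ≤ ρ) (hB : 0 ≤ B)
    (hσG : 0 ≤ σG) (hσH : 0 ≤ σH) (hγG : 0 ≤ γG) (hγH : 0 ≤ γH)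
    (h1 : ∀ k, LipschitzGradients (D k) (Q k) L)
    (h2 : ∀ k, LipschitzHessians (D k) (Q k) ρ)
    (h3 : ∀ k, BoundedGradients (D k) (Q k) B)
    (h4 : ∀ k, BoundedNoiseMoments (D k) (Q k) σG σH)
    (h5 : ∀ k, BoundedTaskVariability (π k) (D k) (Q k) γG γH)
    (A : Matrix (Fin K) (Fin K) ℝ) (h6 : CombinationMatrix A)
    -- the aggregate adjusted objective is bounded below
    (Jo : ℝ) (hJo : ∀ w, Jo ≤ aggregateObjective α n π D Q w)
    -- initial launch models
    (w₀ : Fin K → Param M) :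
    Differentiable ℝ (aggregateObjective α n π D Q) ∧
    -- the constants in the O-terms do not depend on the outer step size `μ`
    ∃ c μ₀ : ℝ, 0 < μ₀ ∧ ∀ μ : ℝ, 0 < μ → μ ≤ μ₀ →
      ∀ {Ω : Type*} [MeasurableSpace Ω] (P : Measure Ω) [IsProbabilityMeasure P]
        (Z : ℕ → Ω → ∀ k, Fin (b k) → TaskSample (T k) (X k) n m), IsSampling P π D Z →
        -- an `O(μ)`-mean-square-stationary point is reached in at most `O(1/μ²)` iterations
        (∃ i : ℕ,
          ExpectationLE P
            (fun ω => ‖gradient (aggregateObjective α n π D Q)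
              (centroid (difMAML α μ A Q w₀ (fun j => Z j ω) i))‖ ^ 2) (c * μ) ∧
          (i : ℝ) ≤ c / μ ^ 2) ∧
        -- with explicit leading constants
        (∃ i : ℕ,
          ExpectationLE P
            (fun ω => ‖gradient (aggregateObjective α n π D Q)
              (centroid (difMAML α μ A Q w₀ (fun j => Z j ω) i))‖ ^ 2)
            (2 * μ * Lhat α L ρ B * noiseConst α L B σG σH γG γH n m b + c * μ ^ 2) ∧
          (0 < Lhat α L ρ B * noiseConst α L B σG σH γG γH n m b →
            (i : ℝ) ≤ 2 * (aggregateObjective α n π D Q (centroid w₀) - Jo)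
                / (Lhat α L ρ B * noiseConst α L B σG σH γG γH n m b) * (1 / μ ^ 2)
              + c / μ)) := by
  have h := fun k => AgentAssumptions.of_assumptions (hQ k) hL (h1 k) (h2 k) (h3 k) (h4 k) (h5 k)
  have hF : SmoothObjectives (fun k => adjustedObjective α n (π k) (D k) (Q k)) (B * (1 + α * L))
      (Lhat α L ρ B) :=
    ⟨fun k => (h k).differentiable_adjustedObjective hn hα.le,
      fun k => (h k).norm_gradient_adjustedObjective_le hn hα.le,
      fun k => (h k).lipschitz_gradient_adjustedObjective hn hα.le⟩
  have hΛ : 0 ≤ Lhat α L ρ B := by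
    unfold Lhat
    positivity
  -- `aggregateObjective` is by definition the `averageObjective` of the adjusted objectives, so the
  -- general results apply verbatim.
  refine ⟨hF.differentiable_average, ?_⟩
  obtain ⟨c, μ₀, hμ₀, hc⟩ := NoisyDiffusion.exists_stationary h6 hF hΛ
    (noiseConst_nonneg (B := B) (σG := σG) (σH := σH) (γG := γG) (γH := γH) hα.le hL n m b) hJo w₀
  refine ⟨c, μ₀, hμ₀, fun μ hμ hμ₀ {Ω} _ P _ Z hZ => ?_⟩
  have h7 := hc μ hμ hμ₀ P _ _ (noisyDiffusion_difMAML h hn hm hb hα.le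
    (three_mul_div_le_noiseConst α L B σG σH γG γH n m b) hZ)
  simp only [← mul_assoc (2 * μ)] at h7
  exact h7
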